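/- **Setting.** Let $\mathbb F$ be a finite field, $m\ge 1$, $A_1,\dots,A_m\subseteq\mathbb F$, $\mathcal A=A_1\times\cdots\times A_m$, $a=\max_i|A_i|$, and let $\vec d=(d_1,\dots,d_m)\in\mathbb N^m$ satisfy $d_i\ge 2(|A_i|-1)$ for all $i$. Write $\mathbb F^{\le m}=\bigcup_{i=0}^m\mathbb F^i$ and $\bar{\mathcal A}=\bigcup_{i=0}^m A_1\times\cdots\times A_i\subseteq\mathbb F^{\le m}$. For $w\colon\mathbb F^m\to\mathbb F$ let $\Sigma[w](x)=\sum_{y\in A_{|x|+1}\times\cdots\times A_m}w(x,y)$ for $x\in\mathbb F^{\le m}$; for $F\colon\mathcal A\to\mathbb F$ define $\Sigma[F]\colon\bar{\mathcal A}\to\mathbb F$ by the same formula. Let $\mathsf{ENC}$ be the randomised encoding that maps the message $\Sigma[F]$, $F\colon\mathcal A\to\mathbb F$, to a uniformly random element of $\{\Sigma[\hat F]\}$, where $\hat F$ ranges over the polynomials in $m$ variables over $\mathbb F$ of degree at most $d_i$ in the $i$-th variable for every $i$ that agree with $F$ on $\mathcal A$. **Theorem.** $\mathsf{ENC}$ is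 a linear randomised encoding, i.e. $\mathsf{ENC}(M)$ is distributed as $\mathsf{ENC}(M;\mu)$ for some function $\mathsf{ENC}(M;\mu)$ that is $\mathbb F$-linear in $(M,\mu)$, with $\mu$ uniform in $\mathbb F^r$ for some $r$. Moreover, there are a single algorithm $\mathsf{CL}$ and a single polynomial $p$ such that for all $\mathbb F,m,\vec d,\mathcal A$ as above and every $I\subseteq\mathbb F^{\le m}$ with $n=|I|$, the algorithm $\mathsf{CL}$, given $m$, $\vec d$, and lists of the elements of each $A_i$ and of $I$, halts within time $$t(n)=p(\lfloor\log_2|\mathbb F|\rfloor,\,m,\,\max_i d_i,\,n)$$ and outputs a set $R\subseteq\bar{\mathcal A}$ with $$|R|\le \ell(n)=n\,m\,(m(a+1)+1)^2$$ and a matrix $Z\in\mathbb F^{k\times(R\sqcup I)}$ (for some $k$) such that for every message $M$ and every $\vec\beta\in\mathbb F^I$, $$(M|_R,\vec\beta)\in\ker Z\iff\text{there is }\mu\text{ with }\mathsf{ENC}(M;\mu)|_I=\vec\beta.$$ Here an algorithm is one fixed program (independent of the field) for a deterministic random access machine over $\mathbb F$, whose memory cells hold natural numbers or elements of $\mathbb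 F$. Elementary operations on natural numbers (constants, addition, truncated subtraction, comparison, reading and writing) cost $1$, and elementary operations on elements of $\mathbb F$ (constants, arithmetic, inversion, zero test, reading and writing) cost the square of the bit length of $|\mathbb F|$. -/

import Mathlib

/-! ### A random access machine over a field

Programs are written in a small imperative language over a two-sorted memory: finitely many banks
of natural-number cells and finitely many banks of `F`-valued cells (only the banks named in the
program text can be touched), with computed (indirect) addressing. A program does not mention the
field, so one and the same program runs over every finite field. -/

/-- The memory: the cell `(i, j)` of bank `b` is `nat b i j` (a natural number) or `fld b i j`
(a field element). -/
structure Mem (F : Type*) where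
  nat : ℕ → ℕ → ℕ → ℕ
  fld : ℕ → ℕ → ℕ → F

/-- Overwrite one natural-number cell. -/
def Mem.setNat {F : Type*} (σ : Mem F) (b i j v : ℕ) : Mem F where
  nat := fun b' i' j' => if b' = b ∧ i' = i ∧ j' = j then v else σ.nat b' i' j'
  fld := σ.fld

/-- Overwrite one field cell. -/
def Mem.setFld {F : Type*} (σ : Mem F) (b i j : ℕ) (v : F) : Mem F where
  nat := σ.nat
  fld := fun b' i' j' => if b' = b ∧ i' = i ∧ j' = j then v else σ.fld b' i' j'

/-- Natural-number expressions: constants, memory reads, addition and truncated subtraction. -/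
inductive NExp : Type where
  | lit (c : ℕ)
  | get (b : ℕ) (i j : NExp)
  | add (x y : NExp)
  | sub (x y : NExp)

/-- Field expressions: the constants `0` and `1`, memory reads and the field operations. -/
inductive FExp : Type where
  | zero
  | one
  | get (b : ℕ) (i j : NExp)
  | add (x y : FExp)
  | sub (x y : FExp)
  | mul (x y : FExp)
  | inv (x : FExp)

/-- Branching conditions: comparison of numbers and zero test in the field. -/
inductive Test : Type where
  | lt (x y : NExp)
  | isZero (x : FExp)

/-- Programs. -/
inductive Prog : Type where
  | skip
  | setNat (b : ℕ) (i j e : NExp)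
  | setFld (b : ℕ) (i j : NExp) (e : FExp)
  | seq (p q : Prog)
  | ite (c : Test) (p q : Prog)
  | while (c : Test) (p : Prog)

/-- Value of a natural-number expression. -/
def NExp.eval {F : Type*} (σ : Mem F) : NExp → ℕ
  | .lit c => c
  | .get b i j => σ.nat b (i.eval σ) (j.eval σ)
  | .add x y => x.eval σ + y.eval σ
  | .sub x y => x.eval σ - y.eval σ

/-- Value of a field expression (`0⁻¹ = 0`). -/
def FExp.eval {F : Type*} [Field F] (σ : Mem F) : FExp → F
  | .zero => 0
  | .one => 1
  | .get b i j => σ.fld b (i.eval σ) (j.eval σ)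
  | .add x y => x.eval σ + y.eval σ
  | .sub x y => x.eval σ - y.eval σ
  | .mul x y => x.eval σ * y.eval σ
  | .inv x => (x.eval σ)⁻¹

/-- Truth of a branching condition. -/
def Test.Holds {F : Type*} [Field F] (σ : Mem F) : Test → Prop
  | .lt x y => x.eval σ < y.eval σ
  | .isZero x => x.eval σ = 0

/-- Every elementary operation on natural numbers costs one unit. There is no multiplication of
numbers, so within `t` steps their bit length grows by at most `O(t)`. -/
def NExp.cost : NExp → ℕ
  | .lit _ => 1
  | .get _ i j => i.cost + j.cost + 1
  | .add x y => x.cost + y.cost + 1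
  | .sub x y => x.cost + y.cost + 1

/-- Every elementary operation on field elements costs `w` units. -/
def FExp.cost (w : ℕ) : FExp → ℕ
  | .zero => w
  | .one => w
  | .get _ i j => i.cost + j.cost + w
  | .add x y => x.cost w + y.cost w + w
  | .sub x y => x.cost w + y.cost w + w
  | .mul x y => x.cost w + y.cost w + w
  | .inv x => x.cost w + w

/-- Cost of evaluating a branching condition. -/
def Test.cost (w : ℕ) : Test → ℕ
  | .lt x y => x.cost + y.cost + 1
  | .isZero x => x.cost w + w

/-- The price of one elementary operation in `F`: the square of the bit length of `|F|`
(schoolbook arithmetic). -/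
def fieldCost (F : Type*) [Fintype F] : ℕ := (Nat.size (Fintype.card F)) ^ 2

/-- `Runs p σ τ t`: started in memory `σ`, the program `p` halts in memory `τ` after time
exactly `t`. -/
inductive Runs {F : Type*} [Field F] [Fintype F] : Prog → Mem F → Mem F → ℕ → Prop where
  | skip (σ : Mem F) : Runs .skip σ σ 1
  | setNat (σ : Mem F) (b : ℕ) (i j e : NExp) :
      Runs (.setNat b i j e) σ (σ.setNat b (i.eval σ) (j.eval σ) (e.eval σ))
        (i.cost + j.cost + e.cost + 1)
  | setFld (σ : Mem F) (b : ℕ) (i j : NExp) (e : FExp) :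
      Runs (.setFld b i j e) σ (σ.setFld b (i.eval σ) (j.eval σ) (e.eval σ))
        (i.cost + j.cost + e.cost (fieldCost F) + fieldCost F)
  | seq {p q : Prog} {σ τ ρ : Mem F} {s t : ℕ} :
      Runs p σ τ s → Runs q τ ρ t → Runs (.seq p q) σ ρ (s + t)
  | iteTrue {c : Test} {p q : Prog} {σ τ : Mem F} {t : ℕ} :
      c.Holds σ → Runs p σ τ t → Runs (.ite c p q) σ τ (c.cost (fieldCost F) + t)
  | iteFalse {c : Test} {p q : Prog} {σ τ : Mem F} {t : ℕ} :
      ¬ c.Holds σ → Runs q σ τ t → Runs (.ite c p q) σ τ (c.cost (fieldCost F) + t)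
  | whileTrue {c : Test} {p : Prog} {σ τ ρ : Mem F} {s t : ℕ} :
      c.Holds σ → Runs p σ τ s → Runs (.while c p) τ ρ t →
        Runs (.while c p) σ ρ (c.cost (fieldCost F) + s + t)
  | whileFalse {c : Test} {p : Prog} {σ : Mem F} :
      ¬ c.Holds σ → Runs (.while c p) σ σ (c.cost (fieldCost F))

/-! ### Linear randomised encodings and constraint systems -/

/-- A randomised encoding function with message space `msg ⊆ F^S` and codewords in `F^D`:
it sends a message to a random codeword. -/
abbrev RandEnc {F S D : Type*} [Field F] (msg : Submodule F (S → F)) : Type _ :=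
  msg → PMF (D → F)

/-- A presentation of `enc` as a linear randomised encoding: a map `ENC(M; μ)`, linear in the
message and the randomness `μ ∈ F^r` jointly, such that `enc M` is the law of `ENC(M; μ)` for
uniformly random `μ`. -/
structure LinearForm {F S D : Type*} [Field F] [Fintype F] {msg : Submodule F (S → F)}
    (enc : RandEnc (D := D) msg) where
  r : ℕ
  ENC : (msg × (Fin r → F)) →ₗ[F] (D → F)
  law : ∀ M : msg, enc M = (PMF.uniformOfFintype (Fin r → F)).map (fun μ => ENC (M, μ))

/-- `(R, Z)` describes all constraints between the message and the codeword on `I`: for every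
message `M` and every `β ∈ F^I`, the vector `(M|_R, β)` lies in `ker Z` iff `ENC(M; μ)|_I = β`
for some randomness `μ`. -/
def IsConstraintSystem {F S D : Type*} [Field F] [Fintype F] {msg : Submodule F (S → F)}
    {enc : RandEnc (D := D) msg} (E : LinearForm enc) (I : Finset D) (R : Finset S) {k : ℕ}
    (Z : Matrix (Fin k) (R ⊕ I) F) : Prop :=
  ∀ (M : msg) (β : I → F),
    Z.mulVec (Sum.elim (fun s : R => (M : S → F) s) β) = 0 ↔
      ∃ μ : Fin E.r → F, (fun x : I => E.ENC (M, μ) x) = β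

/-! ### Subcube sums of low-degree extensions -/

section SumRM

variable {F : Type*} [Field F] [Fintype F] {m : ℕ}

/-- The set `F^{≤ m}` of vectors of length at most `m` (including the empty one). -/
abbrev Pt (F : Type*) (m : ℕ) : Type _ := Σ i : Fin (m + 1), (Fin i → F)

/-- The vectors `(x, y)` of length `m` with `y ∈ A_{|x|+1} × ⋯ × A_m`. -/
def completions (A : Fin m → Finset F) (x : Pt F m) : Finset (Fin m → F) :=
  Fintype.piFinset fun j : Fin m => if h : (j : ℕ) < x.1 then {x.2 ⟨j, h⟩} else A j

/-- The word `Σ_A[w]` of subcube sums of `w`, as a linear map in `w`. -/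
def sumWord (A : Fin m → Finset F) : ((Fin m → F) → F) →ₗ[F] (Pt F m → F) where
  toFun w := fun x => ∑ z ∈ completions A x, w z
  map_add' := fun v w => by
    funext x
    simp [Finset.sum_add_distrib]
  map_smul' := fun c w => by
    funext x
    simp [Finset.mul_sum]

/-- The union of the prefix products `A_1 × ⋯ × A_i` over `0 ≤ i ≤ m`. -/
abbrev SumDom (A : Fin m → Finset F) : Type _ :=
  {x : Pt F m // ∀ j : Fin x.1, x.2 j ∈ A ⟨j, by omega⟩}

/-- The message space: all words of subcube sums, indexed by the prefix products, of functions on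
`A = A_1 × ⋯ × A_m` (at such an index only values on `A` are summed, so it does not matter that
`w` ranges over functions on the whole of `F^m`). -/
def sumMessages (A : Fin m → Finset F) : Submodule F (SumDom A → F) :=
  LinearMap.range
    ((LinearMap.funLeft F F (Subtype.val : SumDom A → Pt F m)).comp (sumWord A))

/-- The function on `A` whose subcube sums a message consists of: its entries of full length. -/
def underlying (A : Fin m → Finset F) (M : sumMessages A)
    (z : {z : Fin m → F // ∀ j, z j ∈ A j}) : F :=
  (M : SumDom A → F) ⟨⟨Fin.last m, z.1⟩, fun j => z.2 j⟩

/-- The low-degree extensions of `f`: polynomials of degree at most `d i` in the variable `i`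
which agree with `f` on `A`. -/
def lowDegExt (A : Fin m → Finset F) (d : Fin m → ℕ)
    (f : {z : Fin m → F // ∀ j, z j ∈ A j} → F) : Set (MvPolynomial (Fin m) F) :=
  {p | (∀ i, p.degreeOf i ≤ d i) ∧ ∀ z, MvPolynomial.eval z.1 p = f z}

theorem lowDegExt_nonempty (A : Fin m → Finset F) (d : Fin m → ℕ)
    (hd : ∀ i, (A i).card ≤ d i + 1) (f : {z : Fin m → F // ∀ j, z j ∈ A j} → F) :
    (lowDegExt A d f).Nonempty := by
  classical
  let L : (Fin m → F) → MvPolynomial (Fin m) F := fun w =>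
    ∏ i, ∏ a ∈ (A i).erase (w i), (MvPolynomial.C ((w i - a)⁻¹) *
      (MvPolynomial.X i - MvPolynomial.C a))
  have hdeg : ∀ (w : Fin m → F), (∀ j, w j ∈ A j) → ∀ k, (L w).degreeOf k ≤ d k := by
    intro w hw k
    refine (MvPolynomial.degreeOf_prod_le k Finset.univ _).trans ?_
    have key : ∀ i, MvPolynomial.degreeOf k (∏ a ∈ (A i).erase (w i),
        (MvPolynomial.C ((w i - a)⁻¹) * (MvPolynomial.X i - MvPolynomial.C a))) ≤
        if i = k then d k else 0 := by
      intro i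
      refine (MvPolynomial.degreeOf_prod_le k _ _).trans ?_
      have h1 : ∀ a ∈ (A i).erase (w i), MvPolynomial.degreeOf k
          (MvPolynomial.C ((w i - a)⁻¹) * (MvPolynomial.X i - MvPolynomial.C a)) ≤
          if i = k then 1 else 0 := by
        intro a _
        refine (MvPolynomial.degreeOf_C_mul_le _ _ _).trans ?_
        refine (MvPolynomial.degreeOf_sub_le _ _ _).trans ?_
        rw [MvPolynomial.degreeOf_C, MvPolynomial.degreeOf_X]
        by_cases h : i = k
        · simp [h]
        · simp [h, Ne.symm h]
      refine (Finset.sum_le_sum h1).trans ?_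
      rw [Finset.sum_const, Finset.card_erase_of_mem (hw i)]
      have := hd i
      by_cases h : i = k
      · subst h
        simp
        omega
      · simp [h]
    refine (Finset.sum_le_sum fun i _ => key i).trans ?_
    simp
  have heval : ∀ (w z : Fin m → F), (∀ j, z j ∈ A j) →
      MvPolynomial.eval z (L w) = if z = w then 1 else 0 := by
    intro w z hz
    simp only [L, map_prod, map_mul, MvPolynomial.eval_C, map_sub, MvPolynomial.eval_X]
    split_ifs with h
    · subst h
      refine Finset.prod_eq_one fun i _ => Finset.prod_eq_one fun a ha => ?_
      exact inv_mul_cancel₀ (sub_ne_zero.2 (Finset.ne_of_mem_erase ha).symm)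
    · obtain ⟨i, hi⟩ := Function.ne_iff.1 h
      refine Finset.prod_eq_zero (Finset.mem_univ i) ?_
      refine Finset.prod_eq_zero (Finset.mem_erase.2 ⟨hi, hz i⟩) ?_
      simp
  refine ⟨∑ w : {z : Fin m → F // ∀ j, z j ∈ A j}, MvPolynomial.C (f w) * L w.1, ?_, ?_⟩
  · intro k
    refine (MvPolynomial.degreeOf_sum_le _ _ _).trans (Finset.sup_le fun w _ => ?_)
    exact (MvPolynomial.degreeOf_C_mul_le _ _ _).trans (hdeg w.1 w.2 k)
  · intro z
    simp only [map_sum, map_mul, MvPolynomial.eval_C]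
    rw [Finset.sum_eq_single z]
    · rw [heval _ _ z.2]
      simp
    · intro w _ hw
      rw [heval _ _ z.2, if_neg, mul_zero]
      exact fun h => hw (Subtype.ext h.symm)
    · simp

/-- The set `Σ_A[LD_d[f]]` of subcube-sum words of the low-degree extensions of `f`. -/
noncomputable def extensionWords (A : Fin m → Finset F) (d : Fin m → ℕ)
    (f : {z : Fin m → F // ∀ j, z j ∈ A j} → F) : Finset (Pt F m → F) :=
  (Set.toFinite ((fun p : MvPolynomial (Fin m) F =>
    sumWord A (fun z => MvPolynomial.eval z p)) '' lowDegExt A d f)).toFinset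

theorem extensionWords_nonempty (A : Fin m → Finset F) (d : Fin m → ℕ)
    (hd : ∀ i, (A i).card ≤ d i + 1) (f : {z : Fin m → F // ∀ j, z j ∈ A j} → F) :
    (extensionWords A d f).Nonempty := by
  rw [extensionWords, Set.Finite.toFinset_nonempty]
  exact (lowDegExt_nonempty A d hd f).image _

/-- The encoding: the message `Σ_A[f]` is sent to a uniformly random element of
`Σ_A[LD_d[f]]`. -/
noncomputable def sumRMEnc (A : Fin m → Finset F) (d : Fin m → ℕ)
    (hd : ∀ i, (A i).card ≤ d i + 1) : RandEnc (D := Pt F m) (sumMessages A) :=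
  fun M => PMF.uniformOfFinset (extensionWords A d (underlying A M))
    (extensionWords_nonempty A d hd _)

/-! ### Input and output conventions -/

/-- The initial memory: `m` and `|I|` in the cells `(0,0)` and `(0,1)` of number bank `0`;
`d_i` and `|A_i|` in the cells `(i,0)` and `(i,1)` of number bank `1`; the length of the `l`-th
point of `I` in the cell `(l,0)` of number bank `2`; the elements of `A_i` in row `i` of field
bank `0`; the coordinates of the `l`-th point of `I` in row `l` of field bank `1`; zero in all
other cells. -/
def inputMem (d : Fin m → ℕ) (A : Fin m → Finset F) (eA : ∀ i, Fin (A i).card ≃ A i)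
    (I : Finset (Pt F m)) (eI : Fin I.card ≃ I) : Mem F where
  nat := fun b i j =>
    match b with
    | 0 => if i = 0 ∧ j = 0 then m else if i = 0 ∧ j = 1 then I.card else 0
    | 1 => if h : i < m then
        (if j = 0 then d ⟨i, h⟩ else if j = 1 then (A ⟨i, h⟩).card else 0) else 0
    | 2 => if h : i < I.card then (if j = 0 then ((eI ⟨i, h⟩).1.1 : ℕ) else 0) else 0
    | _ => 0
  fld := fun b i j =>
    match b with
    | 0 => if h : i < m then
        (if h' : j < (A ⟨i, h⟩).card then (eA ⟨i, h⟩ ⟨j, h'⟩ : F) else 0) else 0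
    | 1 => if h : i < I.card then
        (if h' : j < (eI ⟨i, h⟩).1.1 then (eI ⟨i, h⟩).1.2 ⟨j, h'⟩ else 0) else 0
    | _ => 0

/-- The memory `τ` holds the pair `(R, Z)`: `|R|` and the number `k` of rows of `Z` in the cells
`(0,0)` and `(0,1)` of number bank `3`; for some listing of `R`, the length of its `l`-th point in
the cell `(l,0)` of number bank `4` and the coordinates of that point in row `l` of field bank `2`;
the matrix `Z` in field bank `3`, with the columns of `R` first and those of `I` after them, in the
order of the two listings. -/
def HoldsOutput {A : Fin m → Finset F} (τ : Mem F) (I : Finset (Pt F m)) (eI : Fin I.card ≃ I)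
    (R : Finset (SumDom A)) {k : ℕ} (Z : Matrix (Fin k) (R ⊕ I) F) : Prop :=
  τ.nat 3 0 0 = R.card ∧ τ.nat 3 0 1 = k ∧
    ∃ eR : Fin R.card ≃ R,
      (∀ l : Fin R.card, τ.nat 4 l 0 = ((eR l).1.1.1 : ℕ) ∧
        ∀ j : Fin (eR l).1.1.1, τ.fld 2 l j = (eR l).1.1.2 j) ∧
      ∀ i : Fin k, (∀ l : Fin R.card, τ.fld 3 i l = Z i (Sum.inl (eR l))) ∧
        ∀ l : Fin I.card, τ.fld 3 i (R.card + l) = Z i (Sum.inr (eI l))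

/-- The program `P`, given `m`, `d` and (a listing of) each `A_i`, is a `(t, ℓ)`-constraint locator
for the encoding `sumRMEnc A d hd`: this is a linear randomised encoding, and, given a listing of
any `I ⊆ F^{≤ m}`, the program halts within time `t(|I|)` and outputs a set `R` of at most
`ℓ(|I|)` message positions and a matrix `Z` that describes the constraints on `I`. -/
def IsSumRMConstraintLocator (P : Prog) (A : Fin m → Finset F)
    (eA : ∀ i, Fin (A i).card ≃ A i) (d : Fin m → ℕ) (hd : ∀ i, (A i).card ≤ d i + 1)
    (t ℓ : ℕ → ℕ) : Prop :=
  Nonempty (LinearForm (sumRMEnc A d hd)) ∧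
    ∀ (I : Finset (Pt F m)) (eI : Fin I.card ≃ I),
      ∃ (R : Finset (SumDom A)) (k : ℕ) (Z : Matrix (Fin k) (R ⊕ I) F) (τ : Mem F) (s : ℕ),
        Runs P (inputMem d A eA I eI) τ s ∧ s ≤ t I.card ∧ HoldsOutput τ I eI R Z ∧
        R.card ≤ ℓ I.card ∧
        ∀ E : LinearForm (sumRMEnc A d hd), IsConstraintSystem E I R Z

end SumRM

/-!
Fix `I` with `n = |I|`. Call a function on `A` *invisible* if its sums over the subcubes of `R`
vanish. The set `R` has to be chosen so that every invisible function has an extension of degree at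
most `d` whose subcube sums on `I` vanish: then `β` is the restriction of a codeword of the message
`M` iff `(M|_R, β)` is the restriction to `R ⊔ I` of the subcube sums of *some* polynomial of degree
at most `d`, since two such polynomials with the same sums on `R` differ on `A` by an invisible
function (`isConstraintSystem_of_ker`). The matrix `Z` is a parity check of the space of these
restrictions.

*The set `R`.* Give every prefix `κ` in `A_1 × ⋯ × A_l` the vector of the values, at the points of
`I` (padded by zeros), of its Lagrange polynomial `∏ (X_i - b)` over `i ≤ l` and
`b ∈ A_i \ {κ_i}`. Search the tree of all prefixes level by level, where on each level a prefix is
only expanded if its vector is not in the span of the vectors expanded before it. At most `n`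
prefixes per level are expanded, and `R` consists of all prefixes visited, so that
`|R| ≤ 1 + m n a`. An invisible function is extended from each visited subcube separately, and
expanded prefixes are handled by their children (`extendsFrom_of_mem_level`). If `κ` is not
expanded, then subtracting from its Lagrange polynomial the linear combination that represents its
vector gives a polynomial `q` which vanishes on `I`, but is nonzero on the subcube of `κ`. The
product of `q`, the Lagrange polynomial of `κ`, and an interpolation in the variables after the
first `l` has degree at most `2 (|A_i| - 1) ≤ d_i`, and its sums on `I` vanish: at short points the
sum over the subcube reduces to the sum of the invisible function over the subcube of `κ`, which is
in `R`; at long points `q` vanishes (`extendsFrom_of_notMem_greedy`).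

*The matrix `Z`.* The space of restrictions to `R ⊔ I` is spanned by the subcube sums of monomials,
whose entries are products of powers and power sums (`span_vec_powerSumFactor`). These product
vectors are exponentially many, but the same search, now over exponent tuples, visits few of them
and still spans everything (`Trie.spanOf_level`). Along the way the algorithm maintains a square
matrix whose kernel is the span of the vectors accepted so far; one elimination step adds a vector
to the kernel (`Matrix.ker_mulVecLin_sub_clear`). Membership in the span is then a matrix-vector
product.

*The algorithm.* One program `searchP` performs both searches. All loops are counting loops
(`Exec.exists_loop`), so that a bound on the numbers of iterations gives a bound on the running time
that is computed from the program text (`Prog.bound`) and is a polynomial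
(`Prog.exists_bound_eq_eval`).

That the encoding is linear in message and randomness is linear algebra: a linear section of the
restriction of polynomials of low degree to `A`, plus a parametrisation of its kernel
(`nonempty_linearForm`).
-/

/-! ### Execution with a static time bound -/

namespace Mem

variable {F : Type*}

@[simp] theorem setNat_nat (σ : Mem F) (b i j v b' i' j' : ℕ) :
    (σ.setNat b i j v).nat b' i' j' = if b' = b ∧ i' = i ∧ j' = j then v else σ.nat b' i' j' := rfl

@[simp] theorem setNat_fld (σ : Mem F) (b i j v : ℕ) : (σ.setNat b i j v).fld = σ.fld := rfl

@[simp] theorem setFld_nat (σ : Mem F) (b i j : ℕ) (v : F) : (σ.setFld b i j v).nat = σ.nat := rfl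

@[simp] theorem setFld_fld (σ : Mem F) (b i j : ℕ) (v : F) (b' i' j' : ℕ) :
    (σ.setFld b i j v).fld b' i' j' = if b' = b ∧ i' = i ∧ j' = j then v else σ.fld b' i' j' := rfl

theorem setNat_nat_of_ne (σ : Mem F) {b b' : ℕ} (h : b' ≠ b) (i j v : ℕ) :
    (σ.setNat b i j v).nat b' = σ.nat b' := by
  funext i' j'
  simp [h]

theorem setFld_fld_of_ne (σ : Mem F) {b b' : ℕ} (h : b' ≠ b) (i j : ℕ) (v : F) :
    (σ.setFld b i j v).fld b' = σ.fld b' := by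
  funext i' j'
  simp [h]

end Mem

namespace Prog

/-- An upper bound for the running time of `p` if every loop makes at most `M` iterations each time
it is entered and field operations cost `w`. -/
def bound (w M : ℕ) : Prog → ℕ
  | skip => 1
  | setNat _ i j e => i.cost + j.cost + e.cost + 1
  | setFld _ i j e => i.cost + j.cost + e.cost w + w
  | seq p q => p.bound w M + q.bound w M
  | ite c p q => c.cost w + (p.bound w M + q.bound w M)
  | .while c p => (M + 1) * (c.cost w + p.bound w M)

/-- The text of the program contains no assignment to the number bank `b`. -/
@[simp] def KeepsNat (b : ℕ) : Prog → Prop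
  | skip => True
  | setNat b' _ _ _ => b ≠ b'
  | setFld _ _ _ _ => True
  | seq p q => p.KeepsNat b ∧ q.KeepsNat b
  | ite _ p q => p.KeepsNat b ∧ q.KeepsNat b
  | .while _ p => p.KeepsNat b

/-- The text of the program contains no assignment to the field bank `b`. -/
@[simp] def KeepsFld (b : ℕ) : Prog → Prop
  | skip => True
  | setNat _ _ _ _ => True
  | setFld b' _ _ _ => b ≠ b'
  | seq p q => p.KeepsFld b ∧ q.KeepsFld b
  | ite _ p q => p.KeepsFld b ∧ q.KeepsFld b
  | .while _ p => p.KeepsFld b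

/-- The scalar number variable `b`: the cell `(0,0)` of the number bank `b`. -/
abbrev var (b : ℕ) : NExp := .get b (.lit 0) (.lit 0)

/-- Assignment to the scalar number variable `b`. -/
abbrev setVar (b : ℕ) (e : NExp) : Prog := .setNat b (.lit 0) (.lit 0) e

/-- The scalar field variable `b`: the cell `(0,0)` of the field bank `b`. -/
abbrev fvar (b : ℕ) : FExp := .get b (.lit 0) (.lit 0)

/-- Assignment to the scalar field variable `b`. -/
abbrev setFvar (b : ℕ) (e : FExp) : Prog := .setFld b (.lit 0) (.lit 0) e

/-- The loop `for b := 0, …, e - 1 do p`. -/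
def loop (b : ℕ) (e : NExp) (p : Prog) : Prog :=
  .seq (setVar b (.lit 0)) (.while (.lt (var b) e) (.seq p (setVar b (.add (var b) (.lit 1)))))

@[simp] theorem keepsNat_loop {b c : ℕ} {e : NExp} {p : Prog} :
    (loop c e p).KeepsNat b ↔ b ≠ c ∧ p.KeepsNat b := by
  simp [loop]
  tauto

@[simp] theorem keepsFld_loop {b c : ℕ} {e : NExp} {p : Prog} :
    (loop c e p).KeepsFld b ↔ p.KeepsFld b := by
  simp [loop]

end Prog

infixr:60 ";;" => Prog.seq

section SameOff

variable {F : Type*}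

/-- The memories `σ` and `τ` agree on all banks to which the program `p` does not assign. -/
structure SameOff (p : Prog) (σ τ : Mem F) : Prop where
  nat : ∀ b, p.KeepsNat b → τ.nat b = σ.nat b
  fld : ∀ b, p.KeepsFld b → τ.fld b = σ.fld b

theorem SameOff.refl (p : Prog) (σ : Mem F) : SameOff p σ σ := ⟨fun _ _ => rfl, fun _ _ => rfl⟩

theorem SameOff.trans {p : Prog} {σ τ ρ : Mem F} (h : SameOff p σ τ) (h' : SameOff p τ ρ) :
    SameOff p σ ρ :=
  ⟨fun b hb => (h'.nat b hb).trans (h.nat b hb), fun b hb => (h'.fld b hb).trans (h.fld b hb)⟩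

theorem SameOff.mono {p q : Prog} {σ τ : Mem F} (h : SameOff p σ τ)
    (hn : ∀ b, q.KeepsNat b → p.KeepsNat b) (hf : ∀ b, q.KeepsFld b → p.KeepsFld b) :
    SameOff q σ τ :=
  ⟨fun b hb => h.nat b (hn b hb), fun b hb => h.fld b (hf b hb)⟩

end SameOff

section Exec

variable {F : Type*} [Field F] [Fintype F]

/-- `Exec M p σ τ`: started in `σ`, the program `p` halts in `τ` within the time that its text
allows for when every loop makes at most `M` iterations. -/
def Exec (M : ℕ) (p : Prog) (σ τ : Mem F) : Prop :=
  ∃ s, Runs p σ τ s ∧ s ≤ p.bound (fieldCost F) M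

theorem Runs.sameOff {p : Prog} {σ τ : Mem F} {t : ℕ} (h : Runs p σ τ t) : SameOff p σ τ := by
  induction h with
  | skip σ => exact .refl _ _
  | setNat σ b i j e => exact ⟨fun b' hb => σ.setNat_nat_of_ne hb _ _ _, fun _ _ => rfl⟩
  | setFld σ b i j e => exact ⟨fun _ _ => rfl, fun b' hb => σ.setFld_fld_of_ne hb _ _ _⟩
  | seq _ _ ih₁ ih₂ =>
    exact SameOff.trans (ih₁.mono (fun _ h => And.left h) fun _ h => And.left h)
      (ih₂.mono (fun _ h => And.right h) fun _ h => And.right h)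
  | iteTrue _ _ ih => exact ih.mono (fun _ h => And.left h) fun _ h => And.left h
  | iteFalse _ _ ih => exact ih.mono (fun _ h => And.right h) fun _ h => And.right h
  | whileTrue _ _ _ ih₁ ih₂ => exact SameOff.trans (ih₁.mono (fun _ h => h) fun _ h => h) ih₂
  | whileFalse _ => exact .refl _ _

namespace Exec

variable {M : ℕ} {p q : Prog} {σ τ ρ : Mem F}

theorem sameOff (h : Exec M p σ τ) : SameOff p σ τ := h.choose_spec.1.sameOff

theorem natEq (h : Exec M p σ τ) (b : ℕ) (hb : p.KeepsNat b) : τ.nat b = σ.nat b :=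
  h.sameOff.nat b hb

theorem fldEq (h : Exec M p σ τ) (b : ℕ) (hb : p.KeepsFld b) : τ.fld b = σ.fld b :=
  h.sameOff.fld b hb

theorem skip : Exec M .skip σ σ := ⟨_, .skip σ, le_rfl⟩

theorem setNat (b : ℕ) (i j e : NExp) :
    Exec M (.setNat b i j e) σ (σ.setNat b (i.eval σ) (j.eval σ) (e.eval σ)) :=
  ⟨_, .setNat σ b i j e, le_rfl⟩

theorem setFld (b : ℕ) (i j : NExp) (e : FExp) :
    Exec M (.setFld b i j e) σ (σ.setFld b (i.eval σ) (j.eval σ) (e.eval σ)) :=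
  ⟨_, .setFld σ b i j e, le_rfl⟩

theorem seq (h : Exec M p σ τ) (h' : Exec M q τ ρ) : Exec M (p ;; q) σ ρ := by
  obtain ⟨s, hs, hs'⟩ := h
  obtain ⟨t, ht, ht'⟩ := h'
  exact ⟨s + t, .seq hs ht, add_le_add hs' ht'⟩

theorem iteTrue {c : Test} (hc : c.Holds σ) (h : Exec M p σ τ) : Exec M (.ite c p q) σ τ := by
  obtain ⟨s, hs, hs'⟩ := h
  refine ⟨_, .iteTrue hc hs, ?_⟩
  simp only [Prog.bound]
  omega

theorem iteFalse {c : Test} (hc : ¬ c.Holds σ) (h : Exec M q σ τ) : Exec M (.ite c p q) σ τ := by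
  obtain ⟨s, hs, hs'⟩ := h
  refine ⟨_, .iteFalse hc hs, ?_⟩
  simp only [Prog.bound]
  omega

/-- The rule for counting loops. The body may use the value `k` of the loop variable, the invariant,
and that nothing has happened to the banks without assignments in the loop. -/
theorem exists_loop {b : ℕ} {e : NExp} {Q : Mem F → Prop} (N : ℕ) (Inv : ℕ → Mem F → Prop) (hN : N ≤ M)
    (hb : p.KeepsNat b)
    (he : ∀ σ', SameOff (Prog.loop b e p) σ σ' → e.eval σ' = N)
    (h0 : Inv 0 (σ.setNat b 0 0 0))
    (step : ∀ k < N, ∀ σ', SameOff (Prog.loop b e p) σ σ' → σ'.nat b 0 0 = k → Inv k σ' →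
      ∃ τ, Exec M p σ' τ ∧ Inv (k + 1) (τ.setNat b 0 0 (k + 1)))
    (hQ : ∀ τ, Exec M (Prog.loop b e p) σ τ → Inv N τ → Q τ) :
    ∃ τ, Exec M (Prog.loop b e p) σ τ ∧ Q τ := by
  have key : ∀ r k, k + r = N → ∀ σ', SameOff (Prog.loop b e p) σ σ' → σ'.nat b 0 0 = k →
      Inv k σ' → ∃ τ s, Runs (.while (.lt (Prog.var b) e)
        (.seq p (Prog.setVar b (.add (Prog.var b) (.lit 1))))) σ' τ s ∧ Inv N τ ∧
        s ≤ (r + 1) * ((Test.lt (Prog.var b) e).cost (fieldCost F) +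
          (p ;; Prog.setVar b (.add (Prog.var b) (.lit 1))).bound (fieldCost F) M) := by
    intro r
    induction r with
    | zero =>
      intro k hk σ' hσ hkσ hI
      refine ⟨σ', _, .whileFalse ?_, ?_, ?_⟩
      · simp [Test.Holds, NExp.eval, he σ' hσ, hkσ]
        omega
      · obtain rfl : k = N := by omega
        exact hI
      · simp
    | succ r ih =>
      intro k hk σ' hσ hkσ hI
      obtain ⟨τ, hτ, hI'⟩ := step k (by omega) σ' hσ hkσ hI
      have hτ' : τ.nat b 0 0 = k := by rw [hτ.natEq b hb, hkσ]
      have hset := Exec.setNat (M := M) (σ := τ) b (.lit 0) (.lit 0) (.add (Prog.var b) (.lit 1))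
      simp only [NExp.eval, hτ'] at hset
      obtain ⟨s, hs, hs'⟩ := hτ.seq hset
      have hsame : SameOff (Prog.loop b e p) σ (τ.setNat b 0 0 (k + 1)) :=
        hσ.trans (SameOff.mono hs.sameOff (fun _ h => h.2) fun _ h => h.2)
      obtain ⟨ρ, t, ht, hIρ, htb⟩ := ih (k + 1) (by omega) _ hsame (by simp) hI'
      refine ⟨ρ, _, .whileTrue ?_ hs ht, hIρ, ?_⟩
      · simp [Test.Holds, NExp.eval, he σ' hσ, hkσ]
        omega
      · rw [add_mul _ 1, one_mul, add_comm]
        refine add_le_add htb ?_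
        exact add_le_add le_rfl hs'
  have hset := Exec.setNat (M := M) (σ := σ) b (.lit 0) (.lit 0) (.lit 0)
  simp only [NExp.eval] at hset
  obtain ⟨τ, s, hs, hI, hsb⟩ := key N 0 (by omega) (σ.setNat b 0 0 0)
    (SameOff.mono hset.sameOff (fun _ h => h.1) fun _ h => h.1) (by simp) h0
  have h := hset.seq ⟨s, hs, hsb.trans (Nat.mul_le_mul_right _ (by omega))⟩
  exact ⟨τ, h, hQ τ h hI⟩

end Exec

end Exec

theorem FExp.exists_cost_eq_eval (e : FExp) :
    ∃ P : MvPolynomial (Fin 2) ℕ, ∀ w M, MvPolynomial.eval ![w, M] P = e.cost w := by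
  induction e with
  | zero => exact ⟨.X 0, by simp [cost]⟩
  | one => exact ⟨.X 0, by simp [cost]⟩
  | get b i j => exact ⟨.C (i.cost + j.cost) + .X 0, by simp [cost]⟩
  | add x y hx hy =>
    obtain ⟨P, hP⟩ := hx
    obtain ⟨Q, hQ⟩ := hy
    exact ⟨P + Q + .X 0, by simp [cost, hP, hQ]⟩
  | sub x y hx hy =>
    obtain ⟨P, hP⟩ := hx
    obtain ⟨Q, hQ⟩ := hy
    exact ⟨P + Q + .X 0, by simp [cost, hP, hQ]⟩
  | mul x y hx hy =>
    obtain ⟨P, hP⟩ := hx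
    obtain ⟨Q, hQ⟩ := hy
    exact ⟨P + Q + .X 0, by simp [cost, hP, hQ]⟩
  | inv x hx =>
    obtain ⟨P, hP⟩ := hx
    exact ⟨P + .X 0, by simp [cost, hP]⟩

theorem Test.exists_cost_eq_eval (c : Test) :
    ∃ P : MvPolynomial (Fin 2) ℕ, ∀ w M, MvPolynomial.eval ![w, M] P = c.cost w := by
  cases c with
  | lt x y => exact ⟨.C (x.cost + y.cost + 1), by simp [cost]⟩
  | isZero x =>
    obtain ⟨P, hP⟩ := x.exists_cost_eq_eval
    exact ⟨P + .X 0, by simp [cost, hP]⟩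

/-- The static time bound of a program is a polynomial in the cost of a field operation and the
bound on the number of iterations. -/
theorem Prog.exists_bound_eq_eval : ∀ p : Prog,
    ∃ P : MvPolynomial (Fin 2) ℕ, ∀ w M, MvPolynomial.eval ![w, M] P = p.bound w M
  | .skip => ⟨1, by simp [bound]⟩
  | .setNat b i j e => ⟨.C (i.cost + j.cost + e.cost + 1), by simp [bound]⟩
  | .setFld b i j e => by
    obtain ⟨P, hP⟩ := e.exists_cost_eq_eval
    exact ⟨.C (i.cost + j.cost) + P + .X 0, by simp [bound, hP]⟩
  | .seq p q => by
    obtain ⟨P, hP⟩ := p.exists_bound_eq_eval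
    obtain ⟨Q, hQ⟩ := q.exists_bound_eq_eval
    exact ⟨P + Q, by simp [bound, hP, hQ]⟩
  | .ite c p q => by
    obtain ⟨P, hP⟩ := p.exists_bound_eq_eval
    obtain ⟨Q, hQ⟩ := q.exists_bound_eq_eval
    obtain ⟨S, hS⟩ := c.exists_cost_eq_eval
    exact ⟨S + (P + Q), by simp [bound, hP, hQ, hS]⟩
  | .while c p => by
    obtain ⟨P, hP⟩ := p.exists_bound_eq_eval
    obtain ⟨S, hS⟩ := c.exists_cost_eq_eval
    exact ⟨(.X 1 + 1) * (S + P), by simp [bound, hP, hS]⟩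

/-! ### Greedy search in a tree of product vectors -/

namespace Trie

variable {F : Type*} [Field F]

section Defs

variable (φ : ℕ → ℕ → ℕ → F) (K : ℕ → ℕ) (N : ℕ)

/-- The product vector of a tuple `κ` of choices: its entry at `x` is the product of the factors
`φ i κ_i x`. -/
def vec (κ : List ℕ) : Fin N → F := fun x => ∏ i ∈ Finset.range κ.length, φ i (κ.getD i 0) x

/-- The span of the product vectors of the tuples in a list. -/
def spanOf (L : List (List ℕ)) : Submodule F (Fin N → F) :=
  Submodule.span F (vec φ N '' {κ | κ ∈ L})

open Classical in
/-- Append a tuple to a list unless its product vector is redundant. -/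
noncomputable def insert (L : List (List ℕ)) (κ : List ℕ) : List (List ℕ) :=
  if vec φ N κ ∈ spanOf φ N L then L else L ++ [κ]

/-- The tuples of a list that survive when, from left to right, those with redundant product
vectors are dropped. -/
noncomputable def greedy (L : List (List ℕ)) : List (List ℕ) := L.foldl (insert φ N) []

/-- The extensions of a tuple by one more choice; `K i` is the number of choices at position `i`. -/
def children (κ : List ℕ) : List (List ℕ) := (List.range (K κ.length)).map fun k => κ ++ [k]

/-- The tuples of length `l` that the search visits: the extensions of the surviving tuples of
length `l - 1`. There is nothing to search for if the vectors have no entries. -/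
noncomputable def level : ℕ → List (List ℕ)
  | 0 => if N = 0 then [] else [[]]
  | l + 1 => (greedy φ N (level l)).flatMap (children K)

/-- The tuples of length at most `l` that the search visits. -/
noncomputable def upTo : ℕ → List (List ℕ)
  | 0 => level φ K N 0
  | l + 1 => upTo l ++ level φ K N (l + 1)

/-- All tuples of length `l`. -/
def full (l : ℕ) : Set (List ℕ) := {κ | κ.length = l ∧ ∀ i < l, κ.getD i 0 < K i}

end Defs

variable {φ : ℕ → ℕ → ℕ → F} {K : ℕ → ℕ} {N : ℕ}

theorem vec_append_singleton (κ : List ℕ) (k : ℕ) :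
    vec φ N (κ ++ [k]) = fun x => vec φ N κ x * φ κ.length k x := by
  funext x
  simp only [vec, List.length_append, List.length_singleton, Finset.prod_range_succ]
  congr 1
  · refine Finset.prod_congr rfl fun i hi => ?_
    rw [List.getD_append _ _ _ _ (Finset.mem_range.1 hi)]
  · simp

theorem spanOf_append_singleton (L : List (List ℕ)) (κ : List ℕ) :
    spanOf φ N (L ++ [κ]) = spanOf φ N L ⊔ Submodule.span F {vec φ N κ} := by
  rw [spanOf, spanOf, ← Submodule.span_union]
  congr 1
  ext v
  simp [or_and_right, exists_or, eq_comm, or_comm]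

theorem spanOf_nil : spanOf φ N [] = ⊥ := by simp [spanOf]

theorem vec_mem_spanOf {L : List (List ℕ)} {κ : List ℕ} (h : κ ∈ L) :
    vec φ N κ ∈ spanOf φ N L :=
  Submodule.subset_span ⟨κ, h, rfl⟩

theorem insert_of_mem {L : List (List ℕ)} {κ : List ℕ} (h : vec φ N κ ∈ spanOf φ N L) :
    insert φ N L κ = L :=
  if_pos h

theorem insert_of_notMem {L : List (List ℕ)} {κ : List ℕ} (h : vec φ N κ ∉ spanOf φ N L) :
    insert φ N L κ = L ++ [κ] :=
  if_neg h

theorem spanOf_insert (L : List (List ℕ)) (κ : List ℕ) :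
    spanOf φ N (insert φ N L κ) = spanOf φ N L ⊔ Submodule.span F {vec φ N κ} := by
  rw [insert]
  split_ifs with h
  · exact (sup_eq_left.2 ((Submodule.span_singleton_le_iff_mem _ _).2 h)).symm
  · exact spanOf_append_singleton L κ

theorem greedy_nil : greedy φ N [] = [] := rfl

theorem greedy_append_singleton (L : List (List ℕ)) (κ : List ℕ) :
    greedy φ N (L ++ [κ]) = insert φ N (greedy φ N L) κ := by
  simp [greedy]

theorem spanOf_greedy (L : List (List ℕ)) : spanOf φ N (greedy φ N L) = spanOf φ N L := by
  induction L using List.reverseRecOn with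
  | nil => rfl
  | append_singleton L κ ih =>
    rw [greedy_append_singleton, spanOf_insert, ih, spanOf_append_singleton]

theorem greedy_sublist (L : List (List ℕ)) : (greedy φ N L).Sublist L := by
  induction L using List.reverseRecOn with
  | nil => exact List.Sublist.refl _
  | append_singleton L κ ih =>
    rw [greedy_append_singleton, insert]
    split_ifs
    · exact ih.trans (List.sublist_append_left _ _)
    · exact ih.append (List.Sublist.refl _)

theorem length_greedy_le_finrank (L : List (List ℕ)) :
    (greedy φ N L).length ≤ Module.finrank F (spanOf φ N (greedy φ N L)) := by
  induction L using List.reverseRecOn with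
  | nil => simp [greedy_nil]
  | append_singleton L κ ih =>
    rw [greedy_append_singleton]
    by_cases h : vec φ N κ ∈ spanOf φ N (greedy φ N L)
    · rwa [insert_of_mem h]
    · rw [insert_of_notMem h, List.length_append, List.length_singleton, Nat.add_one_le_iff]
      refine ih.trans_lt (Submodule.finrank_lt_finrank_of_lt ?_)
      rw [spanOf_append_singleton]
      refine lt_of_le_of_ne le_sup_left fun h' => h ?_
      rw [h']
      exact Submodule.mem_sup_right (Submodule.mem_span_singleton_self _)

theorem length_greedy_le (L : List (List ℕ)) : (greedy φ N L).length ≤ N :=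
  (length_greedy_le_finrank L).trans ((Submodule.finrank_le _).trans (by simp))

theorem length_of_mem_level {l : ℕ} {κ : List ℕ} (h : κ ∈ level φ K N l) : κ.length = l := by
  induction l generalizing κ with
  | zero =>
    rw [level] at h
    split_ifs at h
    · simp at h
    · simp_all
  | succ l ih =>
    simp only [level, List.mem_flatMap, children, List.mem_map] at h
    obtain ⟨κ', h', k, -, rfl⟩ := h
    simp [ih ((greedy_sublist _).mem h')]

theorem mem_level_succ {l : ℕ} {κ : List ℕ} : κ ∈ level φ K N (l + 1) ↔
    ∃ κ' ∈ greedy φ N (level φ K N l), ∃ k < K l, κ = κ' ++ [k] := by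
  simp only [level, List.mem_flatMap, children, List.mem_map, List.mem_range]
  refine exists_congr fun κ' => and_congr_right fun h => ?_
  rw [length_of_mem_level ((greedy_sublist _).mem h)]
  simp only [eq_comm]

theorem nodup_level (l : ℕ) : (level φ K N l).Nodup := by
  induction l with
  | zero =>
    rw [level]
    split_ifs <;> simp
  | succ l ih =>
    rw [level, List.nodup_flatMap]
    refine ⟨fun κ _ => ?_, ?_⟩
    · exact List.Nodup.map (fun a b h => by simpa using h) List.nodup_range
    · refine ((greedy_sublist _).nodup ih).imp fun {κ κ'} h => ?_
      intro ρ h₁ h₂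
      simp only [children, List.mem_map] at h₁ h₂
      obtain ⟨k, -, rfl⟩ := h₁
      obtain ⟨k', -, h'⟩ := h₂
      exact h ((List.append_inj' h' rfl).1).symm

theorem mem_upTo {l : ℕ} {κ : List ℕ} : κ ∈ upTo φ K N l ↔ ∃ l' ≤ l, κ ∈ level φ K N l' := by
  induction l with
  | zero => simp [upTo]
  | succ l ih =>
    rw [upTo, List.mem_append, ih]
    constructor
    · rintro (⟨l', h, h'⟩ | h)
      · exact ⟨l', by omega, h'⟩
      · exact ⟨_, le_rfl, h⟩
    · rintro ⟨l', h, h'⟩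
      rcases h.lt_or_eq with h | rfl
      · exact .inl ⟨l', by omega, h'⟩
      · exact .inr h'

theorem length_le_of_mem_upTo {l : ℕ} {κ : List ℕ} (h : κ ∈ upTo φ K N l) : κ.length ≤ l := by
  obtain ⟨l', hl, h⟩ := mem_upTo.1 h
  rwa [length_of_mem_level h]

theorem nodup_upTo (l : ℕ) : (upTo φ K N l).Nodup := by
  induction l with
  | zero => exact nodup_level 0
  | succ l ih =>
    refine List.nodup_append'.2 ⟨ih, nodup_level _, fun κ h h' => ?_⟩
    have := length_le_of_mem_upTo h
    have := length_of_mem_level h'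
    omega

theorem filter_upTo (l : ℕ) :
    (upTo φ K N l).filter (fun κ => l ≤ κ.length) = level φ K N l := by
  have hl : (level φ K N l).filter (fun κ => l ≤ κ.length) = level φ K N l :=
    List.filter_eq_self.2 fun κ h => by simp [length_of_mem_level h]
  cases l with
  | zero => exact hl
  | succ l =>
    rw [upTo, List.filter_append, hl, List.filter_eq_nil_iff.2, List.nil_append]
    intro κ h
    have := length_le_of_mem_upTo h
    simp
    omega

theorem length_level_zero_le : (level φ K N 0).length ≤ 1 := by
  rw [level]
  split_ifs <;> simp

theorem length_level_succ_le (l : ℕ) : (level φ K N (l + 1)).length ≤ N * K l := by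
  rw [level, List.length_flatMap]
  refine (List.sum_le_card_nsmul _ (K l) ?_).trans ?_
  · intro n hn
    obtain ⟨κ, hκ, rfl⟩ := List.mem_map.1 hn
    simp [children, length_of_mem_level ((greedy_sublist _).mem hκ)]
  · simpa using Nat.mul_le_mul_right _ (length_greedy_le _)

theorem length_upTo_le (l : ℕ) :
    (upTo φ K N l).length ≤ 1 + ∑ i ∈ Finset.range l, N * K i := by
  induction l with
  | zero => simpa [upTo] using length_level_zero_le
  | succ l ih =>
    rw [upTo, List.length_append, Finset.sum_range_succ, ← add_assoc]
    exact add_le_add ih (length_level_succ_le l)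

theorem mem_full_of_mem_level {l : ℕ} {κ : List ℕ} (hκ : κ ∈ level φ K N l) : κ ∈ full K l := by
  refine ⟨length_of_mem_level hκ, ?_⟩
  induction l generalizing κ with
  | zero => simp
  | succ l ih =>
    intro i hi
    obtain ⟨κ', h', k, hk, rfl⟩ := mem_level_succ.1 hκ
    have h' := (greedy_sublist _).mem h'
    have hlen := length_of_mem_level h'
    rcases (Nat.lt_succ_iff.1 hi).lt_or_eq with hi | rfl
    · rw [List.getD_append _ _ _ _ (by omega)]
      exact ih h' i hi
    · rw [List.getD_append_right _ _ _ _ (by omega)]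
      simpa [hlen] using hk

/-- Redundant prefixes may be dropped: the tuples that the search visits at length `l` span the
same space as all tuples of length `l`. -/
theorem spanOf_level (l : ℕ) :
    spanOf φ N (level φ K N l) = Submodule.span F (vec φ N '' full K l) := by
  rcases Nat.eq_zero_or_pos N with rfl | hN
  · exact Subsingleton.elim _ _
  induction l with
  | zero =>
    rw [spanOf, level, if_neg hN.ne']
    congr 2
    ext κ
    simp [full]
  | succ l ih =>
    refine le_antisymm (Submodule.span_mono (Set.image_mono fun κ hκ => mem_full_of_mem_level hκ))
      (Submodule.span_le.2 ?_)
    rintro _ ⟨κ, ⟨hlen, hκ⟩, rfl⟩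
    obtain ⟨κ, k, rfl⟩ : ∃ κ' k, κ = κ' ++ [k] :=
      ⟨κ.dropLast, κ.getLast (by rintro rfl; simp at hlen),
        (List.dropLast_concat_getLast _).symm⟩
    have hlen : κ.length = l := by simpa using hlen
    have hk : k < K l := by
      have := hκ l (by omega)
      rwa [List.getD_append_right _ _ _ _ (by omega), hlen, Nat.sub_self,
        List.getD_cons_zero] at this
    have hmem : vec φ N κ ∈ spanOf φ N (greedy φ N (level φ K N l)) := by
      rw [spanOf_greedy, ih]
      refine Submodule.subset_span ⟨κ, ⟨hlen, fun i hi => ?_⟩, rfl⟩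
      have := hκ i (by omega)
      rwa [List.getD_append _ _ _ _ (by omega)] at this
    let T : (Fin N → F) →ₗ[F] (Fin N → F) := LinearMap.mulRight F fun x : Fin N => φ l k x
    have hT : Submodule.map T (spanOf φ N (greedy φ N (level φ K N l))) ≤
        spanOf φ N (level φ K N (l + 1)) := by
      rw [spanOf, Submodule.map_span, Submodule.span_le]
      rintro _ ⟨_, ⟨ρ, hρ, rfl⟩, rfl⟩
      have h : T (vec φ N ρ) = vec φ N (ρ ++ [k]) := by
        rw [vec_append_singleton, length_of_mem_level ((greedy_sublist _).mem hρ)]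
        rfl
      rw [h]
      exact vec_mem_spanOf (mem_level_succ.2 ⟨ρ, hρ, k, hk, rfl⟩)
    have h : T (vec φ N κ) = vec φ N (κ ++ [k]) := by
      rw [vec_append_singleton, hlen]
      rfl
    rw [← h]
    exact hT (Submodule.mem_map_of_mem hmem)

end Trie

/-! ### Maintaining a parity-check matrix -/

/-- Enlarging the kernel of a matrix by one vector: if `Z v` does not vanish in the row `p`, then
clearing it with the help of this row enlarges the kernel by exactly `v`. -/
theorem Matrix.ker_mulVecLin_sub_clear {F n : Type*} [Field F] [Fintype n]
    (Z : Matrix n n F) (v : n → F) (p : n) (hp : Z.mulVec v p ≠ 0) :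
    LinearMap.ker (Matrix.of fun i j =>
      Z i j - Z p j * (Z.mulVec v p)⁻¹ * Z.mulVec v i).mulVecLin =
    LinearMap.ker Z.mulVecLin ⊔ Submodule.span F {v} := by
  have key : ∀ u i, (Matrix.of fun i j =>
      Z i j - Z p j * (Z.mulVec v p)⁻¹ * Z.mulVec v i).mulVec u i =
      Z.mulVec u i - (Z.mulVec u p * (Z.mulVec v p)⁻¹) * Z.mulVec v i := by
    intro u i
    simp only [Matrix.mulVec, dotProduct, Matrix.of_apply, sub_mul, Finset.sum_sub_distrib]
    congr 1
    rw [Finset.sum_mul, Finset.sum_mul]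
    exact Finset.sum_congr rfl fun j _ => by ring
  ext u
  rw [Submodule.mem_sup]
  simp only [LinearMap.mem_ker, Matrix.mulVecLin_apply, Submodule.mem_span_singleton]
  constructor
  · intro h
    refine ⟨u - (Z.mulVec u p * (Z.mulVec v p)⁻¹) • v, ?_, _, ⟨_, rfl⟩, sub_add_cancel _ _⟩
    funext i
    have := congrFun h i
    rw [key] at this
    simpa [Matrix.mulVec_sub, Matrix.mulVec_smul] using this
  · rintro ⟨a, ha, _, ⟨c, rfl⟩, rfl⟩
    funext i
    rw [key]
    simp [Matrix.mulVec_add, Matrix.mulVec_smul, ha, hp]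

/-! ### The search program: vectors and the parity-check matrix -/

/- The scalars and arrays of the programs live in separate banks.

Number banks: the rows of `tupA` hold tuples, whose lengths are in column `0` of `lenA`, and `cntV`
is the number of these tuples; `lvlV`, `endV`, `rowV`, `xV`, `iV`, `kV`, `jV`, `tV` are loop bounds
and loop variables; `pivV` is `0` or the successor of a pivot row; `dimV` is the number of entries
of the vectors.

Field banks: `matZ` is the parity-check matrix, row `0` of `vecV` is a vector and row `0` of `vecY`
its image under the matrix; `facF`, `coefF`, `powF` are scalars. -/
local notation "cntV" => 5
local notation "lenA" => 6
local notation "tupA" => 7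
local notation "lvlV" => 8
local notation "endV" => 9
local notation "rowV" => 10
local notation "xV" => 11
local notation "iV" => 12
local notation "kV" => 13
local notation "jV" => 14
local notation "tV" => 15
local notation "pivV" => 16
local notation "dimV" => 17
local notation "matZ" => 3
local notation "vecV" => 4
local notation "vecY" => 5
local notation "facF" => 6
local notation "coefF" => 7
local notation "powF" => 8

namespace Prog

/-- Compute the product vector of the tuple in row `rowV`; the program `fac` computes the factor at
position `iV`, choice `kV` and entry `xV`. -/
def vecP (fac : Prog) : Prog :=
  loop xV (var dimV)
    (.setFld vecV (.lit 0) (var xV) .one ;;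
      loop iV (var lvlV)
        (setVar kV (.get tupA (var rowV) (var iV)) ;; fac ;;
          .setFld vecV (.lit 0) (var xV) (.mul (.get vecV (.lit 0) (var xV)) (fvar facF))))

/-- Multiply the vector by the matrix. -/
def mulVecP : Prog :=
  loop iV (var dimV)
    (.setFld vecY (.lit 0) (var iV) .zero ;;
      loop jV (var dimV)
        (.setFld vecY (.lit 0) (var iV) (.add (.get vecY (.lit 0) (var iV))
          (.mul (.get matZ (var iV) (var jV)) (.get vecV (.lit 0) (var jV))))))

/-- Search for a nonzero entry of the product. -/
def pivotP : Prog :=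
  setVar pivV (.lit 0) ;;
    loop iV (var dimV)
      (.ite (.isZero (.get vecY (.lit 0) (var iV))) .skip (setVar pivV (.add (var iV) (.lit 1))))

/-- Add the vector to the kernel of the matrix. -/
def clearP : Prog :=
  loop jV (var dimV)
    (setFvar coefF (.mul (.get matZ (.sub (var pivV) (.lit 1)) (var jV))
        (.inv (.get vecY (.lit 0) (.sub (var pivV) (.lit 1))))) ;;
      loop iV (var dimV)
        (.setFld matZ (var iV) (var jV) (.sub (.get matZ (var iV) (var jV))
          (.mul (fvar coefF) (.get vecY (.lit 0) (var iV))))))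

/-- Make the matrix the identity matrix. -/
def identP : Prog :=
  loop iV (var dimV)
    (loop jV (var dimV) (.setFld matZ (var iV) (var jV) .zero) ;;
      .setFld matZ (var iV) (var iV) .one)

end Prog

open Prog Finset

attribute [local simp] NExp.eval FExp.eval Test.Holds

/-- The memories `σ` and `τ` agree on the inputs of a search: on the banks of the input and output
conventions, except for the matrix, and on the number of entries of the vectors. -/
structure SameInput {F : Type*} (σ τ : Mem F) : Prop where
  nat : ∀ b ≤ 4, τ.nat b = σ.nat b
  dim : τ.nat dimV = σ.nat dimV
  fld : ∀ b ≤ 2, τ.fld b = σ.fld b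

theorem SameInput.trans {F : Type*} {σ τ ρ : Mem F} (h : SameInput σ τ) (h' : SameInput τ ρ) :
    SameInput σ ρ :=
  ⟨fun b hb => (h'.nat b hb).trans (h.nat b hb), h'.dim.trans h.dim,
    fun b hb => (h'.fld b hb).trans (h.fld b hb)⟩

/-- The program does not assign to the inputs of a search. -/
structure Prog.KeepsInput (p : Prog) : Prop where
  nat : ∀ b ≤ 4, p.KeepsNat b
  dim : p.KeepsNat dimV
  fld : ∀ b ≤ 2, p.KeepsFld b

theorem SameOff.sameInput {F : Type*} {p : Prog} {σ τ : Mem F} (h : SameOff p σ τ)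
    (hp : p.KeepsInput) : SameInput σ τ :=
  ⟨fun b hb => h.nat b (hp.nat b hb), h.nat _ hp.dim, fun b hb => h.fld b (hp.fld b hb)⟩

section Spec

variable {F : Type*} [Field F] [Fintype F] {M : ℕ} {σ : Mem F}

theorem Exec.bind {p q : Prog} {Q : Mem F → Prop} {τ : Mem F} (h : Exec M p σ τ)
    (h' : ∃ ρ, Exec M q τ ρ ∧ Q ρ) : ∃ ρ, Exec M (p ;; q) σ ρ ∧ Q ρ :=
  let ⟨ρ, h₁, h₂⟩ := h'
  ⟨ρ, h.seq h₁, h₂⟩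

/-- The program `fac` computes the factors `φ i k x` in every memory with the same inputs as
`σ₀`. -/
structure Computes (M : ℕ) (fac : Prog) (σ₀ : Mem F) (m N : ℕ) (Kf : ℕ → ℕ)
    (φ : ℕ → ℕ → ℕ → F) : Prop where
  keepsNat : ∀ b, b ≠ jV → b ≠ tV → fac.KeepsNat b
  keepsFld : ∀ b, b ≠ facF → b ≠ powF → fac.KeepsFld b
  exec : ∀ σ, SameInput σ₀ σ → σ.nat iV 0 0 < m →
    σ.nat kV 0 0 < Kf (σ.nat iV 0 0) → σ.nat xV 0 0 < N →
    ∃ τ, Exec M fac σ τ ∧ τ.fld facF 0 0 = φ (σ.nat iV 0 0) (σ.nat kV 0 0) (σ.nat xV 0 0)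

variable {fac : Prog} {σ₀ : Mem F} {m N : ℕ} {Kf : ℕ → ℕ} {φ : ℕ → ℕ → ℕ → F}

theorem Computes.keepsInput_vecP (hfac : Computes M fac σ₀ m N Kf φ) : (vecP fac).KeepsInput := by
  refine ⟨fun b hb => ?_, ?_, fun b hb => ?_⟩
  · simp [vecP, hfac.keepsNat b (by omega) (by omega)]
    omega
  · simp [vecP, hfac.keepsNat]
  · simp [vecP, hfac.keepsFld b (by omega) (by omega)]
    omega

theorem Exec.exists_vecP (hfac : Computes M fac σ₀ m N Kf φ) (hN : N ≤ M) (hm : m ≤ M)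
    (hσ : SameInput σ₀ σ) (hdim : σ.nat dimV 0 0 = N) {κ : List ℕ} {l : ℕ}
    (hκ : κ ∈ Trie.full Kf l) (hl : l ≤ m) (hlvl : σ.nat lvlV 0 0 = l)
    (hrow : ∀ i < l, σ.nat tupA (σ.nat rowV 0 0) i = κ.getD i 0) :
    ∃ τ, Exec M (vecP fac) σ τ ∧ ∀ x : Fin N, τ.fld vecV 0 x = Trie.vec φ N κ x := by
  obtain ⟨hlen, hκ⟩ := hκ
  refine Exec.exists_loop N
    (fun k σ' => ∀ x < k, σ'.fld vecV 0 x = ∏ i ∈ range κ.length, φ i (κ.getD i 0) x) hN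
    (by simp [hfac.keepsNat])
    (fun σ' h => by
      simp [h.nat dimV (by simp [hfac.keepsNat]), hdim])
    (by simp) ?_ fun τ _ h x => h x x.2
  intro x hx σ' hσ' hxσ' hinv
  refine Exec.bind (Exec.setFld _ _ _ _) ?_
  have hs₁ := hσ'.sameInput hfac.keepsInput_vecP
  have hlvl₁ : σ'.nat lvlV = σ.nat lvlV :=
    hσ'.nat _ (by simp [hfac.keepsNat])
  have hrow₁ : σ'.nat rowV = σ.nat rowV :=
    hσ'.nat _ (by simp [hfac.keepsNat])
  have htup₁ : σ'.nat tupA = σ.nat tupA :=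
    hσ'.nat _ (by simp [hfac.keepsNat])
  simp only [NExp.eval, FExp.eval, hxσ']
  refine Exec.exists_loop l
    (fun k σ'' => (∀ x' < x, σ''.fld vecV 0 x' = σ'.fld vecV 0 x') ∧
      σ''.fld vecV 0 x = ∏ i ∈ range k, φ i (κ.getD i 0) x) (hl.trans hm)
    (by simp [hfac.keepsNat])
    (fun σ'' h => by
      simp [h.nat lvlV (by simp [hfac.keepsNat]), hlvl₁, hlvl])
    ?_ ?_ ?_
  · refine ⟨fun x' hx' => ?_, by simp⟩
    simp [hx'.ne]
  · intro i hi σ'' hσ'' hiσ'' ⟨hinv₁, hinv₂⟩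
    refine Exec.bind (Exec.setNat _ _ _ _) ?_
    have hlvl₂ : σ''.nat rowV = σ'.nat rowV :=
      hσ''.nat _ (by simp [hfac.keepsNat])
    have htup₂ : σ''.nat tupA = σ'.nat tupA :=
      hσ''.nat _ (by simp [hfac.keepsNat])
    have hx₂ : σ''.nat xV = σ'.nat xV :=
      hσ''.nat _ (by simp [hfac.keepsNat])
    have hs₂ : SameInput σ' σ'' := by
      refine ⟨fun b hb => (hσ''.nat _ ?_), (hσ''.nat _ ?_), fun b hb => (hσ''.fld _ ?_).trans ?_⟩
      · simp [hfac.keepsNat b (by omega) (by omega)]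
        omega
      · simp [hfac.keepsNat]
      · simp [hfac.keepsFld b (by omega) (by omega)]
        omega
      · exact Mem.setFld_fld_of_ne _ (by omega) _ _ _
    simp only [NExp.eval, hiσ'', hlvl₂, hrow₁, htup₂, htup₁, hrow i hi]
    set ρ := σ''.setNat kV 0 0 (κ.getD i 0) with hρ
    have hρi : ρ.nat iV 0 0 = i := by simp [hρ, hiσ'']
    have hρk : ρ.nat kV 0 0 = κ.getD i 0 := by simp [hρ]
    have hρx : ρ.nat xV 0 0 = x := by simp [hρ, hx₂, hxσ']
    obtain ⟨τ, hτ, hf⟩ := hfac.exec ρ (hσ.trans (hs₁.trans (hs₂.trans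
      ⟨fun b hb => Mem.setNat_nat_of_ne _ (by omega) _ _ _, Mem.setNat_nat_of_ne _ (by simp) _ _ _,
        fun _ _ => rfl⟩))) (by omega) (by rw [hρi, hρk]; exact hκ i hi) (by omega)
    refine Exec.bind hτ ⟨_, Exec.setFld _ _ _ _, ?_⟩
    have hxτ : τ.nat xV 0 0 = x := by rw [hτ.natEq _ (hfac.keepsNat _ (by simp) (by simp)), hρx]
    have hvτ : τ.fld vecV = σ''.fld vecV := by
      rw [hτ.fldEq _ (hfac.keepsFld _ (by simp) (by simp)), hρ]
      rfl
    simp only [NExp.eval, FExp.eval, hxτ, hvτ, hf, hρi, hρk, hρx, hinv₂]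
    refine ⟨fun x' hx' => ?_, ?_⟩
    · simp [hx'.ne, hvτ, hinv₁ x' hx']
    · simp [prod_range_succ]
  · rintro τ hτ ⟨h₁, h₂⟩ x' hx'
    rcases (Nat.lt_succ_iff.1 hx').lt_or_eq with h | rfl
    · simpa using (h₁ x' h).trans (hinv x' h)
    · simpa [hlen] using h₂

/-- The parity-check matrix in a memory. -/
def Mem.mat {F : Type*} (σ : Mem F) (N : ℕ) : Matrix (Fin N) (Fin N) F :=
  .of fun i j => σ.fld matZ i j

/-- The vector in a memory. -/
def Mem.vec {F : Type*} (σ : Mem F) (N : ℕ) : Fin N → F := fun j => σ.fld vecV 0 j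

theorem Exec.exists_mulVecP (hN : N ≤ M) (hdim : σ.nat dimV 0 0 = N) :
    ∃ τ, Exec M mulVecP σ τ ∧
      ∀ i : Fin N, τ.fld vecY 0 i = (σ.mat N).mulVec (σ.vec N) i := by
  refine Exec.exists_loop N
    (fun k σ' => ∀ i < k, σ'.fld vecY 0 i = ∑ j ∈ range N, σ.fld matZ i j * σ.fld vecV 0 j) hN
    (by simp) (fun σ' h => by simp [h.nat dimV (by simp), hdim]) (by simp) ?_
    fun τ _ h i => ?_
  · intro i hi σ' hσ' hiσ' hinv
    refine Exec.bind (Exec.setFld _ _ _ _) ?_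
    have hdim₁ : σ'.nat dimV = σ.nat dimV := hσ'.nat _ (by simp)
    have hZ₁ : σ'.fld matZ = σ.fld matZ := hσ'.fld _ (by simp)
    have hv₁ : σ'.fld vecV = σ.fld vecV := hσ'.fld _ (by simp)
    simp only [NExp.eval, FExp.eval, hiσ']
    refine Exec.exists_loop N (fun k σ'' => (∀ i' < i, σ''.fld vecY 0 i' = σ'.fld vecY 0 i') ∧
        σ''.fld vecY 0 i = ∑ j ∈ range k, σ.fld matZ i j * σ.fld vecV 0 j) hN (by simp)
      (fun σ'' h => by simp [h.nat dimV (by simp), hdim₁, hdim]) ?_ ?_ ?_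
    · refine ⟨fun i' hi' => ?_, by simp⟩
      simp [hi'.ne]
    · intro j hj σ'' hσ'' hjσ'' ⟨hinv₁, hinv₂⟩
      have hi₂ : σ''.nat iV 0 0 = i := by simp [hσ''.nat iV (by simp), hiσ']
      have hZ₂ : σ''.fld matZ = σ.fld matZ := by
        rw [hσ''.fld matZ (by simp), ← hZ₁]
        rfl
      have hv₂ : σ''.fld vecV = σ.fld vecV := by
        rw [hσ''.fld vecV (by simp), ← hv₁]
        rfl
      refine ⟨_, Exec.setFld _ _ _ _, fun i' hi' => ?_, ?_⟩
      · simp [hi₂, hi'.ne, hinv₁ i' hi']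
      · simp [hi₂, hjσ'', hZ₂, hv₂, hinv₂, sum_range_succ]
    · rintro τ - ⟨h₁, h₂⟩ i' hi'
      rcases (Nat.lt_succ_iff.1 hi').lt_or_eq with h | rfl
      · simpa using (h₁ i' h).trans (hinv i' h)
      · simpa using h₂
  · rw [h i i.2, Finset.sum_range]
    rfl

theorem Exec.exists_pivotP (hN : N ≤ M) (hdim : σ.nat dimV 0 0 = N) :
    ∃ τ, Exec M pivotP σ τ ∧ ((τ.nat pivV 0 0 = 0 ∧ ∀ i : Fin N, σ.fld vecY 0 i = 0) ∨
      ∃ p : Fin N, τ.nat pivV 0 0 = p + 1 ∧ σ.fld vecY 0 p ≠ 0) := by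
  refine Exec.bind (Exec.setNat _ _ _ _) (Exec.exists_loop N
    (fun k σ' => (σ'.nat pivV 0 0 = 0 ∧ ∀ i < k, σ.fld vecY 0 i = 0) ∨
      ∃ p : Fin N, σ'.nat pivV 0 0 = p + 1 ∧ σ.fld vecY 0 p ≠ 0) hN (by simp)
    (fun σ' h => by simp [h.nat dimV (by simp), hdim]) (by simp) ?_ fun τ _ h => ?_)
  · intro i hi σ' hσ' hiσ' hinv
    have hy : σ'.fld vecY = σ.fld vecY := hσ'.fld _ (by simp)
    by_cases h : σ.fld vecY 0 i = 0
    · refine ⟨_, Exec.iteTrue (by simpa [hiσ', hy] using h) Exec.skip, ?_⟩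
      refine hinv.imp (fun ⟨h₁, h₂⟩ => ⟨by simpa using h₁, fun i' hi' => ?_⟩)
        fun ⟨p, h₁, h₂⟩ => ⟨p, by simpa using h₁, h₂⟩
      rcases (Nat.lt_succ_iff.1 hi').lt_or_eq with h' | rfl
      exacts [h₂ i' h', h]
    · refine ⟨_, Exec.iteFalse (by simpa [hiσ', hy] using h) (Exec.setNat _ _ _ _), .inr ?_⟩
      exact ⟨⟨i, hi⟩, by simp [hiσ'], h⟩
  · exact h.imp_left fun ⟨h₁, h₂⟩ => ⟨h₁, fun i => h₂ i i.2⟩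

theorem Exec.exists_clearP (hN : N ≤ M) (hdim : σ.nat dimV 0 0 = N) (p : Fin N)
    (hpiv : σ.nat pivV 0 0 = p + 1) (v : Fin N → F)
    (hv : ∀ i : Fin N, σ.fld vecY 0 i = (σ.mat N).mulVec v i)
    (hp : σ.fld vecY 0 p ≠ 0) :
    ∃ τ, Exec M clearP σ τ ∧ LinearMap.ker (τ.mat N).mulVecLin =
      LinearMap.ker (σ.mat N).mulVecLin ⊔ Submodule.span F {v} := by
  refine Exec.exists_loop N (fun k σ' => ∀ i < N, ∀ j < N, σ'.fld matZ i j =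
      if j < k then
        σ.fld matZ i j - σ.fld matZ p j * (σ.fld vecY 0 p)⁻¹ * σ.fld vecY 0 i
      else σ.fld matZ i j) hN (by simp)
    (fun σ' h => by simp [h.nat dimV (by simp), hdim]) (by simp) ?_ fun τ _ h => ?_
  · intro j hj σ' hσ' hjσ' hinv
    have hdim₁ : σ'.nat dimV = σ.nat dimV := hσ'.nat _ (by simp)
    have hpiv₁ : σ'.nat pivV = σ.nat pivV := hσ'.nat _ (by simp)
    have hy₁ : σ'.fld vecY = σ.fld vecY := hσ'.fld _ (by simp)
    refine Exec.bind (Exec.setFld _ _ _ _) ?_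
    simp only [NExp.eval, FExp.eval, hpiv₁, hpiv, hjσ', hy₁, Nat.add_sub_cancel,
      hinv p p.2 j hj, lt_irrefl, if_false]
    refine Exec.exists_loop N (fun k σ'' => ∀ i' < N, ∀ j' < N, σ''.fld matZ i' j' =
        if j' = j ∧ i' < k then
          σ.fld matZ i' j - σ.fld matZ p j * (σ.fld vecY 0 p)⁻¹ * σ.fld vecY 0 i'
        else σ'.fld matZ i' j') hN (by simp)
      (fun σ'' h => by simp [h.nat dimV (by simp), hdim₁, hdim]) (by simp) ?_
      fun τ _ h i' hi' j' hj' => ?_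
    · intro i hi σ'' hσ'' hiσ'' hinv'
      have hj₂ : σ''.nat jV 0 0 = j := by simp [hσ''.nat jV (by simp), hjσ']
      have hy₂ : σ''.fld vecY = σ.fld vecY := by
        rw [hσ''.fld vecY (by simp), ← hy₁]
        rfl
      have hc₂ : σ''.fld coefF 0 0 = σ.fld matZ p j * (σ.fld vecY 0 p)⁻¹ := by
        simp [hσ''.fld coefF (by simp)]
      refine ⟨_, Exec.setFld _ _ _ _, fun i' hi' j' hj' => ?_⟩
      simp only [NExp.eval, FExp.eval, hj₂, hiσ'', hc₂, hy₂, Mem.setNat_fld, Mem.setFld_fld,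
        hinv' i hi j hj, hinv' i' hi' j' hj', hinv i hi j hj, true_and, lt_irrefl, and_false,
        if_false]
      by_cases h₁ : j' = j
      · subst h₁
        rcases lt_trichotomy i' i with h | rfl | h
        · simp [h, h.ne, h.trans (Nat.lt_succ_self i)]
        · simp
        · simp [h.ne', h.not_gt, Nat.not_lt.2 h]
      · simp [h₁]
    · simp only [Mem.setNat_fld, h i' hi' j' hj', hi', and_true, hinv i' hi' j' hj']
      by_cases h₁ : j' = j
      · simp [h₁]
      · have : j' < j + 1 ↔ j' < j := by omega
        simp [h₁, this]
  · rw [← Matrix.ker_mulVecLin_sub_clear _ _ p (by rw [← hv]; exact hp)]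
    congr 2
    ext i j
    have h' := h i i.2 j j.2
    rw [if_pos j.2, hv, hv] at h'
    exact h'

theorem Exec.exists_identP (hN : N ≤ M) (hdim : σ.nat dimV 0 0 = N) :
    ∃ τ, Exec M identP σ τ ∧ LinearMap.ker (τ.mat N).mulVecLin = ⊥ := by
  refine Exec.exists_loop N (fun k σ' => ∀ i < k, ∀ j < N, σ'.fld matZ i j =
      if i = j then 1 else 0) hN (by simp)
    (fun σ' h => by simp [h.nat dimV (by simp), hdim]) (by simp) ?_ fun τ _ h => ?_
  · intro i hi σ' hσ' hiσ' hinv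
    have hdim₁ : σ'.nat dimV = σ.nat dimV := hσ'.nat _ (by simp)
    obtain ⟨τ, hτ, h₁, h₂⟩ := Exec.exists_loop (σ := σ') (M := M) (b := jV) (e := var dimV)
      (p := .setFld matZ (var iV) (var jV) .zero)
      (Q := fun τ => (∀ i' < i, ∀ j' < N, τ.fld matZ i' j' = σ'.fld matZ i' j') ∧
        ∀ j' < N, τ.fld matZ i j' = 0) N
      (fun k σ'' => (∀ i' < i, ∀ j' < N, σ''.fld matZ i' j' = σ'.fld matZ i' j') ∧
        ∀ j' < k, σ''.fld matZ i j' = 0) hN (by simp)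
      (fun σ'' h => by simp [h.nat dimV (by simp), hdim₁, hdim]) (by simp)
      (fun j hj σ'' hσ'' hjσ'' ⟨hinv₁, hinv₂⟩ => by
        have hi₂ : σ''.nat iV 0 0 = i := by rw [hσ''.nat iV (by simp), hiσ']
        refine ⟨_, Exec.setFld _ _ _ _, fun i' hi' j' hj' => ?_, fun j' hj' => ?_⟩
        · simp [hi₂, hi'.ne, hinv₁ i' hi' j' hj']
        · rcases (Nat.lt_succ_iff.1 hj').lt_or_eq with h | rfl
          · simp [h.ne, hjσ'', hinv₂ j' h]
          · simp [hjσ'', hi₂])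
      fun τ _ h => h
    refine Exec.bind hτ ⟨_, Exec.setFld _ _ _ _, fun i' hi' j' hj' => ?_⟩
    have hi₂ : τ.nat iV 0 0 = i := by rw [hτ.natEq iV (by simp), hiσ']
    rcases (Nat.lt_succ_iff.1 hi').lt_or_eq with h | rfl
    · simp [hi₂, h.ne, h₁ i' h j' hj', hinv i' h j' hj']
    · simp [hi₂, h₂ j' hj', eq_comm]
  · have : τ.mat N = 1 := by
      ext i j
      simp [Mem.mat, h i i.2 j j.2, Matrix.one_apply, Fin.ext_iff]
    rw [this, Matrix.mulVecLin_one, LinearMap.ker_id]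

end Spec

/-! ### The search program: the tree of tuples -/

namespace Prog

/-- Append the extensions of the tuple in row `rowV`; `e` is the number of choices. -/
def childP (e : NExp) : Prog :=
  loop kV e
    (loop iV (var lvlV) (.setNat tupA (var cntV) (var iV) (.get tupA (var rowV) (var iV))) ;;
      .setNat tupA (var cntV) (var lvlV) (var kV) ;;
      .setNat lenA (var cntV) (.lit 0) (.add (var lvlV) (.lit 1)) ;;
      setVar cntV (.add (var cntV) (.lit 1)))

/-- Process the tuple in row `rowV`: unless its product vector is in the kernel of the matrix
already, add it to the kernel and append the extensions of the tuple. -/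
def rowP (fac : Prog) (e : NExp) : Prog :=
  vecP fac ;; mulVecP ;; pivotP ;; .ite (.lt (.lit 0) (var pivV)) (clearP ;; childP e) .skip

/-- Process the tuples of length `lvlV`. -/
def levelP (fac : Prog) (e : NExp) : Prog :=
  setVar endV (var cntV) ;; identP ;;
    loop rowV (var endV)
      (.ite (.lt (.get lenA (var rowV) (.lit 0)) (var lvlV)) .skip (rowP fac e))

/-- The greedy search; it starts from the empty tuple if the vectors have at least one entry, and
from no tuple otherwise. -/
def searchP (fac : Prog) (e : NExp) : Prog :=
  setVar cntV (.sub (.lit 1) (.sub (.lit 1) (var dimV))) ;;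
    .setNat lenA (.lit 0) (.lit 0) (.lit 0) ;;
    loop lvlV (.add (.get 0 (.lit 0) (.lit 0)) (.lit 1)) (levelP fac e)

end Prog

/-- The tuple in row `h`. -/
def Mem.tuple {F : Type*} (σ : Mem F) (h : ℕ) : List ℕ :=
  (List.range (σ.nat lenA h 0)).map (σ.nat tupA h)

/-- The list of tuples in a memory. -/
def Mem.tuples {F : Type*} (σ : Mem F) : List (List ℕ) :=
  (List.range (σ.nat cntV 0 0)).map σ.tuple

theorem Mem.length_tuple {F : Type*} (σ : Mem F) (h : ℕ) :
    (σ.tuple h).length = σ.nat lenA h 0 := by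
  simp [Mem.tuple]

theorem Mem.length_tuples {F : Type*} (σ : Mem F) : σ.tuples.length = σ.nat cntV 0 0 := by
  simp [Mem.tuples]

theorem Mem.getD_tuple {F : Type*} (σ : Mem F) {h i : ℕ} (hi : i < σ.nat lenA h 0) :
    (σ.tuple h).getD i 0 = σ.nat tupA h i := by
  simp [Mem.tuple, hi]

theorem Mem.tuple_congr {F : Type*} {σ τ : Mem F} {h : ℕ}
    (hlen : τ.nat lenA h 0 = σ.nat lenA h 0)
    (htup : ∀ i < σ.nat lenA h 0, τ.nat tupA h i = σ.nat tupA h i) : τ.tuple h = σ.tuple h := by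
  rw [Mem.tuple, Mem.tuple, hlen]
  exact List.map_congr_left fun i hi => htup i (List.mem_range.1 hi)

theorem Mem.tuples_congr {F : Type*} {σ τ : Mem F} (hcnt : τ.nat cntV = σ.nat cntV)
    (hlen : τ.nat lenA = σ.nat lenA) (htup : τ.nat tupA = σ.nat tupA) :
    τ.tuples = σ.tuples := by
  simp only [Mem.tuples, hcnt]
  exact List.map_congr_left fun h _ => Mem.tuple_congr (by rw [hlen]) fun i _ => by rw [htup]

theorem Mem.tuples_setNat {F : Type*} (σ : Mem F) {b : ℕ} (hcnt : b ≠ cntV) (hlen : b ≠ lenA)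
    (htup : b ≠ tupA) (i j v : ℕ) : (σ.setNat b i j v).tuples = σ.tuples :=
  Mem.tuples_congr (Mem.setNat_nat_of_ne _ hcnt.symm _ _ _)
    (Mem.setNat_nat_of_ne _ hlen.symm _ _ _) (Mem.setNat_nat_of_ne _ htup.symm _ _ _)

section Spec

variable {F : Type*} [Field F] [Fintype F] {M : ℕ} {σ : Mem F} {fac : Prog} {σ₀ : Mem F} {m N : ℕ}
  {Kf : ℕ → ℕ} {φ : ℕ → ℕ → ℕ → F} {e : NExp}

theorem Exec.exists_childP {l c : ℕ} (hl : l ≤ M) (hlvl : σ.nat lvlV 0 0 = l)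
    (he : ∀ σ', SameOff (childP e) σ σ' → e.eval σ' = c) (hc : c ≤ M)
    (hrow : σ.nat rowV 0 0 < σ.nat cntV 0 0)
    (hlen : σ.nat lenA (σ.nat rowV 0 0) 0 = l) :
    ∃ τ, Exec M (childP e) σ τ ∧
      τ.tuples = σ.tuples ++ (List.range c).map fun k => σ.tuple (σ.nat rowV 0 0) ++ [k] := by
  set r := σ.nat rowV 0 0 with hr
  have hrl := σ.length_tuple r
  refine Exec.exists_loop c (fun k σ' => σ'.tuples = σ.tuples ++
      (List.range k).map (fun k => σ.tuple r ++ [k]) ∧ σ'.tuple r = σ.tuple r ∧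
      r < σ'.nat cntV 0 0) hc (by simp) he ?_ ?_ fun τ _ h => h.1
  · refine ⟨?_, rfl, by simpa using hrow⟩
    rw [List.range_zero, List.map_nil, List.append_nil]
    exact Mem.tuples_setNat _ (by simp) (by simp) (by simp) _ _ _
  · intro k hk σ' hσ' hkσ' ⟨hinv, hinv', hcnt⟩
    set n := σ'.nat cntV 0 0 with hn
    have hlvl₁ : σ'.nat lvlV 0 0 = l := by rw [hσ'.nat lvlV (by simp), hlvl]
    have hrow₁ : σ'.nat rowV 0 0 = r := by rw [hσ'.nat rowV (by simp)]
    have hlen₁ : σ'.nat lenA r 0 = l := by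
      rw [← Mem.length_tuple, hinv', Mem.length_tuple, hlen]
    obtain ⟨τ, hτ, h₁, h₂⟩ := Exec.exists_loop (σ := σ') (M := M) (b := iV) (e := var lvlV)
      (p := .setNat tupA (var cntV) (var iV) (.get tupA (var rowV) (var iV)))
      (Q := fun τ => (∀ h ≠ n, τ.nat tupA h = σ'.nat tupA h) ∧
        ∀ i < l, τ.nat tupA n i = σ'.nat tupA r i) l
      (fun j σ'' => (∀ h ≠ n, σ''.nat tupA h = σ'.nat tupA h) ∧
        ∀ i < j, σ''.nat tupA n i = σ'.nat tupA r i) hl (by simp)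
      (fun σ'' h => by simp [h.nat lvlV (by simp), hlvl₁])
      ⟨fun h _ => by rw [Mem.setNat_nat_of_ne _ (by simp)], by simp⟩
      (fun i hi σ'' hσ'' hiσ'' ⟨hinv₁, hinv₂⟩ => by
        have hrow₂ : σ''.nat rowV 0 0 = r := by rw [hσ''.nat rowV (by simp), hrow₁]
        have hcnt₂ : σ''.nat cntV 0 0 = n := by rw [hσ''.nat cntV (by simp)]
        refine ⟨_, Exec.setNat _ _ _ _, fun h hh => ?_, fun i' hi' => ?_⟩
        · funext j
          simp [hcnt₂, hh, hinv₁ h hh]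
        · rcases (Nat.lt_succ_iff.1 hi').lt_or_eq with h | rfl
          · simp [h.ne, hcnt₂, hiσ'', hinv₂ i' h]
          · simp [hiσ'', hcnt₂, hrow₂, hinv₁ r hcnt.ne])
      fun τ _ h => h
    have hcntτ : τ.nat cntV 0 0 = n := by rw [hτ.natEq cntV (by simp)]
    have hlvlτ : τ.nat lvlV 0 0 = l := by rw [hτ.natEq lvlV (by simp), hlvl₁]
    have hkτ : τ.nat kV 0 0 = k := by rw [hτ.natEq kV (by simp), hkσ']
    have hlenτ : τ.nat lenA = σ'.nat lenA := hτ.natEq lenA (by simp)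
    refine Exec.bind hτ (Exec.bind (Exec.setNat _ _ _ _) (Exec.bind (Exec.setNat _ _ _ _)
      ⟨_, Exec.setNat _ _ _ _, ?_⟩))
    simp only [NExp.eval, Mem.setNat_nat, hcntτ, hlvlτ, hkτ]
    simp only [Nat.reduceEqDiff, false_and, if_false, and_self, if_true]
    set ρ := ((((τ.setNat tupA n l k).setNat lenA n 0 (l + 1)).setNat cntV 0 0 (n + 1)).setNat
      kV 0 0 (k + 1)) with hρ
    have hold : ∀ h < n, ρ.tuple h = σ'.tuple h := fun h hh => by
      refine Mem.tuple_congr (by simp [hρ, hh.ne, hlenτ]) fun i _ => ?_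
      simp [hρ, hh.ne, h₁ h hh.ne]
    have hnew : ρ.tuple n = σ.tuple r ++ [k] := by
      have hlenρ : ρ.nat lenA n 0 = l + 1 := by simp [hρ]
      rw [Mem.tuple, hlenρ, List.range_succ, List.map_append, List.map_singleton, ← hinv']
      congr 1
      · rw [Mem.tuple, hlen₁]
        refine List.map_congr_left fun i hi => ?_
        have hi := List.mem_range.1 hi
        simp [hρ, hi.ne, h₂ i hi]
      · simp [hρ]
    have hcntρ : ρ.nat cntV 0 0 = n + 1 := by simp [hρ]
    refine ⟨?_, (hold r hcnt).trans hinv', by omega⟩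
    rw [Mem.tuples, hcntρ, List.range_succ, List.map_append, List.map_singleton, hnew,
      List.range_succ (n := k), List.map_append, ← List.append_assoc, ← hinv, List.map_singleton]
    congr 1
    exact List.map_congr_left fun h hh => hold h (List.mem_range.1 hh)

theorem Computes.keepsInput_rowP (hfac : Computes M fac σ₀ m N Kf φ) :
    (rowP fac e).KeepsInput := by
  have := hfac.keepsInput_vecP
  refine ⟨fun b hb => ?_, ?_, fun b hb => ?_⟩
  · simp [rowP, mulVecP, pivotP, clearP, childP, this.nat b hb]
    omega
  · simp [rowP, mulVecP, pivotP, clearP, childP, this.dim]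
  · simp [rowP, mulVecP, pivotP, clearP, childP, this.fld b hb]
    omega

theorem Computes.keepsInput_levelP (hfac : Computes M fac σ₀ m N Kf φ) :
    (levelP fac e).KeepsInput := by
  have := hfac.keepsInput_rowP (e := e)
  refine ⟨fun b hb => ?_, ?_, fun b hb => ?_⟩
  · simp [levelP, identP, this.nat b hb]
    omega
  · simp [levelP, identP, this.dim]
  · simp [levelP, identP, this.fld b hb]
    omega

/-- Processing a row extends the kernel of the matrix by the product vector of the tuple, and
appends the children of the tuple unless this vector has been in the kernel before. -/
theorem Exec.exists_rowP (hfac : Computes M fac σ₀ m N Kf φ)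
    (he : ∀ σ, SameInput σ₀ σ → σ.nat lvlV 0 0 ≤ m → e.eval σ = Kf (σ.nat lvlV 0 0))
    (hN : N ≤ M) (hm : m ≤ M) (hK : ∀ i ≤ m, Kf i ≤ M)
    (hσ : SameInput σ₀ σ) (hdim : σ.nat dimV 0 0 = N) {κ : List ℕ} {l : ℕ}
    (hκ : κ ∈ Trie.full Kf l) (hl : l ≤ m) (hlvl : σ.nat lvlV 0 0 = l)
    (hrow : σ.nat rowV 0 0 < σ.nat cntV 0 0) (htup : σ.tuple (σ.nat rowV 0 0) = κ)
    {acc : List (List ℕ)}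
    (hker : LinearMap.ker (σ.mat N).mulVecLin = Trie.spanOf φ N acc) :
    ∃ τ, Exec M (rowP fac e) σ τ ∧
      LinearMap.ker (τ.mat N).mulVecLin = Trie.spanOf φ N (Trie.insert φ N acc κ) ∧
      ∃ new, Trie.insert φ N acc κ = acc ++ new ∧
        τ.tuples = σ.tuples ++ new.flatMap (Trie.children Kf) := by
  have hlen : σ.nat lenA (σ.nat rowV 0 0) 0 = l := by rw [← Mem.length_tuple, htup, hκ.1]
  have hrow' : ∀ i < l, σ.nat tupA (σ.nat rowV 0 0) i = κ.getD i 0 := fun i hi => by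
    rw [← htup, Mem.getD_tuple]
    omega
  obtain ⟨τ₁, hτ₁, hv⟩ := Exec.exists_vecP hfac hN hm hσ hdim hκ hl hlvl hrow'
  have hv : τ₁.vec N = Trie.vec φ N κ := funext hv
  refine Exec.bind hτ₁ ?_
  have hmat₁ : τ₁.mat N = σ.mat N := by
    simp only [Mem.mat, hτ₁.fldEq matZ (by simp [vecP, hfac.keepsFld])]
  obtain ⟨τ₂, hτ₂, hy⟩ := Exec.exists_mulVecP (M := M) (σ := τ₁) hN
    (by rw [hτ₁.natEq dimV (by simp [vecP, hfac.keepsNat]), hdim])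
  refine Exec.bind hτ₂ ?_
  have hmat₂ : τ₂.mat N = σ.mat N := by
    rw [← hmat₁]
    simp only [Mem.mat, hτ₂.fldEq matZ (by simp [mulVecP])]
  rw [hmat₁, hv] at hy
  obtain ⟨τ₃, hτ₃, hpiv⟩ := Exec.exists_pivotP (M := M) (σ := τ₂) hN
    (by rw [hτ₂.natEq dimV (by simp [mulVecP]), hτ₁.natEq dimV (by simp [vecP, hfac.keepsNat]),
      hdim])
  refine Exec.bind hτ₃ ?_
  have hmat₃ : τ₃.mat N = σ.mat N := by
    rw [← hmat₂]
    simp only [Mem.mat, hτ₃.fldEq matZ (by simp [pivotP])]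
  have hnat : ∀ b, b ≤ 11 ∨ b = 17 → b ≠ 11 → τ₃.nat b = σ.nat b := fun b hb hb' => by
    rw [hτ₃.natEq b (by simp [pivotP]; omega), hτ₂.natEq b (by simp [mulVecP]; omega),
      hτ₁.natEq b (by simp [vecP, hfac.keepsNat b (by omega) (by omega)]; omega)]
  have hin : SameInput σ τ₃ := by
    refine ⟨fun b hb => hnat b (by omega) (by omega), hnat _ (by simp) (by simp), fun b hb => ?_⟩
    rw [hτ₃.fldEq b (by simp [pivotP]), hτ₂.fldEq b (by simp [mulVecP]; omega),
      hτ₁.fldEq b (hfac.keepsInput_vecP.fld b hb)]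
  have htup₃ : τ₃.tuples = σ.tuples :=
    Mem.tuples_congr (hnat _ (by simp) (by simp)) (hnat _ (by simp) (by simp))
      (hnat _ (by simp) (by simp))
  rcases hpiv with ⟨hpiv, hzero⟩ | ⟨p, hpiv, hne⟩
  · have hmem : Trie.vec φ N κ ∈ Trie.spanOf φ N acc := by
      rw [← hker, LinearMap.mem_ker, Matrix.mulVecLin_apply]
      exact funext fun i => by rw [← hy, hzero, Pi.zero_apply]
    refine ⟨_, Exec.iteFalse (by simp [hpiv]) Exec.skip, ?_⟩
    rw [Trie.insert_of_mem hmem, hmat₃]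
    exact ⟨hker, [], by simp, by simp [htup₃]⟩
  · have hmem : Trie.vec φ N κ ∉ Trie.spanOf φ N acc := fun hmem => by
      rw [← hker, LinearMap.mem_ker, Matrix.mulVecLin_apply] at hmem
      exact hne (by rw [hy, hmem, Pi.zero_apply])
    have hy₃ : τ₃.fld vecY = τ₂.fld vecY := hτ₃.fldEq _ (by simp [pivotP])
    obtain ⟨τ₄, hτ₄, hker₄⟩ := Exec.exists_clearP (M := M) (σ := τ₃) hN
      (by rw [hnat _ (by simp) (by simp), hdim]) p hpiv (Trie.vec φ N κ)
      (fun i => by rw [hy₃, hy, hmat₃]) (by rwa [hy₃])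
    have hnat₄ : ∀ b, b ≤ 11 ∨ b = 17 → b ≠ 11 → τ₄.nat b = σ.nat b := fun b hb hb' => by
      rw [hτ₄.natEq b (by simp [clearP]; omega), hnat b hb hb']
    have hin₄ : SameInput σ τ₄ := by
      refine ⟨fun b hb => hnat₄ b (by omega) (by omega), hnat₄ _ (by simp) (by simp),
        fun b hb => ?_⟩
      rw [hτ₄.fldEq b (by simp [clearP]; omega), hin.fld b hb]
    have hrow₄ : τ₄.nat rowV 0 0 = σ.nat rowV 0 0 := by rw [hnat₄ _ (by simp) (by simp)]
    have hlen₄ : τ₄.nat lenA = σ.nat lenA := hnat₄ _ (by simp) (by simp)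
    have hlvl₄ : τ₄.nat lvlV 0 0 = l := by rw [hnat₄ _ (by simp) (by simp), hlvl]
    obtain ⟨τ₅, hτ₅, htup₅⟩ := Exec.exists_childP (M := M) (σ := τ₄) (e := e) (l := l) (c := Kf l)
      (hl.trans hm) hlvl₄
      (fun σ' h => by
        have hlvl' : σ'.nat lvlV 0 0 = l := by rw [h.nat _ (by simp [childP]), hlvl₄]
        rw [he σ' (hσ.trans (hin₄.trans (h.sameInput ?_))) (by omega), hlvl']
        exact ⟨fun b hb => by simp [childP]; omega, by simp [childP], fun b hb => by simp [childP]⟩)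
      (hK l hl) (by rw [hrow₄, hnat₄ cntV (by simp) (by simp)]; exact hrow)
      (by rw [hrow₄, hlen₄, hlen])
    refine ⟨τ₅, Exec.iteTrue (by simp [hpiv]) (hτ₄.seq hτ₅), ?_⟩
    rw [Trie.insert_of_notMem hmem]
    refine ⟨?_, [κ], rfl, ?_⟩
    · rw [Trie.spanOf_append_singleton, ← hker, ← hmat₃, ← hker₄]
      simp only [Mem.mat, hτ₅.fldEq matZ (by simp [childP])]
    · rw [htup₅, hrow₄, Mem.tuples_congr (τ := τ₄) (σ := σ) (hnat₄ _ (by simp) (by simp)) hlen₄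
        (hnat₄ _ (by simp) (by simp)),
        Mem.tuple_congr (τ := τ₄) (σ := σ) (by rw [hlen₄])
          (fun i _ => by rw [hnat₄ tupA (by simp) (by simp)]), htup]
      simp [Trie.children, hκ.1]

/-- The hypotheses under which a search is run: it is started in `σ₀`, the program `fac` computes
the factors and `e` the numbers of choices, and `M` bounds all numbers of iterations. -/
structure SearchSpec (M : ℕ) (fac : Prog) (e : NExp) (σ₀ : Mem F) (m N : ℕ) (Kf : ℕ → ℕ)
    (φ : ℕ → ℕ → ℕ → F) : Prop where
  fac : Computes M fac σ₀ m N Kf φ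
  choices : ∀ σ, SameInput σ₀ σ → σ.nat lvlV 0 0 ≤ m → e.eval σ = Kf (σ.nat lvlV 0 0)
  arity : σ₀.nat 0 0 0 = m
  dim : σ₀.nat dimV 0 0 = N
  dim_le : N ≤ M
  arity_lt : m < M
  choices_le : ∀ i ≤ m, Kf i ≤ M
  tuples_le : ∀ l ≤ m, (Trie.upTo φ Kf N l).length ≤ M

theorem Exec.exists_levelP (h : SearchSpec M fac e σ₀ m N Kf φ) (hσ : SameInput σ₀ σ) {l : ℕ}
    (hl : l ≤ m) (hlvl : σ.nat lvlV 0 0 = l) (htup : σ.tuples = Trie.upTo φ Kf N l) :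
    ∃ τ, Exec M (levelP fac e) σ τ ∧
      LinearMap.ker (τ.mat N).mulVecLin = Trie.spanOf φ N (Trie.level φ Kf N l) ∧
      τ.tuples = Trie.upTo φ Kf N (l + 1) := by
  set L := Trie.upTo φ Kf N l with hL
  have hcnt : σ.nat cntV 0 0 = L.length := by rw [← htup, Mem.length_tuples]
  refine Exec.bind (Exec.setNat _ _ _ _) ?_
  simp only [NExp.eval, hcnt]
  set σ₁ := σ.setNat endV 0 0 L.length with hσ₁
  have hin₁ : SameInput σ σ₁ := ⟨fun b hb => Mem.setNat_nat_of_ne _ (by omega) _ _ _,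
    Mem.setNat_nat_of_ne _ (by simp) _ _ _, fun _ _ => rfl⟩
  have hdim₁ : σ₁.nat dimV 0 0 = N := by rw [hin₁.dim, hσ.dim, h.dim]
  obtain ⟨σ₂, hσ₂, hker⟩ := Exec.exists_identP (M := M) (σ := σ₁) h.dim_le hdim₁
  refine Exec.bind hσ₂ ?_
  have hin₂ : SameInput σ σ₂ := hin₁.trans (hσ₂.sameOff.sameInput
    ⟨fun b hb => by simp [identP]; omega, by simp [identP], fun b hb => by simp [identP]; omega⟩)
  have htup₂ : σ₂.tuples = L := by
    rw [← htup]
    refine Mem.tuples_congr ?_ ?_ ?_ <;> rw [hσ₂.natEq _ (by simp [identP])] <;>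
      exact Mem.setNat_nat_of_ne _ (by simp) _ _ _
  have hlvl₂ : σ₂.nat lvlV 0 0 = l := by
    rw [hσ₂.natEq _ (by simp [identP]), ← hlvl]
    simp [hσ₁]
  have hend₂ : σ₂.nat endV 0 0 = L.length := by
    rw [hσ₂.natEq _ (by simp [identP])]
    simp [hσ₁]
  let done : ℕ → List (List ℕ) := fun k =>
    Trie.greedy φ N ((L.take k).filter fun κ => l ≤ κ.length)
  refine Exec.exists_loop L.length (fun k σ' =>
      LinearMap.ker (σ'.mat N).mulVecLin = Trie.spanOf φ N (done k) ∧
      σ'.tuples = L ++ (done k).flatMap (Trie.children Kf)) (h.tuples_le l hl)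
    (by simp [rowP, pivotP, mulVecP, clearP, childP, vecP, h.fac.keepsNat])
    (fun σ' h' => by
      rw [NExp.eval, h'.nat _ (by simp [rowP, pivotP, mulVecP, clearP, childP, vecP,
        h.fac.keepsNat])]
      simpa using hend₂) ⟨?_, ?_⟩ ?_ fun τ _ h' => ?_
  · have : done 0 = [] := rfl
    rw [this, Trie.spanOf_nil]
    exact hker
  · rw [Mem.tuples_setNat _ (by simp) (by simp) (by simp)]
    simpa [done, Trie.greedy_nil] using htup₂
  · intro k hk σ' hσ' hkσ' ⟨hinv₁, hinv₂⟩
    have hin₃ : SameInput σ₂ σ' := hσ'.sameInput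
      ⟨fun b hb => by simp [h.fac.keepsInput_rowP.nat b hb]; omega,
        by simp [h.fac.keepsInput_rowP.dim], fun b hb => by simp [h.fac.keepsInput_rowP.fld b hb]⟩
    have hlvl₃ : σ'.nat lvlV 0 0 = l := by
      rw [hσ'.nat _ (by simp [rowP, pivotP, mulVecP, clearP, childP, vecP, h.fac.keepsNat]), hlvl₂]
    have hcnt₃ : k < σ'.nat cntV 0 0 := by
      rw [← Mem.length_tuples, hinv₂, List.length_append]
      omega
    have hrow₃ : σ'.tuple k = L[k] := by
      have h₁ : σ'.tuples[k]? = some (σ'.tuple k) := by simp [Mem.tuples, hcnt₃]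
      rw [hinv₂, List.getElem?_append_left hk, List.getElem?_eq_getElem hk] at h₁
      exact (Option.some.inj h₁).symm
    have hlen₃ : σ'.nat lenA k 0 = L[k].length := by rw [← Mem.length_tuple, hrow₃]
    have hle : L[k].length ≤ l := Trie.length_le_of_mem_upTo (List.getElem_mem hk)
    have hkeep : ∀ τ : Mem F, (τ.setNat rowV 0 0 (k + 1)).tuples = τ.tuples := fun τ =>
      Mem.tuples_setNat _ (by simp) (by simp) (by simp) _ _ _
    by_cases hkl : L[k].length < l
    · refine ⟨_, Exec.iteTrue (by simpa [hkσ', hlen₃, hlvl₃] using hkl) Exec.skip, ?_⟩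
      have hdone : done (k + 1) = done k := by
        simp only [done, List.take_add_one, List.getElem?_eq_getElem hk, List.filter_append,
          Option.toList_some, List.filter_singleton, Nat.not_le.2 hkl, decide_false, cond_false,
          List.append_nil]
      rw [hdone, hkeep]
      exact ⟨hinv₁, hinv₂⟩
    · have hκl : L[k].length = l := by omega
      have hκ : L[k] ∈ Trie.level φ Kf N l := by
        rw [← Trie.filter_upTo, List.mem_filter]
        exact ⟨List.getElem_mem hk, by simp [hκl]⟩
      obtain ⟨τ, hτ, h₁, new, h₂, h₃⟩ := Exec.exists_rowP h.fac h.choices h.dim_le h.arity_lt.le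
        h.choices_le (hσ.trans (hin₂.trans hin₃))
        (by rw [hin₃.dim, hin₂.dim, hσ.dim, h.dim])
        (Trie.mem_full_of_mem_level hκ) hl hlvl₃ (by rwa [hkσ']) (by rw [hkσ', hrow₃]) hinv₁
      refine ⟨τ, Exec.iteFalse (by simpa [hkσ', hlen₃, hlvl₃] using hκl.ge) hτ, ?_⟩
      have hdone : done (k + 1) = Trie.insert φ N (done k) L[k] := by
        simp only [done, List.take_add_one, List.getElem?_eq_getElem hk, List.filter_append,
          Option.toList_some, List.filter_singleton, hκl, le_refl, decide_true, cond_true]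
        exact Trie.greedy_append_singleton _ _
      rw [hdone, hkeep]
      refine ⟨h₁, ?_⟩
      rw [h₃, hinv₂, h₂, List.flatMap_append, List.append_assoc]
  · have hdone : done L.length = Trie.greedy φ N (Trie.level φ Kf N l) := by
      simp only [done, List.take_length, hL, Trie.filter_upTo]
    rw [hdone, Trie.spanOf_greedy] at h'
    exact h'

/-- The greedy search lists the tuples that it visits, and it leaves behind a matrix whose kernel is
the span of all product vectors of full length. -/
theorem Exec.exists_searchP (h : SearchSpec M fac e σ₀ m N Kf φ) :
    ∃ τ, Exec M (searchP fac e) σ₀ τ ∧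
      LinearMap.ker (τ.mat N).mulVecLin = Submodule.span F (Trie.vec φ N '' Trie.full Kf m) ∧
      τ.tuples = Trie.upTo φ Kf N (m + 1) := by
  refine Exec.bind (Exec.setNat _ _ _ _) (Exec.bind (Exec.setNat _ _ _ _) ?_)
  simp only [NExp.eval, h.dim]
  set σ₁ := (σ₀.setNat cntV 0 0 (1 - (1 - N))).setNat lenA 0 0 0 with hσ₁
  have hin₁ : SameInput σ₀ σ₁ := by
    refine ⟨fun b hb => ?_, ?_, fun _ _ => rfl⟩ <;>
      rw [hσ₁, Mem.setNat_nat_of_ne _ (by omega), Mem.setNat_nat_of_ne _ (by omega)]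
  refine Exec.exists_loop (m + 1) (fun k σ' => σ'.tuples = Trie.upTo φ Kf N k ∧ ∀ l, k = l + 1 →
      LinearMap.ker (σ'.mat N).mulVecLin = Trie.spanOf φ N (Trie.level φ Kf N l)) h.arity_lt
    (by simp [levelP, identP, rowP, pivotP, mulVecP, clearP, childP, vecP, h.fac.keepsNat])
    (fun σ' h' => ?_) ⟨?_, by simp⟩ ?_ fun τ _ h' => ⟨?_, h'.1⟩
  · have := (hin₁.trans (h'.sameInput ⟨fun b hb => by simp [h.fac.keepsInput_levelP.nat b hb]; omega,
        by simp [h.fac.keepsInput_levelP.dim],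
        fun b hb => by simp [h.fac.keepsInput_levelP.fld b hb]⟩)).nat 0 (by simp)
    simp [this, h.arity]
  · rw [Mem.tuples_setNat _ (by simp) (by simp) (by simp)]
    have hcnt : σ₁.nat cntV 0 0 = 1 - (1 - N) := by simp [hσ₁]
    have hlen : σ₁.nat lenA 0 0 = 0 := by simp [hσ₁]
    rw [Mem.tuples, hcnt, Trie.upTo, Trie.level]
    rcases Nat.eq_zero_or_pos N with rfl | hN
    · simp
    · rw [if_neg hN.ne', show 1 - (1 - N) = 1 by omega]
      simp [Mem.tuple, hlen]
  · intro l hl σ' hσ' hlσ' ⟨hinv, _⟩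
    obtain ⟨τ, hτ, h₁, h₂⟩ := Exec.exists_levelP h (hin₁.trans (hσ'.sameInput
      ⟨fun b hb => by simp [h.fac.keepsInput_levelP.nat b hb]; omega,
        by simp [h.fac.keepsInput_levelP.dim],
        fun b hb => by simp [h.fac.keepsInput_levelP.fld b hb]⟩)) (by omega) hlσ' hinv
    refine ⟨τ, hτ, ?_, fun l' hl' => ?_⟩
    · rw [← h₂]
      exact Mem.tuples_setNat _ (by simp) (by simp) (by simp) _ _ _
    · obtain rfl : l = l' := by omega
      exact h₁
  · rw [h'.2 m rfl, Trie.spanOf_level]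

end Spec

/-! ### The programs for the factors and for the points -/

namespace Prog

/-- Compute the `kV`-th power of `e` in the scalar `b`. -/
def powP (b : ℕ) (e : FExp) : Prog :=
  setFvar b .one ;; loop tV (var kV) (setFvar b (.mul (fvar b) e))

/-- The factors that select message positions: unnormalised Lagrange polynomials. -/
def lagrangeP : Prog :=
  let step := setFvar facF
    (.mul (fvar facF) (.sub (.get 1 (var xV) (var iV)) (.get 0 (var iV) (var jV))))
  setFvar facF .one ;;
    loop jV (.get 1 (var iV) (.lit 1))
      (.ite (.lt (var jV) (var kV)) step (.ite (.lt (var kV) (var jV)) step .skip))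

/-- The factors of the subcube sums of monomials: powers of coordinates, and power sums. -/
def powerSumP : Prog :=
  .ite (.lt (var iV) (.get 4 (var xV) (.lit 0)))
    (powP facF (.get 2 (var xV) (var iV)))
    (setFvar facF .zero ;;
      loop jV (.get 1 (var iV) (.lit 1))
        (powP powF (.get 0 (var iV) (var jV)) ;; setFvar facF (.add (fvar facF) (fvar powF))))

/-- Write the points that belong to the tuples into the output, append the points of the input, and
announce the size of the constraint matrix. -/
def pointsP : Prog :=
  .setNat 3 (.lit 0) (.lit 0) (var cntV) ;;
    loop rowV (var cntV)
      (.setNat 4 (var rowV) (.lit 0) (.get lenA (var rowV) (.lit 0)) ;;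
        loop iV (.get lenA (var rowV) (.lit 0))
          (.setFld 2 (var rowV) (var iV) (.get 0 (var iV) (.get tupA (var rowV) (var iV))))) ;;
    loop rowV (.get 0 (.lit 0) (.lit 1))
      (.setNat 4 (.add (var cntV) (var rowV)) (.lit 0) (.get 2 (var rowV) (.lit 0)) ;;
        loop iV (.get 0 (.lit 0) (.lit 0))
          (.setFld 2 (.add (var cntV) (var rowV)) (var iV) (.get 1 (var rowV) (var iV)))) ;;
    setVar dimV (.add (var cntV) (.get 0 (.lit 0) (.lit 1))) ;;
    .setNat 3 (.lit 0) (.lit 1) (var dimV)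

/-- The constraint locator: search for the message positions, then search for the subcube sums of
monomials on these positions and the points of the input. -/
def locatorP : Prog :=
  setVar dimV (.get 0 (.lit 0) (.lit 1)) ;;
    searchP lagrangeP (.get 1 (var lvlV) (.lit 1)) ;;
    pointsP ;;
    searchP powerSumP (.add (.get 1 (var lvlV) (.lit 0)) (.lit 1))

end Prog

/-- The factors of the vectors that select message positions: up to a scalar, the value at `x l i`
of the `k`-th Lagrange polynomial for the nodes `a i 0, …, a i (c i - 1)`. -/
def lagrangeFactor {F : Type*} [Field F] (c : ℕ → ℕ) (a x : ℕ → ℕ → F) (i k l : ℕ) : F :=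
  ∏ j ∈ range (c i), if j = k then 1 else x l i - a i j

/-- The factors of the subcube sums of monomials at the point `x l` of length `len l`. -/
def powerSumFactor {F : Type*} [Field F] (c : ℕ → ℕ) (a : ℕ → ℕ → F) (len : ℕ → ℕ)
    (x : ℕ → ℕ → F) (i k l : ℕ) : F :=
  if i < len l then x l i ^ k else ∑ j ∈ range (c i), a i j ^ k

section Spec

variable {F : Type*} [Field F] [Fintype F] {M : ℕ} {σ : Mem F} {σ₀ : Mem F} {m N : ℕ}
  {Kf : ℕ → ℕ}

theorem Exec.exists_powP {b : ℕ} {e : FExp} {u : F} (hk : σ.nat kV 0 0 ≤ M)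
    (he : ∀ σ', SameOff (powP b e) σ σ' → e.eval σ' = u) :
    ∃ τ, Exec M (powP b e) σ τ ∧ τ.fld b 0 0 = u ^ σ.nat kV 0 0 := by
  refine Exec.bind (Exec.setFld _ _ _ _) (Exec.exists_loop (σ.nat kV 0 0)
    (fun k σ' => σ'.fld b 0 0 = u ^ k) hk (by simp)
    (fun σ' h => by simp [h.nat kV (by simp)]) (by simp) ?_ fun τ _ h => h)
  intro k _ σ' hσ' _ hinv
  refine ⟨_, Exec.setFld _ _ _ _, ?_⟩
  have hset : SameOff (powP b e) σ (σ.setFld b 0 0 1) :=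
    ⟨fun _ _ => rfl, fun b' hb' => Mem.setFld_fld_of_ne _ (by simp [powP] at hb'; tauto) _ _ _⟩
  have : e.eval σ' = u := he σ' (hset.trans (hσ'.mono
    (fun b' hb' => by simpa [powP] using hb') fun b' hb' => by simpa [powP] using hb'))
  simp [hinv, this, pow_succ]

theorem computes_lagrangeP (hc : ∀ i < m, σ₀.nat 1 i 1 ≤ M) :
    Computes M lagrangeP σ₀ m N Kf
      (lagrangeFactor (fun i => σ₀.nat 1 i 1) (σ₀.fld 0) (σ₀.fld 1)) := by
  refine ⟨fun b h₁ h₂ => by simp [lagrangeP, h₁], fun b h₁ h₂ => by simp [lagrangeP, h₁], ?_⟩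
  intro σ hσ hi hk hx
  refine Exec.bind (Exec.setFld _ _ _ _) (Exec.exists_loop (σ₀.nat 1 (σ.nat iV 0 0) 1)
    (fun k σ' => σ'.fld facF 0 0 = ∏ j ∈ range k, if j = σ.nat kV 0 0 then 1 else
      σ₀.fld 1 (σ.nat xV 0 0) (σ.nat iV 0 0) - σ₀.fld 0 (σ.nat iV 0 0) j)
    (hc _ hi) (by simp) (fun σ' h => ?_) (by simp) ?_ fun τ _ h => h)
  · simp [h.nat iV (by simp), h.nat 1 (by simp), hσ.nat 1 (by simp)]
  · intro j _ σ' hσ' hjσ' hinv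
    have hk' : σ'.nat kV 0 0 = σ.nat kV 0 0 := by simp [hσ'.nat kV (by simp)]
    have hval : (FExp.mul (fvar facF)
        (.sub (.get 1 (var xV) (var iV)) (.get 0 (var iV) (var jV)))).eval σ' =
        (∏ j ∈ range j, if j = σ.nat kV 0 0 then 1 else
          σ₀.fld 1 (σ.nat xV 0 0) (σ.nat iV 0 0) - σ₀.fld 0 (σ.nat iV 0 0) j) *
        (σ₀.fld 1 (σ.nat xV 0 0) (σ.nat iV 0 0) - σ₀.fld 0 (σ.nat iV 0 0) j) := by
      have h₀ : σ'.fld 0 = σ₀.fld 0 := by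
        rw [hσ'.fld 0 (by simp), Mem.setFld_fld_of_ne _ (by simp), hσ.fld 0 (by simp)]
      have h₁ : σ'.fld 1 = σ₀.fld 1 := by
        rw [hσ'.fld 1 (by simp), Mem.setFld_fld_of_ne _ (by simp), hσ.fld 1 (by simp)]
      simp [hjσ', hinv, hσ'.nat iV (by simp), hσ'.nat xV (by simp), h₀, h₁]
    rcases lt_trichotomy j (σ.nat kV 0 0) with h | h | h
    · refine ⟨_, Exec.iteTrue (by simpa [hjσ', hk'] using h) (Exec.setFld _ _ _ _), ?_⟩
      simp only [hval]
      simp [prod_range_succ, h.ne]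
    · refine ⟨_, Exec.iteFalse (by simp [hjσ', hk', h])
        (Exec.iteFalse (by simp [hjσ', hk', h]) Exec.skip), ?_⟩
      simpa [prod_range_succ, h] using hinv
    · refine ⟨_, Exec.iteFalse (by simpa [hjσ', hk'] using h.le)
        (Exec.iteTrue (by simpa [hjσ', hk'] using h) (Exec.setFld _ _ _ _)), ?_⟩
      simp only [hval]
      simp [prod_range_succ, h.ne']

theorem computes_powerSumP (hc : ∀ i < m, σ₀.nat 1 i 1 ≤ M) (hK : ∀ i < m, Kf i ≤ M) :
    Computes M powerSumP σ₀ m N Kf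
      (powerSumFactor (fun i => σ₀.nat 1 i 1) (σ₀.fld 0) (fun l => σ₀.nat 4 l 0) (σ₀.fld 2)) := by
  refine ⟨fun b h₁ h₂ => by simp [powerSumP, powP, h₁, h₂],
    fun b h₁ h₂ => by simp [powerSumP, powP, h₁, h₂], ?_⟩
  intro σ hσ hi hk hx
  have hkM : σ.nat kV 0 0 ≤ M := hk.le.trans (hK _ hi)
  rw [powerSumFactor, ← hσ.nat 4 (by simp)]
  split_ifs with hlen
  · obtain ⟨τ, hτ, h⟩ := Exec.exists_powP (M := M) (σ := σ) (b := facF)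
      (e := .get 2 (var xV) (var iV)) (u := σ₀.fld 2 (σ.nat xV 0 0) (σ.nat iV 0 0)) hkM
      fun σ' h => by
        simp [h.nat xV (by simp [powP]), h.nat iV (by simp [powP]), h.fld 2 (by simp [powP]),
          hσ.fld 2 (by simp)]
    exact ⟨τ, Exec.iteTrue (by simpa using hlen) hτ, h⟩
  · have key : ∃ τ, Exec M (setFvar facF .zero ;;
        loop jV (.get 1 (var iV) (.lit 1))
          (powP powF (.get 0 (var iV) (var jV)) ;;
            setFvar facF (.add (fvar facF) (fvar powF)))) σ τ ∧
        τ.fld facF 0 0 =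
          ∑ j ∈ range (σ₀.nat 1 (σ.nat iV 0 0) 1), σ₀.fld 0 (σ.nat iV 0 0) j ^ σ.nat kV 0 0 := by
      refine Exec.bind (Exec.setFld _ _ _ _) (Exec.exists_loop (σ₀.nat 1 (σ.nat iV 0 0) 1)
        (fun n σ' => σ'.fld facF 0 0 =
          ∑ j ∈ range n, σ₀.fld 0 (σ.nat iV 0 0) j ^ σ.nat kV 0 0)
        (hc _ hi) (by simp [powP]) (fun σ' h => ?_) (by simp) ?_ fun τ _ h => h)
      · simp [h.nat iV (by simp [powP]), h.nat 1 (by simp [powP]), hσ.nat 1 (by simp)]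
      · intro j _ σ' hσ' hjσ' hinv
        have hk' : σ'.nat kV 0 0 = σ.nat kV 0 0 := by simp [hσ'.nat kV (by simp [powP])]
        have hi' : σ'.nat iV 0 0 = σ.nat iV 0 0 := by simp [hσ'.nat iV (by simp [powP])]
        have h₀ : σ'.fld 0 = σ₀.fld 0 := by
          rw [hσ'.fld 0 (by simp [powP]), Mem.setFld_fld_of_ne _ (by simp), hσ.fld 0 (by simp)]
        obtain ⟨τ, hτ, h⟩ := Exec.exists_powP (M := M) (σ := σ') (b := powF)
          (e := .get 0 (var iV) (var jV)) (u := σ₀.fld 0 (σ.nat iV 0 0) j) (by omega)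
          fun σ'' h => by
            simp [h.nat jV (by simp [powP]), h.nat iV (by simp [powP]), h.fld 0 (by simp [powP]),
              h₀, hjσ', hi']
        refine Exec.bind hτ ⟨_, Exec.setFld _ _ _ _, ?_⟩
        simp [h, hτ.fldEq facF (by simp [powP]), hinv, sum_range_succ, hk']
    obtain ⟨τ, hτ, h⟩ := key
    exact ⟨τ, Exec.iteFalse (by simpa using hlen) hτ, h⟩

/-- Filling an initial segment of one row of a field bank. -/
theorem Exec.exists_fillRow {b l r : ℕ} {e ρ : NExp} {src : FExp} {s : ℕ → F} (hl : l ≤ M)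
    (he : ∀ σ', SameOff (loop iV e (.setFld b ρ (var iV) src)) σ σ' → e.eval σ' = l)
    (hr : ∀ σ', SameOff (loop iV e (.setFld b ρ (var iV) src)) σ σ' → ρ.eval σ' = r)
    (hs : ∀ σ', SameOff (loop iV e (.setFld b ρ (var iV) src)) σ σ' → σ'.nat iV 0 0 < l →
      src.eval σ' = s (σ'.nat iV 0 0)) :
    ∃ τ, Exec M (loop iV e (.setFld b ρ (var iV) src)) σ τ ∧
      (∀ h ≠ r, τ.fld b h = σ.fld b h) ∧ ∀ i < l, τ.fld b r i = s i := by
  refine Exec.exists_loop l (fun j σ' => (∀ h ≠ r, σ'.fld b h = σ.fld b h) ∧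
    ∀ i < j, σ'.fld b r i = s i) hl (by simp) he ⟨fun _ _ => rfl, by simp⟩ ?_ fun τ _ h => h
  intro i hi σ' hσ' hiσ' ⟨h₁, h₂⟩
  refine ⟨_, Exec.setFld _ _ _ _, fun h hh => ?_, fun i' hi' => ?_⟩
  · funext j
    simp [hr σ' hσ', hh, h₁ h hh]
  · rcases (Nat.lt_succ_iff.1 hi').lt_or_eq with h | rfl
    · simp [h.ne, hiσ', h₂ i' h]
    · simp [hiσ', hr σ' hσ', hs σ' hσ' (by omega)]

theorem Exec.exists_pointsP {c n : ℕ} (hcnt : σ.nat cntV 0 0 = c) (hn : σ.nat 0 0 1 = n)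
    (hm : σ.nat 0 0 0 = m) (hcM : c ≤ M) (hnM : n ≤ M) (hmM : m ≤ M)
    (hlen : ∀ h < c, σ.nat lenA h 0 ≤ m) :
    ∃ τ, Exec M pointsP σ τ ∧ τ.nat 3 0 0 = c ∧ τ.nat 3 0 1 = c + n ∧
      τ.nat dimV 0 0 = c + n ∧
      (∀ h < c, τ.nat 4 h 0 = σ.nat lenA h 0 ∧
        ∀ i < σ.nat lenA h 0, τ.fld 2 h i = σ.fld 0 i (σ.nat tupA h i)) ∧
      ∀ h < n, τ.nat 4 (c + h) 0 = σ.nat 2 h 0 ∧ ∀ i < m, τ.fld 2 (c + h) i = σ.fld 1 h i := by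
  refine Exec.bind (Exec.setNat _ _ _ _) ?_
  simp only [NExp.eval, hcnt]
  set σ₁ := σ.setNat 3 0 0 c with hσ₁
  have key₁ : ∃ τ, Exec M (loop rowV (var cntV)
      (.setNat 4 (var rowV) (.lit 0) (.get lenA (var rowV) (.lit 0)) ;;
        loop iV (.get lenA (var rowV) (.lit 0))
          (.setFld 2 (var rowV) (var iV) (.get 0 (var iV) (.get tupA (var rowV) (var iV)))))) σ₁ τ ∧
      (∀ h < c, τ.nat 4 h 0 = σ.nat lenA h 0 ∧
        ∀ i < σ.nat lenA h 0, τ.fld 2 h i = σ.fld 0 i (σ.nat tupA h i)) := by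
    refine Exec.exists_loop c (fun k τ => ∀ h < k, τ.nat 4 h 0 = σ.nat lenA h 0 ∧
        ∀ i < σ.nat lenA h 0, τ.fld 2 h i = σ.fld 0 i (σ.nat tupA h i)) hcM (by simp)
      (fun σ' h => by simp [h.nat cntV (by simp), hσ₁, hcnt]) (by simp) ?_ fun τ _ h => h
    intro k hk σ' hσ' hkσ' hinv
    have hlen' : σ'.nat lenA = σ.nat lenA := by
      rw [hσ'.nat lenA (by simp), hσ₁, Mem.setNat_nat_of_ne _ (by simp)]
    have htup' : σ'.nat tupA = σ.nat tupA := by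
      rw [hσ'.nat tupA (by simp), hσ₁, Mem.setNat_nat_of_ne _ (by simp)]
    have hA' : σ'.fld 0 = σ.fld 0 := by rw [hσ'.fld 0 (by simp), hσ₁, Mem.setNat_fld]
    refine Exec.bind (Exec.setNat _ _ _ _) ?_
    simp only [NExp.eval, hkσ', hlen']
    obtain ⟨τ, hτ, h₁, h₂⟩ := Exec.exists_fillRow (M := M) (b := 2) (l := σ.nat lenA k 0)
      (σ := σ'.setNat 4 k 0 (σ.nat lenA k 0)) (r := k) (e := .get lenA (var rowV) (.lit 0))
      (ρ := var rowV) (src := .get 0 (var iV) (.get tupA (var rowV) (var iV)))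
      (s := fun i => σ.fld 0 i (σ.nat tupA k i)) ((hlen k hk).trans hmM)
      (fun ρ h => by simp [h.nat lenA (by simp), h.nat rowV (by simp), hkσ', hlen'])
      (fun ρ h => by simp [h.nat rowV (by simp), hkσ'])
      (fun ρ h _ => by simp [h.nat rowV (by simp), h.nat tupA (by simp), h.fld 0 (by simp), hkσ',
        hA', htup'])
    refine ⟨τ, hτ, fun h hh => ?_⟩
    have h4 : τ.nat 4 = (σ'.setNat 4 k 0 (σ.nat lenA k 0)).nat 4 := hτ.natEq _ (by simp)
    rcases (Nat.lt_succ_iff.1 hh).lt_or_eq with hh | rfl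
    · simpa [h4, hh.ne, h₁ h hh.ne] using hinv h hh
    · simpa [h4] using h₂
  obtain ⟨σ₂, hσ₂, h₂⟩ := key₁
  refine Exec.bind hσ₂ ?_
  have hcnt₂ : σ₂.nat cntV 0 0 = c := by simp [hσ₂.natEq cntV (by simp), hσ₁, hcnt]
  have hin₂ : σ₂.nat 0 = σ.nat 0 := by
    rw [hσ₂.natEq 0 (by simp), hσ₁, Mem.setNat_nat_of_ne _ (by simp)]
  have hI₂ : σ₂.nat 2 = σ.nat 2 := by
    rw [hσ₂.natEq 2 (by simp), hσ₁, Mem.setNat_nat_of_ne _ (by simp)]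
  have hIf₂ : σ₂.fld 1 = σ.fld 1 := by rw [hσ₂.fldEq 1 (by simp), hσ₁, Mem.setNat_fld]
  have key₂ : ∃ τ, Exec M (loop rowV (.get 0 (.lit 0) (.lit 1))
      (.setNat 4 (.add (var cntV) (var rowV)) (.lit 0) (.get 2 (var rowV) (.lit 0)) ;;
        loop iV (.get 0 (.lit 0) (.lit 0))
          (.setFld 2 (.add (var cntV) (var rowV)) (var iV) (.get 1 (var rowV) (var iV))))) σ₂ τ ∧
      (∀ h < c, τ.nat 4 h = σ₂.nat 4 h ∧ τ.fld 2 h = σ₂.fld 2 h) ∧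
      ∀ h < n, τ.nat 4 (c + h) 0 = σ.nat 2 h 0 ∧ ∀ i < m, τ.fld 2 (c + h) i = σ.fld 1 h i := by
    refine Exec.exists_loop n (fun k τ =>
      (∀ h < c, τ.nat 4 h = σ₂.nat 4 h ∧ τ.fld 2 h = σ₂.fld 2 h) ∧
      ∀ h < k, τ.nat 4 (c + h) 0 = σ.nat 2 h 0 ∧ ∀ i < m, τ.fld 2 (c + h) i = σ.fld 1 h i)
      hnM (by simp) (fun σ' h => by simp [h.nat 0 (by simp), hin₂, hn])
      ⟨fun h _ => ⟨by rw [Mem.setNat_nat_of_ne _ (by simp)], rfl⟩, by simp⟩ ?_ fun τ _ h => h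
    intro k hk σ' hσ' hkσ' ⟨hold, hinv⟩
    have hcnt' : σ'.nat cntV 0 0 = c := by rw [hσ'.nat cntV (by simp), hcnt₂]
    have hI' : σ'.nat 2 = σ.nat 2 := by rw [hσ'.nat 2 (by simp), hI₂]
    have hin' : σ'.nat 0 = σ.nat 0 := by rw [hσ'.nat 0 (by simp), hin₂]
    have hIf' : σ'.fld 1 = σ.fld 1 := by rw [hσ'.fld 1 (by simp), hIf₂]
    refine Exec.bind (Exec.setNat _ _ _ _) ?_
    simp only [NExp.eval, hkσ', hcnt', hI']
    obtain ⟨τ, hτ, h₁, h₂⟩ := Exec.exists_fillRow (M := M) (b := 2) (l := m)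
      (σ := σ'.setNat 4 (c + k) 0 (σ.nat 2 k 0)) (r := c + k) (e := .get 0 (.lit 0) (.lit 0))
      (ρ := .add (var cntV) (var rowV)) (src := .get 1 (var rowV) (var iV))
      (s := fun i => σ.fld 1 k i) hmM
      (fun ρ h => by simp [h.nat 0 (by simp), hin', hm])
      (fun ρ h => by simp [h.nat rowV (by simp), h.nat cntV (by simp), hkσ', hcnt'])
      (fun ρ h _ => by simp [h.nat rowV (by simp), h.fld 1 (by simp), hkσ', hIf'])
    have h4 : τ.nat 4 = (σ'.setNat 4 (c + k) 0 (σ.nat 2 k 0)).nat 4 := hτ.natEq _ (by simp)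
    refine ⟨τ, hτ, fun h hh => ⟨?_, ?_⟩, fun h hh => ?_⟩
    · rw [Mem.setNat_nat_of_ne _ (by simp), h4, ← (hold h hh).1]
      funext j
      simp [show h ≠ c + k by omega]
    · rw [Mem.setNat_fld, h₁ h (by omega), ← (hold h hh).2, Mem.setNat_fld]
    · rcases (Nat.lt_succ_iff.1 hh).lt_or_eq with hh | rfl
      · simpa [h4, hh.ne, h₁ (c + h) (by omega)] using hinv h hh
      · simpa [h4] using h₂
  obtain ⟨σ₃, hσ₃, h₃, h₃'⟩ := key₂
  refine Exec.bind hσ₃ (Exec.bind (Exec.setNat _ _ _ _) ⟨_, Exec.setNat _ _ _ _, ?_⟩)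
  have hcnt₃ : σ₃.nat cntV 0 0 = c := by rw [hσ₃.natEq cntV (by simp), hcnt₂]
  have hin₃ : σ₃.nat 0 = σ.nat 0 := by rw [hσ₃.natEq 0 (by simp), hin₂]
  have hout₃ : σ₃.nat 3 0 0 = c := by
    rw [hσ₃.natEq 3 (by simp), hσ₂.natEq 3 (by simp), hσ₁]
    simp
  simp only [NExp.eval, Mem.setNat_nat, Mem.setNat_fld, hcnt₃, hin₃, hn]
  refine ⟨by simp [hout₃], by simp, by simp, fun h hh => ?_, fun h hh => ?_⟩
  · simpa [(h₃ h hh).1, (h₃ h hh).2] using h₂ h hh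
  · simpa using h₃' h hh

end Spec

/-! ### Subcube sums of polynomials and the encoding -/

/-- The polynomials of degree at most `d i` in the variable `i`. -/
def lowDeg (F : Type*) [Field F] {m : ℕ} (d : Fin m → ℕ) : Submodule F (MvPolynomial (Fin m) F) where
  carrier := {p | ∀ i, p.degreeOf i ≤ d i}
  add_mem' := fun hp hq i => (MvPolynomial.degreeOf_add_le i _ _).trans (max_le (hp i) (hq i))
  zero_mem' := fun i => by simp
  smul_mem' := fun c p hp i => by
    rw [MvPolynomial.smul_eq_C_mul]
    exact (MvPolynomial.degreeOf_C_mul_le _ _ _).trans (hp i)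

theorem mul_mem_lowDeg {F : Type*} [Field F] {m : ℕ} {d d' : Fin m → ℕ}
    {p q : MvPolynomial (Fin m) F} (hp : p ∈ lowDeg F d) (hq : q ∈ lowDeg F d') :
    p * q ∈ lowDeg F (d + d') := fun i =>
  (MvPolynomial.degreeOf_mul_le i p q).trans (add_le_add (hp i) (hq i))

/-- The value of a polynomial does not depend on the variables in which it has degree zero. -/
theorem eval_congr_of_mem_lowDeg {F : Type*} [Field F] {m : ℕ} {d : Fin m → ℕ}
    {p : MvPolynomial (Fin m) F} (hp : p ∈ lowDeg F d) {z z' : Fin m → F}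
    (h : ∀ i, d i ≠ 0 → z i = z' i) : MvPolynomial.eval z p = MvPolynomial.eval z' p := by
  rw [MvPolynomial.eval_eq, MvPolynomial.eval_eq]
  refine Finset.sum_congr rfl fun s hs => ?_
  congr 1
  refine Finset.prod_congr rfl fun i _ => ?_
  by_cases hi : d i = 0
  · have := (MvPolynomial.monomial_le_degreeOf i hs).trans (hp i)
    rw [hi, Nat.le_zero] at this
    rw [this, pow_zero, pow_zero]
  · rw [h i hi]

section Encoding

variable {F : Type*} {m : ℕ}

theorem mem_completions {A : Fin m → Finset F} {x : Pt F m} {z : Fin m → F} :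
    z ∈ completions A x ↔
      ∀ j : Fin m, (∀ h : (j : ℕ) < x.1, z j = x.2 ⟨j, h⟩) ∧ (¬ (j : ℕ) < x.1 → z j ∈ A j) := by
  rw [completions, Fintype.mem_piFinset]
  refine forall_congr' fun j => ?_
  by_cases h : (j : ℕ) < x.1 <;> simp [h]

theorem mem_of_mem_completions {A : Fin m → Finset F} {x : SumDom A} {z : Fin m → F}
    (hz : z ∈ completions A x.1) (j : Fin m) : z j ∈ A j := by
  have := mem_completions.1 hz j
  by_cases h : (j : ℕ) < x.1.1
  · rw [this.1 h]
    exact x.2 ⟨j, h⟩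
  · exact this.2 h

theorem completions_last (A : Fin m → Finset F) (z : Fin m → F) :
    completions A ⟨Fin.last m, z⟩ = {z} := by
  ext z'
  rw [mem_completions, Finset.mem_singleton, funext_iff]
  exact forall_congr' fun j => ⟨fun h => h.1 j.2, fun h => ⟨fun _ => h, fun h' => absurd j.2 h'⟩⟩

variable [Field F]

/-- The subcube sums of a polynomial, as a linear map. -/
noncomputable def polySums (A : Fin m → Finset F) : MvPolynomial (Fin m) F →ₗ[F] (Pt F m → F) :=
  (sumWord A).comp (MvPolynomial.evalₗ F (Fin m))

theorem polySums_apply (A : Fin m → Finset F) (p : MvPolynomial (Fin m) F) (x : Pt F m) :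
    polySums A p x = ∑ z ∈ completions A x, MvPolynomial.eval z p := rfl

/-- Every message consists of the subcube sums of its underlying function. -/
theorem message_eq_sum {A : Fin m → Finset F} (M : sumMessages A) (x : SumDom A)
    {g : (Fin m → F) → F} (hg : ∀ z, g z.1 = underlying A M z) :
    (M : SumDom A → F) x = ∑ z ∈ completions A x.1, g z := by
  obtain ⟨w, hw⟩ := LinearMap.mem_range.1 M.2
  have hM : ∀ x : SumDom A, (M : SumDom A → F) x = ∑ z ∈ completions A x.1, w z := fun x => by
    rw [← hw]
    rfl
  rw [hM]
  refine Finset.sum_congr rfl fun z hz => ?_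
  rw [hg ⟨z, mem_of_mem_completions hz⟩, underlying, hM, completions_last, Finset.sum_singleton]

variable [Fintype F]

theorem mem_extensionWords {A : Fin m → Finset F} {d : Fin m → ℕ}
    {f : {z : Fin m → F // ∀ j, z j ∈ A j} → F} {w : Pt F m → F} :
    w ∈ extensionWords A d f ↔ ∃ p ∈ lowDegExt A d f, polySums A p = w := by
  rw [extensionWords, Set.Finite.mem_toFinset]
  rfl

theorem exists_ENC_eq_iff {A : Fin m → Finset F} {d : Fin m → ℕ} {hd : ∀ i, (A i).card ≤ d i + 1}
    (E : LinearForm (sumRMEnc A d hd)) (M : sumMessages A) (w : Pt F m → F) :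
    (∃ μ, E.ENC (M, μ) = w) ↔ ∃ p ∈ lowDegExt A d (underlying A M), polySums A p = w := by
  have h := congrArg PMF.support (E.law M)
  rw [sumRMEnc, PMF.support_uniformOfFinset, PMF.support_map, PMF.support_uniformOfFintype] at h
  rw [← mem_extensionWords, ← Finset.mem_coe, h]
  simp

/-- The underlying function of a message, as a linear map. -/
def underlyingLin (A : Fin m → Finset F) :
    sumMessages A →ₗ[F] ({z : Fin m → F // ∀ j, z j ∈ A j} → F) where
  toFun := underlying A
  map_add' _ _ := rfl
  map_smul' _ _ := rfl

/-- The values on `A` of a polynomial of low degree, as a linear map. -/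
noncomputable def restrictLin (A : Fin m → Finset F) (d : Fin m → ℕ) :
    lowDeg F d →ₗ[F] ({z : Fin m → F // ∀ j, z j ∈ A j} → F) :=
  (LinearMap.funLeft F F Subtype.val).comp
    ((MvPolynomial.evalₗ F (Fin m)).comp (lowDeg F d).subtype)

/-- The images `W x` of the solutions `x` of `r x = y` are parametrised by `y` and a free vector:
a linear choice of one solution, perturbed by a combination of a basis of the images of the kernel
of `r`. -/
theorem exists_linear_parametrisation {F X Y D : Type*} [Field F] [AddCommGroup X] [Module F X]
    [AddCommGroup Y] [Module F Y] [AddCommGroup D] [Module F D] [Module.Finite F D]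
    (r : X →ₗ[F] Y) (hr : Function.Surjective r) (W : X →ₗ[F] D) :
    ∃ (n : ℕ) (E : (Y × (Fin n → F)) →ₗ[F] D), (∀ y, Function.Injective fun μ => E (y, μ)) ∧
      ∀ y w, (∃ μ, E (y, μ) = w) ↔ ∃ x, r x = y ∧ W x = w := by
  obtain ⟨s, hs⟩ := LinearMap.exists_rightInverse_of_surjective _ (LinearMap.range_eq_top.2 hr)
  have hs : ∀ y, r (s y) = y := LinearMap.congr_fun hs
  let V : Submodule F D := (LinearMap.ker r).map W
  let b := Module.finBasis F V
  refine ⟨_, (W.comp s).coprod (V.subtype.comp b.equivFun.symm.toLinearMap),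
    fun y μ μ' h => ?_, fun y w => ⟨?_, ?_⟩⟩
  · exact b.equivFun.symm.injective (Subtype.ext (add_left_cancel h))
  · rintro ⟨μ, rfl⟩
    obtain ⟨q, hq, hqV⟩ := (b.equivFun.symm μ).2
    refine ⟨s y + q, ?_, ?_⟩
    · rw [map_add, hs, LinearMap.mem_ker.1 hq, add_zero]
    · rw [map_add, hqV]
      rfl
  · rintro ⟨x, hx, rfl⟩
    have hV : W (x - s y) ∈ V :=
      ⟨x - s y, by rw [SetLike.mem_coe, LinearMap.mem_ker, map_sub, hs, hx, sub_self], rfl⟩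
    refine ⟨b.equivFun ⟨_, hV⟩, ?_⟩
    simp

theorem PMF.uniformOfFinset_eq_map {α β : Type*} [Fintype α] [Nonempty α] {f : α → β}
    (hf : Function.Injective f) {s : Finset β} (hs : s.Nonempty)
    (h : ∀ b, b ∈ s ↔ ∃ a, f a = b) :
    PMF.uniformOfFinset s hs = (PMF.uniformOfFintype α).map f := by
  classical
  have hset : s = Finset.univ.image f := by
    ext b
    simp [h]
  ext b
  rw [PMF.uniformOfFinset_apply, PMF.map_apply]
  split_ifs with hb
  · obtain ⟨a, rfl⟩ := (h b).1 hb
    rw [tsum_eq_single a, if_pos rfl, PMF.uniformOfFintype_apply, hset,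
      Finset.card_image_of_injective _ hf, Finset.card_univ]
    exact fun a' ha' => if_neg fun h => ha' (hf h).symm
  · rw [eq_comm, ENNReal.tsum_eq_zero]
    exact fun a => if_neg fun h' => hb ((h b).2 ⟨a, h'.symm⟩)

theorem nonempty_linearForm (A : Fin m → Finset F) (d : Fin m → ℕ)
    (hd : ∀ i, (A i).card ≤ d i + 1) : Nonempty (LinearForm (sumRMEnc A d hd)) := by
  have hsurj : Function.Surjective (restrictLin A d) := fun f => by
    obtain ⟨p, hp, hpf⟩ := lowDegExt_nonempty A d hd f
    exact ⟨⟨p, hp⟩, funext hpf⟩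
  obtain ⟨n, E, hinj, hE⟩ := exists_linear_parametrisation (restrictLin A d) hsurj
    ((polySums A).comp (lowDeg F d).subtype)
  refine ⟨⟨n, E.comp ((underlyingLin A).prodMap LinearMap.id), fun M =>
    PMF.uniformOfFinset_eq_map (hinj (underlying A M)) _ fun w => ?_⟩⟩
  rw [mem_extensionWords]
  refine Iff.trans ?_ (hE (underlying A M) w).symm
  exact ⟨fun ⟨p, ⟨hp, hpf⟩, h⟩ => ⟨⟨p, hp⟩, funext hpf, h⟩,
    fun ⟨p, hp, h⟩ => ⟨p.1, ⟨p.2, congrFun hp⟩, h⟩⟩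

end Encoding

/-! ### Locality of the constraints -/

/-- `a i 0, …, a i (c i - 1)` is a listing of the set `A i` without repetitions. -/
structure IsListing {F : Type*} {m : ℕ} (A : Fin m → Finset F) (c : ℕ → ℕ) (a : ℕ → ℕ → F) : Prop where
  card : ∀ i : Fin m, c i = (A i).card
  inj : ∀ i : Fin m, ∀ j < c i, ∀ k < c i, a i j = a i k → j = k
  mem_iff : ∀ (i : Fin m) (b : F), b ∈ A i ↔ ∃ j < c i, a i j = b

section Locality

variable {F : Type*} [Field F] {m n : ℕ} {A : Fin m → Finset F} {c : ℕ → ℕ} {a : ℕ → ℕ → F}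

/-- The prefix point with index tuple `κ`. -/
def ptOf (a : ℕ → ℕ → F) (κ : List ℕ) (h : κ.length ≤ m) : Pt F m :=
  ⟨⟨κ.length, Nat.lt_succ_of_le h⟩, fun j => a j (κ.getD j 0)⟩

theorem eq_of_ptOf_eq {F : Type*} {A : Fin m → Finset F} {a : ℕ → ℕ → F} (hA : IsListing A c a) {κ ρ : List ℕ} {hκ : κ.length ≤ m} {hρ : ρ.length ≤ m}
    (hκc : ∀ i < κ.length, κ.getD i 0 < c i) (hρc : ∀ i < ρ.length, ρ.getD i 0 < c i)
    (h : ptOf a κ hκ = ptOf a ρ hρ) : κ = ρ := by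
  have hlen : κ.length = ρ.length := congrArg (fun p : Pt F m => (p.1 : ℕ)) h
  refine List.ext_getElem hlen fun i hi hi' => ?_
  have hpt : ∀ p q : Pt F m, p = q → ∀ (hp : i < p.1) (hq : i < q.1), p.2 ⟨i, hp⟩ = q.2 ⟨i, hq⟩ := by
    rintro p _ rfl _ _
    rfl
  have := hA.inj ⟨i, hi.trans_le hκ⟩ _ (hκc i hi) _ (hρc i hi') (hpt _ _ h hi hi')
  rwa [List.getD_eq_getElem _ _ hi, List.getD_eq_getElem _ _ hi'] at this

/-- The unnormalised Lagrange polynomial of a prefix. On `A`, it vanishes exactly outside of the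
subcube of the prefix, and on this subcube it is constant. -/
noncomputable def prefixPoly (m : ℕ) (c : ℕ → ℕ) (a : ℕ → ℕ → F) (κ : List ℕ) :
    MvPolynomial (Fin m) F :=
  ∏ i : Fin m, if (i : ℕ) < κ.length then ∏ j ∈ (range (c i)).erase (κ.getD i 0),
    (MvPolynomial.X i - MvPolynomial.C (a i j)) else 1

theorem eval_prefixPoly (κ : List ℕ) (z : Fin m → F) :
    MvPolynomial.eval z (prefixPoly m c a κ) = ∏ i : Fin m, if (i : ℕ) < κ.length then
      ∏ j ∈ (range (c i)).erase (κ.getD i 0), (z i - a i j) else 1 := by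
  rw [prefixPoly, map_prod]
  refine prod_congr rfl fun i _ => ?_
  split_ifs <;> simp

theorem eval_prefixPoly_eq_vec {κ : List ℕ} (hκ : κ.length ≤ m) (x : ℕ → ℕ → F) (l : Fin n) :
    MvPolynomial.eval (fun i : Fin m => x l i) (prefixPoly m c a κ) =
      Trie.vec (lagrangeFactor c a x) n κ l := by
  rw [eval_prefixPoly, Trie.vec, ← Finset.prod_range fun i => if i < κ.length then
    ∏ j ∈ (range (c i)).erase (κ.getD i 0), (x l i - a i j) else 1]
  rw [← prod_subset (range_subset_range.2 hκ) fun i _ hi => if_neg (by simpa using hi)]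
  refine prod_congr rfl fun i hi => ?_
  rw [if_pos (mem_range.1 hi), lagrangeFactor]
  refine prod_subset_one_on_sdiff (erase_subset _ _) (fun j hj => ?_) fun j hj => ?_
  · rw [if_pos]
    by_contra h
    exact (mem_sdiff.1 hj).2 (mem_erase.2 ⟨h, (mem_sdiff.1 hj).1⟩)
  · rw [if_neg (mem_erase.1 hj).1]

theorem eval_prefixPoly_ne_zero (hA : IsListing A c a) {l : ℕ} {κ : List ℕ} (hκ : κ ∈ Trie.full c l)
    {z : Fin m → F} (hz : ∀ i : Fin m, (i : ℕ) < l → z i = a i (κ.getD i 0)) :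
    MvPolynomial.eval z (prefixPoly m c a κ) ≠ 0 := by
  rw [eval_prefixPoly, prod_ne_zero_iff]
  intro i _
  split_ifs with hi
  · rw [hκ.1] at hi
    refine prod_ne_zero_iff.2 fun j hj => sub_ne_zero.2 fun h => ?_
    rw [mem_erase, mem_range] at hj
    rw [hz i hi] at h
    exact hj.1 (hA.inj i _ (hκ.2 i hi) j hj.2 h).symm
  · exact one_ne_zero

theorem eval_prefixPoly_eq_zero {κ : List ℕ} {z : Fin m → F} {i : Fin m} (hi : (i : ℕ) < κ.length)
    {j : ℕ} (hj : j < c i) (hz : z i = a i j) (hne : j ≠ κ.getD i 0) :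
    MvPolynomial.eval z (prefixPoly m c a κ) = 0 := by
  rw [eval_prefixPoly]
  refine prod_eq_zero (mem_univ i) ?_
  rw [if_pos hi]
  exact prod_eq_zero (mem_erase.2 ⟨hne, mem_range.2 hj⟩) (by rw [hz, sub_self])

theorem prefixPoly_mem_lowDeg {l : ℕ} {κ : List ℕ} (hκ : κ ∈ Trie.full c l) :
    prefixPoly m c a κ ∈ lowDeg F fun i : Fin m => if (i : ℕ) < l then c i - 1 else 0 := by
  intro k
  refine (MvPolynomial.degreeOf_prod_le k _ _).trans ?_
  have key : ∀ i : Fin m, MvPolynomial.degreeOf k (if (i : ℕ) < κ.length then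
      ∏ j ∈ (range (c i)).erase (κ.getD i 0), (MvPolynomial.X i - MvPolynomial.C (a i j)) else 1) ≤
      if i = k then (if (k : ℕ) < l then c k - 1 else 0) else 0 := by
    intro i
    rw [hκ.1]
    by_cases hi : (i : ℕ) < l
    · rw [if_pos hi]
      refine (MvPolynomial.degreeOf_prod_le k _ _).trans ?_
      have h1 : ∀ j ∈ (range (c i)).erase (κ.getD i 0), MvPolynomial.degreeOf k
          (MvPolynomial.X i - MvPolynomial.C (a i j)) ≤ if i = k then 1 else 0 := by
        intro j _
        refine (MvPolynomial.degreeOf_sub_le _ _ _).trans ?_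
        rw [MvPolynomial.degreeOf_C, MvPolynomial.degreeOf_X]
        by_cases h : i = k
        · simp [h]
        · simp [h, Ne.symm h]
      refine (sum_le_sum h1).trans ?_
      rw [sum_const, card_erase_of_mem (mem_range.2 (hκ.2 i hi)), card_range]
      by_cases h : i = k
      · subst h
        simp [hi]
      · simp [h]
    · simp [hi]
  refine (sum_le_sum fun i _ => key i).trans ?_
  simp

/-- A prefix whose product vector is redundant admits a polynomial of low degree that vanishes on
all points, but not on the subcube of the prefix. -/
theorem exists_vanishing_poly (hA : IsListing A c a) {x : ℕ → ℕ → F} {l : ℕ} (hl : l ≤ m)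
    {κ : List ℕ} (hκ : κ ∈ Trie.level (lagrangeFactor c a x) c n l)
    (hκ' : κ ∉ Trie.greedy (lagrangeFactor c a x) n
      (Trie.level (lagrangeFactor c a x) c n l)) :
    ∃ q ∈ lowDeg F fun i : Fin m => if (i : ℕ) < l then c i - 1 else 0,
      (∀ k : Fin n, MvPolynomial.eval (fun i : Fin m => x k i) q = 0) ∧
      ∀ z : Fin m → F, (∀ i : Fin m, (i : ℕ) < l → z i = a i (κ.getD i 0)) →
        MvPolynomial.eval z q ≠ 0 := by
  set φ := lagrangeFactor c a x with hφ
  set acc := Trie.greedy φ n (Trie.level φ c n l) with hacc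
  have hfull := Trie.mem_full_of_mem_level hκ
  have haccfull : ∀ ρ ∈ acc, ρ ∈ Trie.full c l := fun ρ hρ =>
    Trie.mem_full_of_mem_level ((Trie.greedy_sublist _).mem hρ)
  let ev : MvPolynomial (Fin m) F →ₗ[F] (Fin n → F) :=
    { toFun := fun p k => MvPolynomial.eval (fun i : Fin m => x k i) p
      map_add' := fun p q => by
        funext k
        simp
      map_smul' := fun r p => by
        funext k
        simp }
  have hev : ∀ ρ ∈ Trie.full c l, ev (prefixPoly m c a ρ) = Trie.vec φ n ρ := fun ρ hρ =>
    funext fun k => eval_prefixPoly_eq_vec (by rw [hρ.1]; exact hl) x k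
  have hmem : Trie.vec φ n κ ∈ Trie.spanOf φ n acc := by
    rw [Trie.spanOf_greedy]
    exact Trie.vec_mem_spanOf hκ
  have himage : Trie.spanOf φ n acc =
      (Submodule.span F (prefixPoly m c a '' {ρ | ρ ∈ acc})).map ev := by
    rw [Submodule.map_span, Trie.spanOf, Set.image_image]
    congr 1
    exact Set.image_congr fun ρ hρ => (hev ρ (haccfull ρ hρ)).symm
  rw [himage] at hmem
  obtain ⟨u, hu, huev⟩ := hmem
  refine ⟨prefixPoly m c a κ - u, Submodule.sub_mem _ (prefixPoly_mem_lowDeg hfull) ?_,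
    fun k => ?_, fun z hz => ?_⟩
  · refine Submodule.span_le.2 ?_ hu
    rintro _ ⟨ρ, hρ, rfl⟩
    exact prefixPoly_mem_lowDeg (haccfull ρ hρ)
  · rw [map_sub, sub_eq_zero]
    have := congrFun (huev.trans (hev κ hfull).symm) k
    exact this.symm
  · have hu0 : MvPolynomial.eval z u = 0 := by
      refine Submodule.span_induction (p := fun u _ => MvPolynomial.eval z u = 0) ?_ (by simp)
        (fun p q _ _ hp hq => by rw [map_add, hp, hq, add_zero])
        (fun r p _ hp => by rw [MvPolynomial.smul_eval, hp, mul_zero]) hu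
      rintro _ ⟨ρ, hρ, rfl⟩
      have hρf := haccfull ρ hρ
      have hne : ∃ i < l, ρ.getD i 0 ≠ κ.getD i 0 := by
        by_contra! h
        refine hκ' ?_
        have : ρ = κ := by
          refine List.ext_getElem (by rw [hρf.1, hfull.1]) fun i h₁ h₂ => ?_
          have := h i (by rw [← hρf.1]; exact h₁)
          rwa [List.getD_eq_getElem _ _ h₁, List.getD_eq_getElem _ _ h₂] at this
        rwa [← this]
      obtain ⟨i, hi, hne⟩ := hne
      exact eval_prefixPoly_eq_zero (i := ⟨i, by omega⟩) (by rw [hρf.1]; exact hi)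
        (hfull.2 i hi) (hz ⟨i, by omega⟩ hi) hne.symm
    rw [map_sub, hu0, sub_zero]
    exact eval_prefixPoly_ne_zero hA hfull hz

/-- The point `z` lies in the subcube of the prefix with index tuple `κ`. -/
def InSubcube (a : ℕ → ℕ → F) (κ : List ℕ) (z : Fin m → F) : Prop :=
  ∀ i : Fin m, (i : ℕ) < κ.length → z i = a i (κ.getD i 0)

/-- A function `g` on `A` is extended from the subcube of a prefix by zero: there is a polynomial of
low degree with these values on `A` whose subcube sums vanish at all points. -/
def ExtendsFrom (A : Fin m → Finset F) (d : Fin m → ℕ) (a : ℕ → ℕ → F) (P : Fin n → Pt F m)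
    (g : (Fin m → F) → F) (κ : List ℕ) : Prop :=
  ∃ p ∈ lowDeg F d,
    (∀ z : Fin m → F, (∀ j, z j ∈ A j) → (InSubcube a κ z → MvPolynomial.eval z p = g z) ∧
      (¬ InSubcube a κ z → MvPolynomial.eval z p = 0)) ∧
    ∀ k, polySums A p (P k) = 0

/-- At a prefix that the search has dropped, a function with sum zero is extended from the subcube.
The extension is a product of three polynomials: one that vanishes at all points, the Lagrange
polynomial of the prefix, and an extension of `g` in the remaining variables. The first two only
involve the variables of the prefix, so that a subcube sum either contains a zero factor of the
first kind, or runs over all of the remaining variables and is a multiple of the sum of `g`. -/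
theorem extendsFrom_of_notMem_greedy [Fintype F] (hA : IsListing A c a) {d : Fin m → ℕ}
    (hd : ∀ i, 2 * ((A i).card - 1) ≤ d i) {P : Fin n → Pt F m} {x : ℕ → ℕ → F}
    (hx : ∀ k, ∀ j : Fin (P k).1, x k j = (P k).2 j) {g : (Fin m → F) → F} {l : ℕ} (hl : l ≤ m)
    {κ : List ℕ} (hκ : κ ∈ Trie.level (lagrangeFactor c a x) c n l)
    (hκ' : κ ∉ Trie.greedy (lagrangeFactor c a x) n
      (Trie.level (lagrangeFactor c a x) c n l))
    (hg : ∀ h : κ.length ≤ m, ∑ z ∈ completions A (ptOf a κ h), g z = 0) :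
    ExtendsFrom A d a P g κ := by
  classical
  have hfull := Trie.mem_full_of_mem_level hκ
  obtain ⟨hlen, hlt⟩ := id hfull
  have hg := hg (by omega)
  obtain ⟨q, hq, hqx, hq0⟩ := exists_vanishing_poly hA hl hκ hκ'
  set N := prefixPoly m c a κ with hN
  have hNdeg : N ∈ lowDeg F fun i : Fin m => if (i : ℕ) < l then c i - 1 else 0 :=
    prefixPoly_mem_lowDeg hfull
  let A' : Fin m → Finset F := fun i => if (i : ℕ) < l then {a i (κ.getD i 0)} else A i
  let d' : Fin m → ℕ := fun i => if (i : ℕ) < l then 0 else c i - 1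
  obtain ⟨h, hhdeg, hhg⟩ := lowDegExt_nonempty A' d' (fun i => by
    simp only [A', d', hA.card]
    split_ifs
    · simp
    · omega) fun z => g z
  replace hhg : ∀ z : Fin m → F, (∀ j, z j ∈ A' j) → MvPolynomial.eval z h = g z :=
    fun z hz => hhg ⟨z, hz⟩
  have hAmem : ∀ i : Fin m, (i : ℕ) < l → a i (κ.getD i 0) ∈ A i := fun i hi =>
    (hA.mem_iff i _).2 ⟨_, hlt i hi, rfl⟩
  -- replacing the coordinates of the prefix changes neither `h` nor the remaining coordinates
  let T : (Fin m → F) → Fin m → F := fun z i => if (i : ℕ) < l then a i (κ.getD i 0) else z i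
  have hT : ∀ z : Fin m → F, (∀ i : Fin m, ¬ (i : ℕ) < l → z i ∈ A i) →
      MvPolynomial.eval z h = g (T z) := fun z hz => by
    rw [← hhg (T z) fun i => ?_]
    · refine eval_congr_of_mem_lowDeg hhdeg fun i hi => ?_
      have : ¬ (i : ℕ) < l := fun hil => hi (by simp [d', hil])
      simp [T, this]
    · by_cases hi : (i : ℕ) < l
      · simp [T, A', hi]
      · simpa [T, A', hi] using hz i hi
  have hqN : ∀ z z' : Fin m → F, (∀ i : Fin m, (i : ℕ) < l → z i = z' i) →
      MvPolynomial.eval z (q * N) = MvPolynomial.eval z' (q * N) := fun z z' hz => by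
    refine eval_congr_of_mem_lowDeg (mul_mem_lowDeg hq hNdeg) fun i hi => hz i ?_
    by_contra hil
    exact hi (by simp [hil])
  let z₀ : Fin m → F := fun i => a i (κ.getD i 0)
  have hne : MvPolynomial.eval z₀ (q * N) ≠ 0 := by
    rw [map_mul]
    exact mul_ne_zero (hq0 _ fun _ _ => rfl) (eval_prefixPoly_ne_zero hA hfull fun _ _ => rfl)
  have heval : ∀ z, MvPolynomial.eval z ((MvPolynomial.eval z₀ (q * N))⁻¹ • (q * N * h)) =
      (MvPolynomial.eval z₀ (q * N))⁻¹ * (MvPolynomial.eval z (q * N) * MvPolynomial.eval z h) :=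
    fun z => by rw [MvPolynomial.smul_eval, map_mul _ (q * N) h]
  have hNzero : ∀ z : Fin m → F, ∀ i : Fin m, (i : ℕ) < l → z i ∈ A i → z i ≠ a i (κ.getD i 0) →
      MvPolynomial.eval z (q * N) = 0 := fun z i hi hz hzi => by
    obtain ⟨j, hj, hjz⟩ := (hA.mem_iff i _).1 hz
    rw [map_mul, eval_prefixPoly_eq_zero (by rw [hlen]; exact hi) hj hjz.symm, mul_zero]
    rintro rfl
    exact hzi hjz.symm
  refine ⟨(MvPolynomial.eval z₀ (q * N))⁻¹ • (q * N * h), Submodule.smul_mem _ _ fun i => ?_,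
    fun z hz => ⟨fun hzκ => ?_, fun hzκ => ?_⟩, fun k => ?_⟩
  · refine (mul_mem_lowDeg (mul_mem_lowDeg hq hNdeg) hhdeg i).trans ?_
    have := hd i
    simp only [Pi.add_apply, d', hA.card]
    split_ifs <;> omega
  · rw [InSubcube, hlen] at hzκ
    rw [heval, hqN z z₀ hzκ, inv_mul_cancel_left₀ hne,
      hT z fun i _ => hz i]
    congr 1
    funext i
    simp only [T]
    split_ifs with hi
    · exact (hzκ i hi).symm
    · rfl
  · rw [InSubcube, hlen] at hzκ
    push Not at hzκ
    obtain ⟨i, hi, hzi⟩ := hzκ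
    rw [heval, hNzero z i hi (hz i) hzi, zero_mul, mul_zero]
  · rw [polySums_apply]
    rcases le_or_gt l (P k).1 with hlk | hlk
    · refine sum_eq_zero fun z hz => ?_
      have : MvPolynomial.eval z (q * N) = 0 := by
        rw [hqN z (fun i => x k i) fun i hi => ?_, map_mul, hqx, zero_mul]
        have hi' : (i : ℕ) < (P k).1 := by omega
        rw [(mem_completions.1 hz i).1 hi', hx k ⟨i, hi'⟩]
      rw [heval, this, zero_mul, mul_zero]
    · let z₁ : Fin m → F := fun i => if hi : (i : ℕ) < (P k).1 then (P k).2 ⟨i, hi⟩ else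
        a i (κ.getD i 0)
      let C := (MvPolynomial.eval z₀ (q * N))⁻¹ * MvPolynomial.eval z₁ (q * N)
      have hterm : ∀ z ∈ completions A (P k),
          MvPolynomial.eval z ((MvPolynomial.eval z₀ (q * N))⁻¹ • (q * N * h)) =
          if ∀ i : Fin m, (i : ℕ) < l → z i = z₁ i then C * g (T z) else 0 := by
        intro z hz
        rw [heval]
        split_ifs with hz₁
        · rw [hqN z z₁ hz₁, hT z fun i hi => (mem_completions.1 hz i).2 (by omega), ← mul_assoc]
        · push Not at hz₁
          obtain ⟨i, hi, hzi⟩ := hz₁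
          have hiP : ¬ (i : ℕ) < (P k).1 := fun h' => hzi (by
            rw [(mem_completions.1 hz i).1 h']
            simp [z₁, h'])
          rw [hNzero z i hi ((mem_completions.1 hz i).2 hiP) (by simpa [z₁, hiP] using hzi),
            zero_mul, mul_zero]
      rw [sum_congr rfl hterm, ← sum_filter, ← mul_sum, ← mul_zero C, ← hg]
      congr 1
      refine sum_nbij' T (fun z i => if (i : ℕ) < l then z₁ i else z i) (fun z hz => ?_)
        (fun z hz => ?_) (fun z hz => ?_) (fun z hz => ?_) fun _ _ => rfl
      · rw [mem_filter, mem_completions] at hz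
        rw [mem_completions]
        intro j
        refine ⟨fun hj => ?_, fun hj => ?_⟩
        · simp only [ptOf, hlen] at hj
          simp [T, hj, ptOf]
        · simp only [ptOf, hlen] at hj
          simpa [T, hj] using (hz.1 j).2 (by omega)
      · rw [mem_completions] at hz
        rw [mem_filter, mem_completions]
        refine ⟨fun j => ⟨fun hj => ?_, fun hj => ?_⟩, fun i hi => by simp [hi]⟩
        · simp [hj.trans hlk, z₁, hj]
        · by_cases hjl : (j : ℕ) < l
          · simpa [hjl, z₁, hj] using hAmem j hjl
          · simpa [hjl] using (hz j).2 (by simpa [ptOf, hlen] using hjl)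
      · rw [mem_filter] at hz
        funext i
        by_cases hi : (i : ℕ) < l
        · simp [hi, hz.2 i hi]
        · simp [T, hi]
      · rw [mem_completions] at hz
        funext i
        by_cases hi : (i : ℕ) < l
        · have := (hz i).1 (by simpa [ptOf, hlen] using hi)
          simpa [T, hi, ptOf] using this.symm
        · simp [T, hi]

/-- Extensions from all subcubes in the tree of the search, from the leaves to the root. -/
theorem extendsFrom_of_mem_level [Fintype F] (hA : IsListing A c a) {d : Fin m → ℕ}
    (hd : ∀ i, 2 * ((A i).card - 1) ≤ d i) {P : Fin n → Pt F m} {x : ℕ → ℕ → F}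
    (hx : ∀ k, ∀ j : Fin (P k).1, x k j = (P k).2 j) {g : (Fin m → F) → F}
    (hg : ∀ κ ∈ Trie.upTo (lagrangeFactor c a x) c n m, ∀ h : κ.length ≤ m,
      ∑ z ∈ completions A (ptOf a κ h), g z = 0) {l : ℕ} (hl : l ≤ m) :
    ∀ κ ∈ Trie.level (lagrangeFactor c a x) c n l, ExtendsFrom A d a P g κ := by
  classical
  induction hl using Nat.decreasingInduction with
  | self =>
    intro κ hκ
    have hκg := hg κ (Trie.mem_upTo.2 ⟨m, le_rfl, hκ⟩)
    have hlen := Trie.length_of_mem_level hκ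
    refine ⟨0, Submodule.zero_mem _, fun z _ => ⟨fun hzκ => ?_, fun _ => map_zero _⟩,
      fun k => by rw [map_zero, Pi.zero_apply]⟩
    have h := hκg hlen.le
    rw [sum_eq_single_of_mem z] at h
    · rw [h, map_zero]
    · exact mem_completions.2 fun j => ⟨fun hj => hzκ j hj, fun hj => absurd (hlen ▸ j.2) hj⟩
    · refine fun z' hz' hne => absurd (funext fun j => ?_) hne
      have hj : (j : ℕ) < κ.length := hlen ▸ j.2
      rw [hzκ j hj]
      exact (mem_completions.1 hz' j).1 hj
  | of_succ l hl ih =>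
    intro κ hκ
    have hlen := Trie.length_of_mem_level hκ
    by_cases hκ' : κ ∈ Trie.greedy (lagrangeFactor c a x) n
      (Trie.level (lagrangeFactor c a x) c n l)
    · have hchild : ∀ k : Fin (c l), ExtendsFrom A d a P g (κ ++ [(k : ℕ)]) := fun k =>
        ih _ (Trie.mem_level_succ.2 ⟨κ, hκ', k, k.2, rfl⟩)
      choose p hp hpg hpP using hchild
      have hsub : ∀ (z : Fin m → F) (k : ℕ), InSubcube a (κ ++ [k]) z ↔
          InSubcube a κ z ∧ z ⟨l, hl⟩ = a l k := by
        intro z k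
        simp only [InSubcube, List.length_append, List.length_singleton, hlen]
        constructor
        · refine fun h => ⟨fun i hi => ?_, ?_⟩
          · rw [h i (by omega), List.getD_append _ _ _ _ (by omega)]
          · rw [h ⟨l, hl⟩ (by simp), List.getD_append_right _ _ _ _ (by simp [hlen])]
            simp [hlen]
        · rintro ⟨h, h'⟩ i hi
          rcases (Nat.lt_succ_iff.1 hi).lt_or_eq with hil | hil
          · rw [h i hil, List.getD_append _ _ _ _ (by omega)]
          · rw [List.getD_append_right _ _ _ _ (by omega)]
            obtain rfl : i = ⟨l, hl⟩ := Fin.ext hil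
            simpa [hlen] using h'
      refine ⟨∑ k, p k, Submodule.sum_mem _ fun k _ => hp k, fun z hz => ⟨fun hzκ => ?_,
        fun hzκ => ?_⟩, fun k => ?_⟩
      · obtain ⟨j, hj, hjz⟩ := (hA.mem_iff ⟨l, hl⟩ _).1 (hz ⟨l, hl⟩)
        rw [map_sum, sum_eq_single_of_mem ⟨j, hj⟩ (mem_univ _)]
        · exact (hpg _ z hz).1 ((hsub z j).2 ⟨hzκ, hjz.symm⟩)
        · refine fun k _ hk => (hpg k z hz).2 fun h => hk (Fin.ext ?_)
          exact hA.inj ⟨l, hl⟩ k k.2 j hj (((hsub z k).1 h).2.symm.trans hjz.symm)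
      · rw [map_sum]
        exact sum_eq_zero fun k _ => (hpg k z hz).2 fun h => hzκ ((hsub z k).1 h).1
      · rw [map_sum, Finset.sum_apply]
        exact sum_eq_zero fun j _ => hpP j k
    · exact extendsFrom_of_notMem_greedy hA hd hx hl.le hκ hκ'
        (hg κ (Trie.mem_upTo.2 ⟨l, hl.le, hκ⟩))

end Locality

/-! ### The constraint matrix -/

section Constraints

variable {F : Type*} [Field F] {m : ℕ} {A : Fin m → Finset F} {d : Fin m → ℕ}

theorem IsListing.sum_eq {c : ℕ → ℕ} {a : ℕ → ℕ → F} (hA : IsListing A c a) (i : Fin m)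
    (f : F → F) : ∑ b ∈ A i, f b = ∑ j ∈ range (c i), f (a i j) := by
  classical
  have : A i = (range (c i)).image (a i) := by
    ext b
    simp [hA.mem_iff]
  rw [this, sum_image]
  intro j hj k hk h
  exact hA.inj i j (by simpa using hj) k (by simpa using hk) h

/-- The product vectors of power sums are the subcube sums of monomials. -/
theorem polySums_monomial {c : ℕ → ℕ} {a : ℕ → ℕ → F} (hA : IsListing A c a) {N : ℕ}
    {P : Fin N → Pt F m} {len : ℕ → ℕ} {x : ℕ → ℕ → F} (hlen : ∀ k : Fin N, len k = (P k).1)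
    (hx : ∀ k, ∀ j : Fin (P k).1, x k j = (P k).2 j) {κ : List ℕ} (hκ : κ.length = m)
    {s : Fin m →₀ ℕ} (hs : ∀ i, s i = κ.getD i 0) (k : Fin N) :
    polySums A (MvPolynomial.monomial s 1) (P k) =
      Trie.vec (powerSumFactor c a len x) N κ k := by
  have h : ∀ z : Fin m → F, MvPolynomial.eval z (MvPolynomial.monomial s 1) =
      ∏ i, z i ^ s i := fun z => by
    rw [MvPolynomial.eval_monomial, one_mul, Finsupp.prod_fintype]
    simp
  rw [polySums_apply, sum_congr rfl fun z _ => h z, completions,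
    ← prod_univ_sum _ fun i b => b ^ s i, Trie.vec, hκ, prod_range]
  refine prod_congr rfl fun i _ => ?_
  rw [powerSumFactor, hlen, ← hs]
  split_ifs with hi
  · rw [sum_singleton, hx k ⟨i, hi⟩]
  · exact hA.sum_eq i fun b => b ^ s i

/-- The product vectors of power sums span the space of all vectors of subcube sums of
polynomials of low degree. -/
theorem span_vec_powerSumFactor {c : ℕ → ℕ} {a : ℕ → ℕ → F} (hA : IsListing A c a) {N : ℕ}
    {P : Fin N → Pt F m} {len : ℕ → ℕ} {x : ℕ → ℕ → F} (hlen : ∀ k : Fin N, len k = (P k).1)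
    (hx : ∀ k, ∀ j : Fin (P k).1, x k j = (P k).2 j) {Kf : ℕ → ℕ} (hK : ∀ i : Fin m, Kf i = d i + 1) :
    Submodule.span F (Trie.vec (powerSumFactor c a len x) N '' Trie.full Kf m) =
      (lowDeg F d).map ((LinearMap.funLeft F F P).comp (polySums A)) := by
  classical
  refine le_antisymm (Submodule.span_le.2 ?_) (Submodule.map_le_iff_le_comap.2 fun p hp => ?_)
  · rintro _ ⟨κ, ⟨hκ, hlt⟩, rfl⟩
    let s : Fin m →₀ ℕ := Finsupp.equivFunOnFinite.symm fun i => κ.getD i 0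
    refine ⟨MvPolynomial.monomial s 1, fun i => ?_,
      funext fun k => polySums_monomial hA hlen hx hκ (fun _ => rfl) k⟩
    rw [MvPolynomial.degreeOf_monomial_eq _ _ one_ne_zero]
    exact Nat.lt_succ_iff.1 ((hlt i i.2).trans_eq (hK i))
  · rw [Submodule.mem_comap, p.as_sum, map_sum]
    refine Submodule.sum_mem _ fun s hs => ?_
    rw [← mul_one (MvPolynomial.coeff s p), ← smul_eq_mul, ← MvPolynomial.smul_monomial, map_smul]
    refine Submodule.smul_mem _ _ (Submodule.subset_span ⟨List.ofFn s, ⟨by simp, fun i hi => ?_⟩,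
      funext fun k => ?_⟩)
    · rw [hK ⟨i, hi⟩, Nat.lt_succ_iff]
      simpa [hi] using (MvPolynomial.monomial_le_degreeOf ⟨i, hi⟩ hs).trans (hp ⟨i, hi⟩)
    · exact (polySums_monomial hA hlen hx (by simp) (fun i => by simp) k).symm

/-- If every function on `A` without subcube sums on `R` has an extension without subcube sums on
`I`, then the constraints on `R` and `I` are those that hold for all polynomials of low degree. -/
theorem isConstraintSystem_of_ker [Fintype F] {hd : ∀ i, (A i).card ≤ d i + 1}
    (E : LinearForm (sumRMEnc A d hd)) {I : Finset (Pt F m)} (eI : Fin I.card ≃ I)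
    {R : Finset (SumDom A)} (eR : Fin R.card ≃ R) {k : ℕ}
    (W : Matrix (Fin k) (Fin (R.card + I.card)) F)
    (hW : ∀ b, W.mulVec b = 0 ↔ ∃ p ∈ lowDeg F d, ∀ j,
      polySums A p (Fin.append (fun l => (eR l).1.1) (fun l => (eI l).1) j) = b j)
    (hloc : ∀ g : (Fin m → F) → F, (∀ s ∈ R, ∑ z ∈ completions A s.1, g z = 0) →
      ∃ p ∈ lowDegExt A d fun z => g z, ∀ x ∈ I, polySums A p x = 0) :
    IsConstraintSystem E I R (Matrix.of fun i => Sum.elim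
      (fun s => W i (Fin.castAdd I.card (eR.symm s)))
      (fun x => W i (Fin.natAdd R.card (eI.symm x)))) := by
  intro M β
  have hmul : ∀ i, (Matrix.of fun i => Sum.elim (fun s => W i (Fin.castAdd I.card (eR.symm s)))
      (fun x => W i (Fin.natAdd R.card (eI.symm x)))).mulVec
        (Sum.elim (fun s : R => (M : SumDom A → F) s) β) i =
      W.mulVec (Fin.append (fun l => (M : SumDom A → F) (eR l)) fun l => β (eI l)) i := by
    intro i
    simp only [Matrix.mulVec, dotProduct, Matrix.of_apply, Fintype.sum_sum_type, Sum.elim_inl,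
      Sum.elim_inr, Fin.sum_univ_add, Fin.append_left, Fin.append_right]
    congr 1
    · rw [← Equiv.sum_comp eR]
      simp
    · rw [← Equiv.sum_comp eI]
      simp
  rw [funext hmul, hW]
  constructor
  · rintro ⟨p, hp, hpb⟩
    obtain ⟨p₀, hp₀, hp₀M⟩ := lowDegExt_nonempty A d hd (underlying A M)
    have hpR : ∀ s ∈ R, polySums A p s.1 = (M : SumDom A → F) s := fun s hs => by
      simpa using hpb (Fin.castAdd _ (eR.symm ⟨s, hs⟩))
    have hpI : ∀ x : I, polySums A p x.1 = β x := fun x => by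
      simpa using hpb (Fin.natAdd _ (eI.symm x))
    obtain ⟨p₁, ⟨hp₁, hp₁g⟩, hp₁I⟩ := hloc
      (fun z => MvPolynomial.eval z p₀ - MvPolynomial.eval z p) fun s hs => by
        rw [sum_sub_distrib, ← message_eq_sum M s hp₀M, ← polySums_apply, hpR s hs, sub_self]
    obtain ⟨μ, hμ⟩ := (exists_ENC_eq_iff E M (polySums A (p + p₁))).2
      ⟨p + p₁, ⟨(lowDeg F d).add_mem hp hp₁, fun z => by
        rw [map_add, hp₁g, ← hp₀M, add_sub_cancel]⟩, rfl⟩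
    refine ⟨μ, funext fun x => ?_⟩
    rw [hμ, map_add, Pi.add_apply, hpI, hp₁I x x.2, add_zero]
  · rintro ⟨μ, hμ⟩
    obtain ⟨p, ⟨hp, hpM⟩, hpw⟩ := (exists_ENC_eq_iff E M _).1 ⟨μ, rfl⟩
    refine ⟨p, hp, fun j => ?_⟩
    refine Fin.addCases (fun l => ?_) (fun l => ?_) j
    · rw [Fin.append_left, Fin.append_left, message_eq_sum M _ (g := fun z => MvPolynomial.eval z p) hpM,
        polySums_apply]
    · rw [Fin.append_right, Fin.append_right, hpw, ← hμ]

end Constraints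

/-! ### The constraint locator -/

section Locator

/-- An upper bound for all numbers of iterations, in terms of the number `m` of variables, the
maximal degree `D` and the number `n` of points; the number of columns of the constraint matrix is
at most `1 + m n (D + 1) + n`. -/
def iterBound {S : Type*} [CommSemiring S] (m D n : S) : S :=
  (1 + m * ((1 + m * (n * (D + 1)) + n) * (D + 1))) + (1 + m * (n * (D + 1)) + n) + (m + D + 1)

variable {F : Type*} [Field F] {m : ℕ} {A : Fin m → Finset F} {d : Fin m → ℕ}

theorem isListing_inputMem (eA : ∀ i, Fin (A i).card ≃ A i) {I : Finset (Pt F m)}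
    (eI : Fin I.card ≃ I) : IsListing A (fun i => (inputMem d A eA I eI).nat 1 i 1)
      ((inputMem d A eA I eI).fld 0) := by
  refine ⟨fun i => by simp [inputMem], fun i j hj k hk h => ?_, fun i b => ⟨fun hb => ?_, ?_⟩⟩
  · simp only [inputMem, Fin.is_lt, dite_true, one_ne_zero, if_false, if_true] at hj hk h
    rw [dif_pos hj, dif_pos hk] at h
    exact congrArg Fin.val ((eA i).injective (Subtype.ext h))
  · refine ⟨(eA i).symm ⟨b, hb⟩, by simp [inputMem], by simp [inputMem]⟩
  · rintro ⟨j, hj, rfl⟩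
    simp only [inputMem, Fin.is_lt, dite_true, one_ne_zero, if_false, if_true] at hj
    simp [inputMem, hj]

theorem inputMem_pts (eA : ∀ i, Fin (A i).card ≃ A i) {I : Finset (Pt F m)}
    (eI : Fin I.card ≃ I) (k : Fin I.card) (j : Fin (eI k).1.1) :
    (inputMem d A eA I eI).fld 1 k j = (eI k).1.2 j := by
  simp [inputMem]

theorem Trie.upTo_zero {φ : ℕ → ℕ → ℕ → F} {K : ℕ → ℕ} (l : ℕ) : Trie.upTo φ K 0 l = [] := by
  have hlevel : ∀ l, Trie.level φ K 0 l = [] := fun l => by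
    induction l with
    | zero => rfl
    | succ l ih => rw [Trie.level, ih, Trie.greedy_nil, List.flatMap_nil]
  induction l with
  | zero => exact hlevel 0
  | succ l ih => rw [Trie.upTo, ih, hlevel, List.nil_append]

/-- The correctness of the program: it lists the prefixes visited by the first search, and the
kernel of its matrix consists of the restrictions of the subcube sums of polynomials of low degree
to the listed points and `I`. -/
theorem Exec.exists_locatorP [Fintype F] (hd : ∀ i, 2 * ((A i).card - 1) ≤ d i)
    (eA : ∀ i, Fin (A i).card ≃ A i) {I : Finset (Pt F m)} (eI : Fin I.card ≃ I)
    {c : ℕ → ℕ} {a x : ℕ → ℕ → F} {L : List (List ℕ)}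
    (hc : c = fun i => (inputMem d A eA I eI).nat 1 i 1)
    (ha : a = (inputMem d A eA I eI).fld 0) (hx : x = (inputMem d A eA I eI).fld 1)
    (hL : L = Trie.upTo (lagrangeFactor c a x) c I.card m) (hLm : ∀ κ ∈ L, κ.length ≤ m) :
    ∃ τ, Exec (iterBound m (univ.sup d) I.card) locatorP (inputMem d A eA I eI) τ ∧
      τ.nat 3 0 0 = L.length ∧ τ.nat 3 0 1 = L.length + I.card ∧
      (∀ h : Fin L.length, τ.nat 4 h 0 = L[h].length ∧
        ∀ i < L[h].length, τ.fld 2 h i = a i (L[h].getD i 0)) ∧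
      ∀ b : Fin (L.length + I.card) → F, (τ.mat (L.length + I.card)).mulVec b = 0 ↔
        ∃ p ∈ lowDeg F d, ∀ j, polySums A p (Fin.append
          (fun l : Fin L.length => ptOf a L[l] (hLm _ (List.getElem_mem l.2)))
          (fun l => (eI l).1) j) = b j := by
  set σ := inputMem d A eA I eI with hσ
  set D := univ.sup d with hD
  set M := iterBound m D I.card with hM
  have hdD : ∀ i, d i ≤ D := fun i => le_sup (f := d) (mem_univ i)
  have hA : IsListing A c a := by
    rw [hc, ha]
    exact isListing_inputMem eA eI
  have hσ00 : σ.nat 0 0 0 = m := by simp [hσ, inputMem]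
  have hσ01 : σ.nat 0 0 1 = I.card := by simp [hσ, inputMem]
  have hcD : ∀ i, c i ≤ D + 1 := fun i => by
    by_cases hi : i < m
    · have h₁ := hA.card ⟨i, hi⟩
      have h₂ := hd ⟨i, hi⟩
      have h₃ := hdD ⟨i, hi⟩
      simp only at h₁
      omega
    · simp [hc, hσ, inputMem, hi]
  have hcm : c m = 0 := by simp [hc, hσ, inputMem]
  have hlist : ∀ (φ : ℕ → ℕ → ℕ → F) (K : ℕ → ℕ) (N l : ℕ), l ≤ m → (∀ i < m, K i ≤ D + 1) →
      (Trie.upTo φ K N l).length ≤ 1 + m * (N * (D + 1)) := fun φ K N l hl hK => by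
    refine (Trie.length_upTo_le l).trans (Nat.add_le_add_left ?_ 1)
    refine (sum_le_card_nsmul _ _ (N * (D + 1)) fun i hi => ?_).trans ?_
    · exact Nat.mul_le_mul_left _ (hK i ((mem_range.1 hi).trans_le hl))
    · rw [card_range, smul_eq_mul]
      exact Nat.mul_le_mul_right _ hl
  have hLlen : L.length ≤ 1 + m * (I.card * (D + 1)) := by
    rw [hL]
    exact hlist _ _ _ _ le_rfl fun i _ => hcD i
  have hNle : L.length + I.card ≤ 1 + m * (I.card * (D + 1)) + I.card := by omega
  have hmul : m * ((L.length + I.card) * (D + 1)) ≤ m * ((1 + m * (I.card * (D + 1)) + I.card) * (D + 1)) :=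
    Nat.mul_le_mul_left _ (Nat.mul_le_mul_right _ hNle)
  have hMdef : M = (1 + m * ((1 + m * (I.card * (D + 1)) + I.card) * (D + 1))) +
    (1 + m * (I.card * (D + 1)) + I.card) + (m + D + 1) := rfl
  -- the first search
  have h₁ : Exec M (setVar dimV (.get 0 (.lit 0) (.lit 1))) σ (σ.setNat dimV 0 0 I.card) := by
    have := Exec.setNat (M := M) (σ := σ) dimV (.lit 0) (.lit 0) (.get 0 (.lit 0) (.lit 1))
    simpa only [NExp.eval, hσ01] using this
  refine Exec.bind h₁ ?_
  set σ₁ := σ.setNat dimV 0 0 I.card with hσ₁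
  have hnat₁ : ∀ b, b ≤ 4 → σ₁.nat b = σ.nat b := fun b hb =>
    Mem.setNat_nat_of_ne _ (by omega) _ _ _
  have spec₁ : SearchSpec M lagrangeP (.get 1 (var lvlV) (.lit 1)) σ₁ m I.card c
      (lagrangeFactor c a x) := by
    have hcomp : Computes M lagrangeP σ₁ m I.card c (lagrangeFactor (fun i => σ₁.nat 1 i 1)
        (σ₁.fld 0) (σ₁.fld 1)) := computes_lagrangeP fun i _ => by
      have := hcD i
      simp only [hc] at this
      rw [hnat₁ 1 (by simp)]
      omega
    rw [hnat₁ 1 (by simp), hσ₁, Mem.setNat_fld, ← hc, ← ha, ← hx] at hcomp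
    refine ⟨hcomp, fun ρ hρ _ => ?_, ?_, by simp [hσ₁], by omega, by omega,
      fun i _ => ?_, fun l hl => ?_⟩
    · simp [hρ.nat 1 (by simp), hnat₁ 1, hc]
    · rw [hnat₁ 0 (by simp), hσ00]
    · have := hcD i
      omega
    · have := hlist (lagrangeFactor c a x) c I.card l hl fun i _ => hcD i
      omega
  obtain ⟨σ₂, h₂, -, htup₂⟩ := Exec.exists_searchP spec₁
  refine Exec.bind h₂ ?_
  have hlast : Trie.level (lagrangeFactor c a x) c I.card (m + 1) = [] := by
    rw [List.eq_nil_iff_forall_not_mem]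
    intro κ hκ
    obtain ⟨κ', -, k, hk, -⟩ := Trie.mem_level_succ.1 hκ
    omega
  rw [Trie.upTo, hlast, List.append_nil, ← hL] at htup₂
  have hin₂ : SameInput σ₁ σ₂ := h₂.sameOff.sameInput
    ⟨fun b hb => by simp [searchP, spec₁.fac.keepsInput_levelP.nat b hb]; omega,
      by simp [searchP, spec₁.fac.keepsInput_levelP.dim],
      fun b hb => by simp [searchP, spec₁.fac.keepsInput_levelP.fld b hb]⟩
  have hnat₂ : ∀ b, b ≤ 4 → σ₂.nat b = σ.nat b := fun b hb => by
    rw [hin₂.nat b hb, hnat₁ b hb]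
  have hfld₂ : ∀ b, b ≤ 2 → σ₂.fld b = σ.fld b := fun b hb => hin₂.fld b hb
  have hcnt₂ : σ₂.nat cntV 0 0 = L.length := by rw [← Mem.length_tuples, htup₂]
  have htuple₂ : ∀ h : Fin L.length, σ₂.tuple h = L[h] := fun h => by
    have h' : σ₂.tuples[(h : ℕ)]? = some (σ₂.tuple h) := by
      simp [Mem.tuples, hcnt₂]
    rw [htup₂, List.getElem?_eq_getElem h.2] at h'
    exact (Option.some.inj h').symm
  have hlen₂ : ∀ h : Fin L.length, σ₂.nat lenA h 0 = L[h].length := fun h => by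
    rw [← Mem.length_tuple, htuple₂]
  -- the points
  obtain ⟨σ₃, h₃, hout₃, hout₃', hdim₃, hR₃, hI₃⟩ := Exec.exists_pointsP (M := M) (σ := σ₂)
    (m := m) (c := L.length) (n := I.card) hcnt₂ (by rw [hnat₂ 0 (by simp), hσ01])
    (by rw [hnat₂ 0 (by simp), hσ00]) (by omega) (by omega) (by omega)
    (fun h hh => (hlen₂ ⟨h, hh⟩).trans_le (hLm _ (List.getElem_mem hh)))
  refine Exec.bind h₃ ?_
  have hnat₃ : ∀ b, b ≤ 2 → σ₃.nat b = σ.nat b := fun b hb => by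
    rw [h₃.natEq b (by simp [pointsP]; omega), hnat₂ b (by omega)]
  have hfld₃ : ∀ b, b ≤ 1 → σ₃.fld b = σ.fld b := fun b hb => by
    rw [h₃.fldEq b (by simp [pointsP]; omega), hfld₂ b (by omega)]
  let P : Fin (L.length + I.card) → Pt F m := Fin.append
    (fun l : Fin L.length => ptOf a L[l] (hLm _ (List.getElem_mem l.2))) (fun l => (eI l).1)
  have hPlen : ∀ k : Fin (L.length + I.card), σ₃.nat 4 k 0 = (P k).1 := by
    refine Fin.addCases (fun l => ?_) fun l => ?_
    · simp only [P, Fin.append_left]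
      rw [Fin.val_castAdd, (hR₃ l l.2).1, hlen₂]
      rfl
    · simp only [P, Fin.append_right]
      rw [Fin.val_natAdd, (hI₃ l l.2).1, hnat₂ 2 (by simp)]
      simp [hσ, inputMem, l.2]
  have hPpts : ∀ (k : Fin (L.length + I.card)) (j : Fin (P k).1), σ₃.fld 2 k j = (P k).2 j := by
    refine Fin.addCases (fun l => ?_) fun l => ?_
    · rw [show P (Fin.castAdd I.card l) = ptOf a L[l] (hLm _ (List.getElem_mem l.2)) from
        Fin.append_left _ _ l]
      intro j
      have hj : (j : ℕ) < σ₂.nat lenA l 0 := by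
        rw [hlen₂]
        exact j.2
      rw [Fin.val_castAdd, (hR₃ l l.2).2 j hj, hfld₂ 0 (by simp), ← Mem.getD_tuple _ hj, htuple₂,
        ← ha]
      rfl
    · rw [show P (Fin.natAdd L.length l) = (eI l).1 from Fin.append_right _ _ l]
      intro j
      rw [Fin.val_natAdd, (hI₃ l l.2).2 j (by omega), hfld₂ 1 (by simp)]
      exact inputMem_pts eA eI l j
  -- the second search
  let K' : ℕ → ℕ := fun i => σ.nat 1 i 0 + 1
  have hK'eq : ∀ i : Fin m, K' i = d i + 1 := fun i => by simp [K', hσ, inputMem]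
  have hK' : ∀ i, K' i ≤ D + 1 := fun i => by
    by_cases hi : i < m
    · have h₁ := hK'eq ⟨i, hi⟩
      have h₂ := hdD ⟨i, hi⟩
      simp only at h₁
      omega
    · simp [K', hσ, inputMem, hi]
  have spec₃ : SearchSpec M powerSumP (.add (.get 1 (var lvlV) (.lit 0)) (.lit 1)) σ₃ m
      (L.length + I.card) K' (powerSumFactor c a (fun l => σ₃.nat 4 l 0) (σ₃.fld 2)) := by
    have hcomp : Computes M powerSumP σ₃ m (L.length + I.card) K' (powerSumFactor
        (fun i => σ₃.nat 1 i 1) (σ₃.fld 0) (fun l => σ₃.nat 4 l 0) (σ₃.fld 2)) :=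
      computes_powerSumP (fun i _ => by
        have := hcD i
        simp only [hc] at this
        rw [hnat₃ 1 (by simp)]
        omega) fun i _ => by
          have := hK' i
          omega
    rw [hnat₃ 1 (by simp), hfld₃ 0 (by simp), ← hc, ← ha] at hcomp
    refine ⟨hcomp, fun ρ hρ _ => ?_, ?_, hdim₃, by omega, by omega,
      fun i _ => ?_, fun l hl => ?_⟩
    · simp [hρ.nat 1 (by simp), hnat₃ 1, K']
    · rw [hnat₃ 0 (by simp), hσ00]
    · have := hK' i
      omega
    · have := hlist (powerSumFactor c a (fun l => σ₃.nat 4 l 0) (σ₃.fld 2)) K' (L.length + I.card) l hl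
        fun i _ => hK' i
      omega
  obtain ⟨τ, hτ, hker, -⟩ := Exec.exists_searchP spec₃
  have hinτ : SameInput σ₃ τ := hτ.sameOff.sameInput
    ⟨fun b hb => by simp [searchP, spec₃.fac.keepsInput_levelP.nat b hb]; omega,
      by simp [searchP, spec₃.fac.keepsInput_levelP.dim],
      fun b hb => by simp [searchP, spec₃.fac.keepsInput_levelP.fld b hb]⟩
  refine ⟨τ, hτ, by rw [hinτ.nat 3 (by simp), hout₃], by rw [hinτ.nat 3 (by simp), hout₃'],
    fun h => ⟨?_, fun i hi => ?_⟩, fun b => ?_⟩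
  · rw [hinτ.nat 4 (by simp), (hR₃ h h.2).1, hlen₂]
  · have hi' : i < σ₂.nat lenA h 0 := by rwa [hlen₂]
    rw [hinτ.fld 2 (by simp), (hR₃ h h.2).2 i hi', hfld₂ 0 (by simp), ← Mem.getD_tuple _ hi',
      htuple₂, ← ha]
  · rw [span_vec_powerSumFactor hA hPlen hPpts hK'eq] at hker
    rw [← Matrix.mulVecLin_apply, ← LinearMap.mem_ker, hker, Submodule.mem_map]
    refine exists_congr fun p => and_congr_right fun _ => ?_
    rw [funext_iff]
    rfl

end Locator

/-! ### The size of the constraint system and the running time -/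

theorem fieldCost_eq (F : Type*) [Field F] [Fintype F] :
    fieldCost F = (Nat.log 2 (Fintype.card F) + 1) ^ 2 := by
  have hF : Fintype.card F ≠ 0 := Fintype.card_ne_zero
  rw [fieldCost]
  congr 1
  refine le_antisymm (Nat.size_le.2 (Nat.lt_pow_succ_log_self one_lt_two _)) ?_
  exact Nat.lt_size.2 (Nat.pow_log_le_self 2 hF)

/-- The running time of a program whose loops have at most `iterBound m D n` iterations is a
polynomial in the logarithm of the field size and the three parameters. -/
theorem Prog.exists_bound_iterBound_eq_eval (P : Prog) : ∃ p : MvPolynomial (Fin 4) ℕ,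
    ∀ b m D n, MvPolynomial.eval ![b, m, D, n] p = P.bound ((b + 1) ^ 2) (iterBound m D n) := by
  obtain ⟨Q, hQ⟩ := P.exists_bound_eq_eval
  refine ⟨MvPolynomial.bind₁ ![(.X 0 + 1) ^ 2, iterBound (.X 1) (.X 2) (.X 3)] Q,
    fun b m D n => ?_⟩
  rw [← hQ, MvPolynomial.eval, MvPolynomial.eval₂Hom_bind₁]
  congr 2
  funext i
  fin_cases i <;> simp [iterBound]

theorem card_le_of_le_one_add_mul {L n m a : ℕ} (hm : 1 ≤ m) (hn : n = 0 → L = 0)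
    (h : L ≤ 1 + m * (n * a)) : L ≤ n * m * (m * (a + 1) + 1) ^ 2 := by
  obtain rfl | hn' := n.eq_zero_or_pos
  · rw [hn rfl]
    exact Nat.zero_le _
  · have h₁ : 1 ≤ n * m := Nat.mul_pos hn' hm
    have h₂ : a + 1 ≤ (m * (a + 1) + 1) ^ 2 :=
      (Nat.le_mul_of_pos_left _ hm).trans ((Nat.le_succ _).trans (Nat.le_self_pow two_ne_zero _))
    calc L ≤ 1 + n * m * a := h.trans_eq (by ring)
      _ ≤ n * m * (a + 1) := by rw [mul_add, mul_one, add_comm]; omega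
      _ ≤ _ := Nat.mul_le_mul_left _ h₂

theorem mainTheorem5 :
    ∃ (P : Prog) (p : MvPolynomial (Fin 4) ℕ),
      ∀ (F : Type*) [Field F] [Fintype F] (m : ℕ) (_hm : 1 ≤ m) (d : Fin m → ℕ)
        (A : Fin m → Finset F) (eA : ∀ i, Fin (A i).card ≃ A i)
        (hd : ∀ i, 2 * ((A i).card - 1) ≤ d i),
        IsSumRMConstraintLocator P A eA d (fun i => by have := hd i; omega)
          (fun n => MvPolynomial.eval
            ![Nat.log 2 (Fintype.card F), m, Finset.univ.sup d, n] p)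
          (fun n => n * m * (m * ((Finset.univ.sup fun i => (A i).card) + 1) + 1) ^ 2) := by
  obtain ⟨p, hp⟩ := locatorP.exists_bound_iterBound_eq_eval
  refine ⟨locatorP, p, fun F _ _ m hm d A eA hd => ⟨nonempty_linearForm A d _, fun I eI => ?_⟩⟩
  have hA := isListing_inputMem (d := d) eA eI
  set c : ℕ → ℕ := fun i => (inputMem d A eA I eI).nat 1 i 1 with hc
  set a := (inputMem d A eA I eI).fld 0 with ha
  set x := (inputMem d A eA I eI).fld 1 with hx
  obtain ⟨L, hL⟩ : ∃ L, L = Trie.upTo (lagrangeFactor c a x) c I.card m := ⟨_, rfl⟩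
  have hLm : ∀ κ ∈ L, κ.length ≤ m := fun κ hκ => Trie.length_le_of_mem_upTo (hL ▸ hκ)
  have hlt : ∀ κ ∈ L, ∀ i < κ.length, κ.getD i 0 < c i := fun κ hκ i hi => by
    obtain ⟨l, -, hl⟩ := Trie.mem_upTo.1 (hL ▸ hκ)
    have hκl := Trie.mem_full_of_mem_level hl
    exact hκl.2 i (hκl.1 ▸ hi)
  obtain ⟨τ, ⟨s, hs, hst⟩, hout, hout', hpts, hmat⟩ :=
    Exec.exists_locatorP hd eA eI hc ha hx hL hLm
  -- the points with the listed index tuples, as a set of message positions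
  let rpt : Fin L.length → SumDom A := fun l => ⟨ptOf a L[l] (hLm _ (List.getElem_mem l.2)),
    fun j => (hA.mem_iff _ _).2 ⟨_, hlt _ (List.getElem_mem l.2) j j.2, rfl⟩⟩
  have hrpt : Function.Injective rpt := fun l l' h => by
    have h' : ptOf a L[l] (hLm _ (List.getElem_mem l.2)) =
        ptOf a L[l'] (hLm _ (List.getElem_mem l'.2)) := congrArg Subtype.val h
    have hL' : L.Nodup := hL ▸ Trie.nodup_upTo m
    refine Fin.ext ((List.Nodup.getElem_inj_iff hL').1 (eq_of_ptOf_eq hA (hlt _ ?_) (hlt _ ?_) h')) <;>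
      exact List.getElem_mem _
  let R : Finset (SumDom A) := univ.map ⟨rpt, hrpt⟩
  have hR : R.card = L.length := by simp [R]
  let eR : Fin R.card ≃ R := (finCongr hR).trans <|
    (Equiv.ofInjective rpt hrpt).trans <| Equiv.subtypeEquivRight fun s => by simp [R]
  have hmat' : ∀ (r : ℕ) (hr : r = L.length) (b : Fin (r + I.card) → F),
      (τ.mat (r + I.card)).mulVec b = 0 ↔ ∃ p ∈ lowDeg F d, ∀ j, polySums A p
        (Fin.append (fun l => (rpt (finCongr hr l)).1) (fun l => (eI l).1) j) = b j := by
    rintro _ rfl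
    exact hmat
  refine ⟨R, R.card + I.card, _, τ, s, hs, ?_, ⟨hR ▸ hout, hR ▸ hout', eR, fun l => ?_,
    fun i => ⟨fun l => ?_, fun l => ?_⟩⟩, ?_,
    fun E => isConstraintSystem_of_ker E eI eR (τ.mat (R.card + I.card)) (hmat' _ hR) fun g hg => ?_⟩
  · beta_reduce
    rw [hp, ← fieldCost_eq]
    exact hst
  · have h := hpts (finCongr hR l)
    exact ⟨h.1, fun j => h.2 j j.2⟩
  · simp [Mem.mat]
  · simp [Mem.mat]
  · rw [hR]
    refine card_le_of_le_one_add_mul hm (fun h => ?_) ?_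
    · rw [hL, h, Trie.upTo_zero, List.length_nil]
    · rw [hL]
      refine (Trie.length_upTo_le m).trans (Nat.add_le_add_left ?_ 1)
      refine (sum_le_card_nsmul _ _ (I.card * univ.sup fun i => (A i).card) fun i hi => ?_).trans_eq
        (by rw [card_range, smul_eq_mul])
      refine Nat.mul_le_mul_left _ ?_
      rw [hA.card ⟨i, mem_range.1 hi⟩]
      exact le_sup (f := fun i => (A i).card) (mem_univ _)
  · -- without points the search visits no prefix at all, and any extension will do
    obtain h | h := I.card.eq_zero_or_pos
    · obtain ⟨p, hp⟩ := lowDegExt_nonempty A d (fun i => by have := hd i; omega) fun z => g z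
      refine ⟨p, hp, fun x hx => ?_⟩
      rw [card_eq_zero.1 h] at hx
      exact absurd hx (notMem_empty x)
    · obtain ⟨p, hp, hpg, hpI⟩ := extendsFrom_of_mem_level hA hd (P := fun k => (eI k).1) (x := x)
        (inputMem_pts eA eI) (g := g) (fun κ hκ hκm => by
          obtain ⟨l, hl, rfl⟩ := List.getElem_of_mem (hL ▸ hκ : κ ∈ L)
          exact hg (rpt ⟨l, hl⟩) (mem_map_of_mem _ (mem_univ _))) (Nat.zero_le m) []
        (by simp [Trie.level, h.ne'])
      refine ⟨p, ⟨hp, fun z => (hpg z z.2).1 fun i hi => absurd hi (Nat.not_lt_zero _)⟩,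
        fun y hy => ?_⟩
      simpa using hpI (eI.symm ⟨y, hy⟩)
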